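/- Let $n>4$ and let $\eta:\mathbb{R}\to[0,1]$ be a smooth function with $\eta\equiv 0$ on $]-\infty,\frac12[$ and $\eta\equiv 1$ on $[1,\infty[$. Then there is a constant $\widetilde c=\widetilde c(n,\eta)>0$, depending only on $n$ and $\eta$, such that the following holds. Let $G$ be a connected compact semisimple (finite-dimensional) Lie group with Lie algebra $\mathfrak g$, equipped with the negative Killing form $\langle Y,Z\rangle=-\mathrm{tr}(\mathrm{ad}_Y\circ\mathrm{ad}_Z)$; let $V$ be a finite-dimensional real inner product space and $\rho:G\to GL(V)$ a smooth representation leaving the inner product of $V$ invariant; write $Y\cdot v$ for the action of $\mathfrak g$ on $V$ obtained by differentiating $\rho$ at the identity, and $\odot:V\times V\to\mathfrak g$ for the bilinear map with $\langle Y,u_1\odot u_2\rangle=\langle Y\cdot u_1,u_2\rangle$ for all $Y\in\mathfrak g$. Let $W\in C^1(\mathbb{R})$ with $W\ge 0$. For $A=(A_1,\dots,A_n):\mathbb{R}^n\to\mathfrak g^n$ and $u:\mathbb{R}^n\to V$ put $$F_{ij}=\partial_iA_j-\partial_jA_i+[A_i,A_j],\quad \nabla_i=\partial_i+[A_i,\cdot\,],\quad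 D_iu=\partial_iu+A_i\cdot u,$$ $$e(A,u)=\tfrac12\Big(\sum_{i<j}|F_{ij}|^2+\sum_i|D_iu|^2\Big)+W(|u|^2).$$ Let $a,T\in\mathbb{R}$, $X\in\mathbb{R}^n$, and let $\{(A(\cdot,t),u(\cdot,t))\}_{t\in[a,T[}$ be a family, smooth on $\mathbb{R}^n\times[a,T[$, that evolves by the Yang–Mills–Higgs flow, i.e. on $\mathbb{R}^n\times\,]a,T[$ $$\partial_tA_j=\sum_i\nabla_iF_{ij}-u\odot D_ju,\qquad \partial_tu=\sum_iD_i^2u-2W'(|u|^2)u.$$ Put $$\mathcal S^A_j=\partial_tA_j+\sum_k\frac{(x-X)^k}{2(t-T)}F_{kj},\qquad \mathcal J^u=\partial_tu+\sum_k\frac{(x-X)^k}{2(t-T)}D_ku,$$ $$\Phi(x,t)=\frac{1}{(4\pi(T-t))^{\frac{n-4}{2}}}\exp\Big(\frac{|x-X|^2}{4(t-T)}\Big),\qquad E_r=\{(x,t)\in\mathbb{R}^n\times\,]-\infty,T[\;:\;\Phi(x,t)>r^{-(n-4)}\},$$ $c_n=\sqrt{\frac{n-4}{2\pi e}}$, and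 $R_r(\tau)=\sqrt{2(n-4)\tau\log\big(-\frac{4\pi\tau}{r^2}\big)}$ for $\tau\in\,]-\frac{r^2}{4\pi},0[$. Then, for every $r\in\,]0,\sqrt{4\pi(T-a)}[$ (the integrals being taken in $[0,\infty]$), $$\iint_{E_r}\Big(\sum_{j}|\mathcal S^A_j|^2+|\mathcal J^u|^2\Big)\,dx\,dt\le \frac{2\widetilde c}{r^{2}}\int_{T-\frac{r^2}{4\pi}}^{T}\int_{B_{2c_nr}(X)}e(A,u)(x,t)\,dx\,dt+2\int_{B_{2c_nr}(X)}e(A,u)\big(x,T-\tfrac{r^2}{4\pi}\big)\,dx,$$ and, for every $t\in\,\big]T-e^{-\frac{1}{2(n-4)}}\frac{r^2}{4\pi},T\big[$, $$\frac{1}{R_r(t-T)^{n-4}}\int_{B_{R_r(t-T)}(X)}e(A,u)(x,t)\,dx\le(4\pi)^{\frac{n-4}{2}}e^{\frac14}\Big(\frac{\widetilde c}{r^{n-2}}\int_{T-\frac{r^2}{4\pi}}^{T}\int_{B_{2c_nr}(X)}e(A,u)(x,s)\,dx\,ds+\frac{1}{r^{n-4}}\int_{B_{2c_nr}(X)}e(A,u)\big(x,T-\tfrac{r^2}{4\pi}\big)\,dx\Big).$$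 -/

import Mathlib

open scoped Manifold ContDiff

namespace YMH

/-- A real smooth Lie group is `C³`, the regularity from which Mathlib builds its Lie algebra. -/
instance leInfty_minSmoothness : ENat.LEInfty (minSmoothness ℝ 3) :=
  ⟨by rw [minSmoothness_of_isRCLikeNormedField]; exact ENat.LEInfty.out⟩

/-- `ℝᵏ` with its Euclidean norm. -/
abbrev Eu (k : ℕ) : Type := EuclideanSpace ℝ (Fin k)

noncomputable section

section Algebra

/- `G` is a Lie group of dimension `d`. Its Lie algebra is Mathlib's `GroupLieAlgebra (𝓡 d) G`, the
tangent space at the identity, which by definition is a copy of the model space `Eu d`. Fields with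
values in the Lie algebra are written as `Eu d`-valued functions (`Eu d` carries the norm needed for
differential calculus), and the bracket and the Killing form are those of `GroupLieAlgebra`. -/
variable {d : ℕ} (G : Type*) [Group G] [TopologicalSpace G] [ChartedSpace (Eu d) G]
  [LieGroup (𝓡 d) ∞ G]

/-- The identification of the model space with the Lie algebra `T_1 G`, which is definitional. -/
def toLie (Y : Eu d) : GroupLieAlgebra (𝓡 d) G := Y

/-- The Lie bracket of the Lie algebra of `G`. -/
def lieBracket (Y Z : Eu d) : Eu d :=
  (⁅toLie G Y, toLie G Z⁆ : GroupLieAlgebra (𝓡 d) G)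

/-- The negative Killing form `⟨Y, Z⟩ = -tr (ad Y ∘ ad Z)`. -/
def gInner (Y Z : Eu d) : ℝ :=
  -killingForm ℝ (GroupLieAlgebra (𝓡 d) G) (toLie G Y) (toLie G Z)

variable {G}
variable {V : Type*} [NormedAddCommGroup V] [InnerProductSpace ℝ V]

/-- The derivative of `ρ` at the identity. -/
def dRep (ρ : G →* (V →L[ℝ] V)) : GroupLieAlgebra (𝓡 d) G →L[ℝ] (V →L[ℝ] V) :=
  mfderiv (𝓡 d) 𝓘(ℝ, V →L[ℝ] V) ρ 1

/-- The action `Y · v` of the Lie algebra on `V`, obtained by differentiating `ρ`. -/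
def act (ρ : G →* (V →L[ℝ] V)) (Y : Eu d) (v : V) : V := dRep ρ (toLie G Y) v

open Classical in
/-- `u₁ ⊙ u₂` is the element of the Lie algebra with `⟨Y, u₁ ⊙ u₂⟩ = ⟨Y · u₁, u₂⟩` for all `Y`; for a
compact semisimple `G` there is exactly one, as the negative Killing form is positive definite. -/
def odot (ρ : G →* (V →L[ℝ] V)) (u₁ u₂ : V) : Eu d :=
  if h : ∃ Z : Eu d, ∀ Y : Eu d, gInner G Y Z = inner ℝ (act ρ Y u₁) u₂ then h.choose else 0

end Algebra

/-- The `i`th partial derivative of a function on `ℝⁿ`. -/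
def pd {n : ℕ} {F : Type*} [NormedAddCommGroup F] [NormedSpace ℝ F]
    (i : Fin n) (f : Eu n → F) (x : Eu n) : F :=
  fderiv ℝ f x (EuclideanSpace.single i 1)

section Fields

variable {n d : ℕ} (G : Type*) [Group G] [TopologicalSpace G] [ChartedSpace (Eu d) G]
  [LieGroup (𝓡 d) ∞ G]

/-- The curvature `F_ij = ∂_i A_j - ∂_j A_i + [A_i, A_j]` of `A = ∑ A_i dx^i`. -/
def curv (A : Fin n → Eu n → Eu d) (i j : Fin n) (x : Eu n) : Eu d :=
  pd i (A j) x - pd j (A i) x + lieBracket G (A i x) (A j x)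

/-- The gauge-covariant partial derivative `∇_i Y = ∂_i Y + [A_i, Y]`. -/
def nabla (A : Fin n → Eu n → Eu d) (i : Fin n) (Y : Eu n → Eu d) (x : Eu n) : Eu d :=
  pd i Y x + lieBracket G (A i x) (Y x)

variable {G}
variable {V : Type*} [NormedAddCommGroup V] [InnerProductSpace ℝ V]

/-- The gauge-covariant partial derivative `∂_i u + A_i · u` of a scalar field. -/
def snabla (ρ : G →* (V →L[ℝ] V)) (A : Fin n → Eu n → Eu d) (i : Fin n) (u : Eu n → V)
    (x : Eu n) : V :=
  pd i u x + act ρ (A i x) (u x)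

/-- The energy density `e(A,u) = ½ (∑_{i<j} |F_ij|² + ∑_i |∇̸_i u|²) + W(|u|²)`. -/
def energy (ρ : G →* (V →L[ℝ] V)) (W : ℝ → ℝ) (A : Fin n → Eu n → Eu d) (u : Eu n → V)
    (x : Eu n) : ℝ :=
  1 / 2 * ((∑ i, ∑ j ∈ Finset.Ioi i, gInner G (curv G A i j x) (curv G A i j x))
    + ∑ i, ‖snabla ρ A i u x‖ ^ 2) + W (‖u x‖ ^ 2)

/-- The family of pairs `(A t, u t)`, `t ∈ [a, b)`, is smooth on `ℝⁿ × [a, b)` and evolves by the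
Yang-Mills-Higgs flow with potential `W`:
`∂_t A_j = ∑_i ∇_i F_ij - u ⊙ ∇̸_j u` and `∂_t u = ∑_i ∇̸_i² u - 2 W'(|u|²) u` on `ℝⁿ × (a, b)`. -/
structure IsFlow (ρ : G →* (V →L[ℝ] V)) (W : ℝ → ℝ) (a b : ℝ)
    (A : ℝ → Fin n → Eu n → Eu d) (u : ℝ → Eu n → V) : Prop where
  smooth_A : ∀ j, ContDiffOn ℝ ∞ (fun p : Eu n × ℝ => A p.2 j p.1) (Set.univ ×ˢ Set.Ico a b)
  smooth_u : ContDiffOn ℝ ∞ (fun p : Eu n × ℝ => u p.2 p.1) (Set.univ ×ˢ Set.Ico a b)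
  eq_A : ∀ t ∈ Set.Ioo a b, ∀ x j,
    deriv (fun s => A s j x) t
      = ∑ i, nabla G (A t) i (curv G (A t) i j) x - odot ρ (u t x) (snabla ρ (A t) j (u t) x)
  eq_u : ∀ t ∈ Set.Ioo a b, ∀ x,
    deriv (fun s => u s x) t
      = ∑ i, snabla ρ (A t) i (snabla ρ (A t) i (u t)) x
        - (2 * deriv W (‖u t x‖ ^ 2)) • u t x

variable (G) in
/-- `S^A_j(x,t) = ∂_t A_j + ∑_k (x - X)^k / (2 (t - T)) F_kj`. -/
def selfSimA (X : Eu n) (T : ℝ) (A : ℝ → Fin n → Eu n → Eu d) (j : Fin n) (x : Eu n) (t : ℝ) :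
    Eu d :=
  deriv (fun s => A s j x) t + ∑ k, ((x k - X k) / (2 * (t - T))) • curv G (A t) k j x

/-- `J^u(x,t) = ∂_t u + ∑_k (x - X)^k / (2 (t - T)) ∇̸_k u`. -/
def selfSimU (ρ : G →* (V →L[ℝ] V)) (X : Eu n) (T : ℝ) (A : ℝ → Fin n → Eu n → Eu d)
    (u : ℝ → Eu n → V) (x : Eu n) (t : ℝ) : V :=
  deriv (fun s => u s x) t + ∑ k, ((x k - X k) / (2 * (t - T))) • snabla ρ (A t) k (u t) x

/-- `∑_j |S^A_j|² + |J^u|²` at `(x, t)`. -/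
def selfSimSq (ρ : G →* (V →L[ℝ] V)) (X : Eu n) (T : ℝ) (A : ℝ → Fin n → Eu n → Eu d)
    (u : ℝ → Eu n → V) (x : Eu n) (t : ℝ) : ℝ :=
  (∑ j, gInner G (selfSimA G X T A j x t) (selfSimA G X T A j x t))
    + ‖selfSimU ρ X T A u x t‖ ^ 2

end Fields

/-- The weighted backward heat kernel
`Φ_(X,T)(x,t) = (4π(T-t))^(-(n-4)/2) exp (|x-X|² / (4(t-T)))`, for `t < T`. -/
def heatKer {n : ℕ} (X : Eu n) (T : ℝ) (x : Eu n) (t : ℝ) : ℝ :=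
  1 / (4 * Real.pi * (T - t)) ^ (((n : ℝ) - 4) / 2) * Real.exp (‖x - X‖ ^ 2 / (4 * (t - T)))

/-- The weighted heat ball `E_r(X,T) = {(x,t) : t < T, Φ_(X,T)(x,t) > 1 / r^(n-4)}`. -/
def heatBall {n : ℕ} (r : ℝ) (X : Eu n) (T : ℝ) : Set (Eu n × ℝ) :=
  {p | p.2 < T ∧ 1 / r ^ (n - 4) < heatKer X T p.1 p.2}

/-- `R_r(τ) = √(2 (n-4) τ log (-4πτ / r²))`, for `-r²/(4π) < τ < 0`. -/
def heatRadius (n : ℕ) (r τ : ℝ) : ℝ :=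
  Real.sqrt (2 * ((n : ℝ) - 4) * τ * Real.log (-(4 * Real.pi * τ) / r ^ 2))

/-- `c_n = √((n-4) / (2πe))`. -/
def cBall (n : ℕ) : ℝ := Real.sqrt (((n : ℝ) - 4) / (2 * Real.pi * Real.exp 1))

section Integrals

variable {n d : ℕ} {G : Type*} [Group G] [TopologicalSpace G] [ChartedSpace (Eu d) G]
  [LieGroup (𝓡 d) ∞ G] {V : Type*} [NormedAddCommGroup V] [InnerProductSpace ℝ V]

/- All integrands are nonnegative, so that the integrals are taken with values in `[0, ∞]`. -/

/-- The energy `∫_{B_R(X)} e(A,u)(x,t) dx` at time `t`. -/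
def ballEnergy (ρ : G →* (V →L[ℝ] V)) (W : ℝ → ℝ) (A : ℝ → Fin n → Eu n → Eu d)
    (u : ℝ → Eu n → V) (X : Eu n) (R t : ℝ) : ENNReal :=
  ∫⁻ x in Metric.ball X R, ENNReal.ofReal (energy ρ W (A t) (u t) x)

/-- The space-time energy `∫_{T - r²/4π}^T ∫_{B_{2 c_n r}(X)} e(A,u)(x,t) dx dt`. -/
def cylEnergy (ρ : G →* (V →L[ℝ] V)) (W : ℝ → ℝ) (A : ℝ → Fin n → Eu n → Eu d)
    (u : ℝ → Eu n → V) (X : Eu n) (T r : ℝ) : ENNReal :=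
  ∫⁻ t in Set.Ioo (T - r ^ 2 / (4 * Real.pi)) T, ballEnergy ρ W A u X (2 * cBall n * r) t

end Integrals

end

end YMH

namespace YMH
noncomputable section

section Calculus

variable {E F : Type*} [NormedAddCommGroup E] [NormedSpace ℝ E] [NormedAddCommGroup F]
  [NormedSpace ℝ F]

/-- The second partial differential of `m` in the direction `z`, along `y = p`. -/
def rightDeriv (m : E × E → E) (p : E) (z : E) (x : E) : E := fderiv ℝ m (x, p) (0, z)

theorem eventually_fst_slice {E : Type*} [TopologicalSpace E] {p : E} {P : E × E → Prop} (h : ∀ᶠ q in nhds (p, p), P q) :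
    ∀ᶠ x in nhds p, ∀ᶠ y in nhds p, P (x, y) := by
  rw [nhds_prod_eq] at h
  exact h.curry

theorem fderiv_mixed_of_conj {m C : E × E → E} {p : E}
    (hm : ContDiffAt ℝ 2 m (p, p)) (hC : ContDiffAt ℝ 2 C (p, p))
    (hcomm : ∀ᶠ q in nhds (p, p), m (C q, q.1) = m q)
    (hCr : ∀ᶠ x in nhds p, C (x, p) = p) (hCl : ∀ᶠ y in nhds p, C (p, y) = y)
    (hml : ∀ᶠ x in nhds p, m (x, p) = x) (y z : E) :
    fderiv ℝ (rightDeriv C p z) p y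
      = fderiv ℝ (rightDeriv m p z) p y - fderiv ℝ (rightDeriv m p y) p z := by
  have hCpp : C (p, p) = p := hCl.self_of_nhds
  have hm' : DifferentiableAt ℝ (fderiv ℝ m) (p, p) :=
    (hm.fderiv_right (m := 1) (by norm_num)).differentiableAt (by norm_num)
  have hC' : DifferentiableAt ℝ (fderiv ℝ C) (p, p) :=
    (hC.fderiv_right (m := 1) (by norm_num)).differentiableAt (by norm_num)
  have hi : HasFDerivAt (fun x : E => (x, p)) (ContinuousLinearMap.inl ℝ E E) p :=
    (hasFDerivAt_id p).prodMk (hasFDerivAt_const p p)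
  have hj : HasFDerivAt (fun x : E => (p, x)) (ContinuousLinearMap.inr ℝ E E) p :=
    (hasFDerivAt_const p p).prodMk (hasFDerivAt_id p)
  have dR : ∀ w, HasFDerivAt (rightDeriv m p w)
      ((ContinuousLinearMap.apply ℝ E ((0 : E), w)).comp ((fderiv ℝ (fderiv ℝ m) (p, p)).comp
        (ContinuousLinearMap.inl ℝ E E))) p := fun w =>
    (ContinuousLinearMap.apply ℝ E ((0 : E), w)).hasFDerivAt.comp p
      (hm'.hasFDerivAt.comp (f := fun x : E => (x, p)) p hi)
  have dC : HasFDerivAt (rightDeriv C p z)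
      ((ContinuousLinearMap.apply ℝ E ((0 : E), z)).comp ((fderiv ℝ (fderiv ℝ C) (p, p)).comp
        (ContinuousLinearMap.inl ℝ E E))) p :=
    (ContinuousLinearMap.apply ℝ E ((0 : E), z)).hasFDerivAt.comp p
      (hC'.hasFDerivAt.comp (f := fun x : E => (x, p)) p hi)
  have dL : HasFDerivAt (fun x => fderiv ℝ m (p, x))
      ((fderiv ℝ (fderiv ℝ m) (p, p)).comp (ContinuousLinearMap.inr ℝ E E)) p :=
    hm'.hasFDerivAt.comp p hj
  have key : (fun x => fderiv ℝ m (p, x) (rightDeriv C p z x, 0)) =ᶠ[nhds p]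
      rightDeriv m p z := by
    have hmd : ∀ᶠ q in nhds (p, p), DifferentiableAt ℝ m q :=
      (hm.eventually (by norm_num)).mono fun q hq => hq.differentiableAt (by norm_num)
    have hCd : ∀ᶠ q in nhds (p, p), DifferentiableAt ℝ C q :=
      (hC.eventually (by norm_num)).mono fun q hq => hq.differentiableAt (by norm_num)
    have e1 := hj.continuousAt.eventually hmd
    have e2 := hi.continuousAt.eventually hCd
    have e3 := hi.continuousAt.eventually hmd
    filter_upwards [eventually_fst_slice hcomm, hCr, e1, e2, e3] with x hx hxr h1 h2 h3
    have hjx : HasFDerivAt (fun y : E => (x, y)) (ContinuousLinearMap.inr ℝ E E) p :=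
      (hasFDerivAt_const x p).prodMk (hasFDerivAt_id p)
    have c1 : HasFDerivAt (fun y : E => C (x, y))
        ((fderiv ℝ C (x, p)).comp (ContinuousLinearMap.inr ℝ E E)) p :=
      h2.hasFDerivAt.comp p hjx
    have c2 : HasFDerivAt (fun y : E => (C (x, y), x))
        (((fderiv ℝ C (x, p)).comp (ContinuousLinearMap.inr ℝ E E)).prod 0) p :=
      c1.prodMk (hasFDerivAt_const x p)
    have c3 : HasFDerivAt (fun y : E => m (C (x, y), x))
        ((fderiv ℝ m (p, x)).comp
          (((fderiv ℝ C (x, p)).comp (ContinuousLinearMap.inr ℝ E E)).prod 0)) p := by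
      have h1' : HasFDerivAt m (fderiv ℝ m (p, x)) (C (x, p), x) := by
        rw [hxr]; exact h1.hasFDerivAt
      exact h1'.comp p c2
    have c4 : HasFDerivAt (fun y : E => m (x, y))
        ((fderiv ℝ m (x, p)).comp (ContinuousLinearMap.inr ℝ E E)) p := h3.hasFDerivAt.comp p hjx
    have := (c3.congr_of_eventuallyEq (hx.mono fun y hy => hy.symm)).unique c4
    simpa [rightDeriv] using congrArg (fun L => L z) this
  have dprod : HasFDerivAt (fun x => (rightDeriv C p z x, (0 : E)))
      (((ContinuousLinearMap.apply ℝ E ((0 : E), z)).comp ((fderiv ℝ (fderiv ℝ C) (p, p)).comp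
        (ContinuousLinearMap.inl ℝ E E))).prod 0) p := dC.prodMk (hasFDerivAt_const 0 p)
  have d1 := dL.clm_apply dprod
  have hu := congrArg (fun L => L y) ((d1.congr_of_eventuallyEq key.symm).unique (dR z))
  have hCz : rightDeriv C p z p = z := by
    have : HasFDerivAt (fun y : E => C (p, y))
        ((fderiv ℝ C (p, p)).comp (ContinuousLinearMap.inr ℝ E E)) p :=
      (hC.differentiableAt (by norm_num)).hasFDerivAt.comp p hj
    have := (((hasFDerivAt_id p).congr_of_eventuallyEq hCl)).unique this
    simpa [rightDeriv] using (congrArg (fun L => L z) this).symm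
  have hmz : ∀ w, fderiv ℝ m (p, p) (w, 0) = w := fun w => by
    have h : HasFDerivAt (fun y : E => m (y, p))
        ((fderiv ℝ m (p, p)).comp (ContinuousLinearMap.inl ℝ E E)) p :=
      (hm.differentiableAt (by norm_num)).hasFDerivAt.comp (f := fun x : E => (x, p)) p hi
    have := (((hasFDerivAt_id p).congr_of_eventuallyEq hml)).unique h
    simpa using (congrArg (fun L => L w) this).symm
  have hs : IsSymmSndFDerivAt ℝ m (p, p) := hm.isSymmSndFDerivAt (by simp)
  rw [(dR z).fderiv, (dR y).fderiv, dC.fderiv]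
  simp [hCz, hmz] at hu ⊢
  rw [← hu, hs.eq (z, 0) (0, y)]
  abel

theorem fderiv_lie_of_mul {m : E × E → E} {p : E} {R : Type*} [NormedRing R] [NormedAlgebra ℝ R]
    {f : E → R} (hm : ContDiffAt ℝ 2 m (p, p)) (hf : ContDiffAt ℝ 2 f p)
    (hmul : ∀ᶠ q in nhds (p, p), f (m q) = f q.1 * f q.2)
    (hmr : ∀ᶠ x in nhds p, m (x, p) = x) (hml : ∀ᶠ y in nhds p, m (p, y) = y) (y z : E) :
    fderiv ℝ f p (fderiv ℝ (rightDeriv m p z) p y - fderiv ℝ (rightDeriv m p y) p z)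
      = fderiv ℝ f p y * fderiv ℝ f p z - fderiv ℝ f p z * fderiv ℝ f p y := by
  have hm' : DifferentiableAt ℝ (fderiv ℝ m) (p, p) :=
    (hm.fderiv_right (m := 1) (by norm_num)).differentiableAt (by norm_num)
  have hf' : DifferentiableAt ℝ (fderiv ℝ f) p :=
    (hf.fderiv_right (m := 1) (by norm_num)).differentiableAt (by norm_num)
  have hi : HasFDerivAt (fun x : E => (x, p)) (ContinuousLinearMap.inl ℝ E E) p :=
    (hasFDerivAt_id p).prodMk (hasFDerivAt_const p p)
  have hj : HasFDerivAt (fun x : E => (p, x)) (ContinuousLinearMap.inr ℝ E E) p :=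
    (hasFDerivAt_const p p).prodMk (hasFDerivAt_id p)
  have dR : ∀ w, DifferentiableAt ℝ (rightDeriv m p w) p := fun w =>
    ((ContinuousLinearMap.apply ℝ E ((0 : E), w)).hasFDerivAt.comp p
      (hm'.hasFDerivAt.comp (f := fun x : E => (x, p)) p hi)).differentiableAt
  have hRp : ∀ w, rightDeriv m p w p = w := fun w => by
    have : HasFDerivAt (fun y : E => m (p, y))
        ((fderiv ℝ m (p, p)).comp (ContinuousLinearMap.inr ℝ E E)) p :=
      (hm.differentiableAt (by norm_num)).hasFDerivAt.comp p hj
    have := (((hasFDerivAt_id p).congr_of_eventuallyEq hml)).unique this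
    simpa [rightDeriv] using (congrArg (fun L => L w) this).symm
  have hfd : DifferentiableAt ℝ f p := hf.differentiableAt (by norm_num)
  have key : ∀ w, (fun x => fderiv ℝ f x (rightDeriv m p w x)) =ᶠ[nhds p]
      fun x => f x * fderiv ℝ f p w := fun w => by
    have hmd : ∀ᶠ q in nhds (p, p), DifferentiableAt ℝ m q :=
      (hm.eventually (by norm_num)).mono fun q hq => hq.differentiableAt (by norm_num)
    have hfd' : ∀ᶠ q in nhds p, DifferentiableAt ℝ f q :=
      (hf.eventually (by norm_num)).mono fun q hq => hq.differentiableAt (by norm_num)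
    filter_upwards [eventually_fst_slice hmul, hmr, hfd', hi.continuousAt.eventually hmd]
      with x hx hxr h1 h2
    have hjx : HasFDerivAt (fun y : E => (x, y)) (ContinuousLinearMap.inr ℝ E E) p :=
      (hasFDerivAt_const x p).prodMk (hasFDerivAt_id p)
    have c1 : HasFDerivAt (fun y : E => m (x, y))
        ((fderiv ℝ m (x, p)).comp (ContinuousLinearMap.inr ℝ E E)) p :=
      h2.hasFDerivAt.comp p hjx
    have h1' : HasFDerivAt f (fderiv ℝ f x) (m (x, p)) := by rw [hxr]; exact h1.hasFDerivAt
    have c2 := h1'.comp p c1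
    have c3 : HasFDerivAt (fun y : E => f x * f y) _ p := hfd.hasFDerivAt.const_mul (f x)
    have := (c2.congr_of_eventuallyEq (hx.mono fun y hy => hy.symm)).unique c3
    simpa [rightDeriv] using congrArg (fun L => L w) this
  have main : ∀ y w, fderiv ℝ (fderiv ℝ f) p y w + fderiv ℝ f p (fderiv ℝ (rightDeriv m p w) p y)
      = fderiv ℝ f p y * fderiv ℝ f p w := fun y w => by
    have d1 := hf'.hasFDerivAt.clm_apply (dR w).hasFDerivAt
    have d2 : HasFDerivAt (fun x => f x * fderiv ℝ f p w) _ p :=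
      hfd.hasFDerivAt.mul_const' (fderiv ℝ f p w)
    have := congrArg (fun L => L y) ((d1.congr_of_eventuallyEq (key w).symm).unique d2)
    simp [hRp] at this
    rw [← this, add_comm]
  have hs : IsSymmSndFDerivAt ℝ f p := hf.isSymmSndFDerivAt (by simp)
  rw [map_sub, ← main y z, ← main z y, hs.eq y z]
  abel

end Calculus

theorem contDiffAt_of_contMDiffAt_prod {E F F' : Type*} [NormedAddCommGroup E] [NormedSpace ℝ E]
    [NormedAddCommGroup F] [NormedSpace ℝ F] [NormedAddCommGroup F'] [NormedSpace ℝ F']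
    {f : E × F → F'} {x : E × F} {n : ℕ∞ω}
    (h : ContMDiffAt (𝓘(ℝ, E).prod 𝓘(ℝ, F)) 𝓘(ℝ, F') n f x) : ContDiffAt ℝ n f x := by
  rw [← contMDiffAt_iff_contDiffAt, modelWithCornersSelf_prod, ← chartedSpaceSelf_prod]
  exact h

theorem hasFDerivAt_unique_apply {E F : Type*} [NormedAddCommGroup E] [NormedSpace ℝ E]
    [NormedAddCommGroup F] [NormedSpace ℝ F] {f : E → F} {x : E} {L M : E →L[ℝ] F}
    (hL : HasFDerivAt f L x) (hM : HasFDerivAt f M x) (z : E) : L z = M z := by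
  rw [hL.unique hM]

section Chart

variable (d : ℕ) (G : Type*) [Group G] [TopologicalSpace G] [ChartedSpace (Eu d) G]

/-- The chart at the identity. -/
abbrev idChart : PartialEquiv G (Eu d) := extChartAt (𝓡 d) (1 : G)

/-- The image of the identity in the chart. -/
abbrev idPt : Eu d := idChart d G 1

/-- The multiplication in the chart at the identity. -/
def locMul (q : Eu d × Eu d) : Eu d :=
  idChart d G ((idChart d G).symm q.1 * (idChart d G).symm q.2)

/-- Conjugation in the chart at the identity. -/
def locConj (q : Eu d × Eu d) : Eu d :=
  idChart d G ((idChart d G).symm q.1 * (idChart d G).symm q.2 * ((idChart d G).symm q.1)⁻¹)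

theorem idChart_symm_idPt : (idChart d G).symm (idPt d G) = (1 : G) := extChartAt_to_inv _

theorem eventually_mem_target : ∀ᶠ x in nhds (idPt d G), x ∈ (idChart d G).target :=
  extChartAt_target_mem_nhds (I := 𝓡 d) (1 : G)

theorem locMul_left : ∀ᶠ x in nhds (idPt d G), locMul d G (x, idPt d G) = x := by
  filter_upwards [eventually_mem_target d G] with x hx
  simp only [locMul, idChart_symm_idPt, mul_one]
  exact (idChart d G).right_inv hx

theorem locMul_right : ∀ᶠ x in nhds (idPt d G), locMul d G (idPt d G, x) = x := by
  filter_upwards [eventually_mem_target d G] with x hx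
  simp only [locMul, idChart_symm_idPt, one_mul]
  exact (idChart d G).right_inv hx

theorem locConj_left (x : Eu d) : locConj d G (x, idPt d G) = idPt d G := by
  simp only [locConj, idChart_symm_idPt, mul_one, mul_inv_cancel]

theorem locConj_right : ∀ᶠ x in nhds (idPt d G), locConj d G (idPt d G, x) = x := by
  filter_upwards [eventually_mem_target d G] with x hx
  simp only [locConj, idChart_symm_idPt, one_mul, inv_one, mul_one]
  exact (idChart d G).right_inv hx

variable [LieGroup (𝓡 d) ∞ G]

theorem contMDiffAt_idChart_symm :
    ContMDiffAt 𝓘(ℝ, Eu d) (𝓡 d) ∞ (idChart d G).symm (idPt d G) :=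
  (contMDiffOn_extChartAt_symm (I := 𝓡 d) (n := ∞) (1 : G)).contMDiffAt
    (extChartAt_target_mem_nhds (I := 𝓡 d) (1 : G))

theorem contMDiffAt_idChart_symm_fst : ContMDiffAt (𝓘(ℝ, Eu d).prod 𝓘(ℝ, Eu d)) (𝓡 d) ∞
      (fun q : Eu d × Eu d => (idChart d G).symm q.1) (idPt d G, idPt d G) :=
  ContMDiffAt.comp (idPt d G, idPt d G) (contMDiffAt_idChart_symm d G) contMDiffAt_fst

theorem contMDiffAt_idChart_symm_snd : ContMDiffAt (𝓘(ℝ, Eu d).prod 𝓘(ℝ, Eu d)) (𝓡 d) ∞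
      (fun q : Eu d × Eu d => (idChart d G).symm q.2) (idPt d G, idPt d G) :=
  ContMDiffAt.comp (idPt d G, idPt d G) (contMDiffAt_idChart_symm d G) contMDiffAt_snd

theorem contDiffAt_locMul : ContDiffAt ℝ ∞ (locMul d G) (idPt d G, idPt d G) := by
  refine contDiffAt_of_contMDiffAt_prod ((contMDiffAt_extChartAt (I := 𝓡 d) (n := ∞) (x := (1 : G))).comp_of_eq
    ((contMDiffAt_idChart_symm_fst d G).mul (contMDiffAt_idChart_symm_snd d G))
    (by simp only [idChart_symm_idPt, mul_one]))

theorem contDiffAt_locConj : ContDiffAt ℝ ∞ (locConj d G) (idPt d G, idPt d G) := by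
  refine contDiffAt_of_contMDiffAt_prod ((contMDiffAt_extChartAt (I := 𝓡 d) (n := ∞) (x := (1 : G))).comp_of_eq
    (((contMDiffAt_idChart_symm_fst d G).mul (contMDiffAt_idChart_symm_snd d G)).mul
      (contMDiffAt_idChart_symm_fst d G).inv)
    (by simp only [idChart_symm_idPt, mul_one, inv_one]))

theorem eventually_mul_mem_source : ∀ᶠ q in nhds ((idPt d G, idPt d G) : Eu d × Eu d),
    (idChart d G).symm q.1 * (idChart d G).symm q.2 ∈ (idChart d G).source := by
  have hc := ((contMDiffAt_idChart_symm_fst d G).mul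
    (contMDiffAt_idChart_symm_snd d G)).continuousAt
  refine hc.eventually ?_
  simp only [Pi.mul_apply, idChart_symm_idPt, mul_one]
  exact extChartAt_source_mem_nhds (I := 𝓡 d) (1 : G)

theorem eventually_conj_mem_source : ∀ᶠ q in nhds ((idPt d G, idPt d G) : Eu d × Eu d),
    (idChart d G).symm q.1 * (idChart d G).symm q.2 * ((idChart d G).symm q.1)⁻¹
      ∈ (idChart d G).source := by
  have hc := (((contMDiffAt_idChart_symm_fst d G).mul
    (contMDiffAt_idChart_symm_snd d G)).mul (contMDiffAt_idChart_symm_fst d G).inv).continuousAt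
  refine hc.eventually ?_
  simp only [Pi.mul_apply, idChart_symm_idPt, mul_one, inv_one]
  exact extChartAt_source_mem_nhds (I := 𝓡 d) (1 : G)

theorem locMul_locConj : ∀ᶠ q in nhds ((idPt d G, idPt d G) : Eu d × Eu d),
    locMul d G (locConj d G q, q.1) = locMul d G q := by
  filter_upwards [eventually_conj_mem_source d G] with q hq
  simp only [locMul, locConj]
  rw [(idChart d G).left_inv hq]
  simp

theorem hasMFDerivAt_of_eq {E H M E' H' M' : Type*} [NormedAddCommGroup E] [NormedSpace ℝ E]
    [TopologicalSpace H] {I : ModelWithCorners ℝ E H} [TopologicalSpace M] [ChartedSpace H M]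
    [NormedAddCommGroup E'] [NormedSpace ℝ E'] [TopologicalSpace H'] {I' : ModelWithCorners ℝ E' H'}
    [TopologicalSpace M'] [ChartedSpace H' M'] {f : M → M'} {x x' : M} (hx : x = x')
    {f' : E →L[ℝ] E'} (h : HasMFDerivAt I I' f x f') : HasMFDerivAt I I' f x' f' := by
  subst hx; exact h

theorem hasMFDerivAt_idChart_symm :
    HasMFDerivAt 𝓘(ℝ, Eu d) (𝓡 d) (idChart d G).symm (idPt d G)
      (ContinuousLinearMap.id ℝ (Eu d)) := by
  have h := mfderivWithin_range_extChartAt_symm (I := 𝓡 d) (x := (1 : G))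
  have h2 := ((contMDiffAt_idChart_symm d G).mdifferentiableAt (by simp)).hasMFDerivAt
  simp only [ModelWithCorners.range_eq_univ, mfderivWithin_univ] at h
  have h' : (mfderiv 𝓘(ℝ, Eu d) (𝓡 d) (idChart d G).symm (idPt d G) : Eu d →L[ℝ] Eu d)
      = ContinuousLinearMap.id ℝ (Eu d) := h
  rw [h'] at h2
  exact h2

theorem mpullback_mulInvariantVectorField_idChart (z : Eu d) :
    ∀ᶠ x in nhds (idPt d G),
      VectorField.mpullbackWithin 𝓘(ℝ, Eu d) (𝓡 d) (idChart d G).symm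
        (mulInvariantVectorField (toLie G z)) (Set.range (𝓡 d)) x
      = rightDeriv (locMul d G) (idPt d G) z x := by
  have hi : Continuous (fun x : Eu d => (x, idPt d G)) := by fun_prop
  have hd : ∀ᶠ q in nhds ((idPt d G, idPt d G) : Eu d × Eu d),
      DifferentiableAt ℝ (locMul d G) q :=
    (((contDiffAt_locMul d G).of_le (m := 1) (by exact_mod_cast le_top)).eventually
      (by norm_num)).mono fun q hq => hq.differentiableAt (by norm_num)
  filter_upwards [eventually_mem_target d G, hi.continuousAt.eventually hd] with x hx hdx
  have hxs : (idChart d G).symm x ∈ (idChart d G).source := (idChart d G).map_target hx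
  rw [VectorField.mpullbackWithin_apply]
  have hinv : (mfderivWithin 𝓘(ℝ, Eu d) (𝓡 d) (idChart d G).symm (Set.range (𝓡 d)) x).inverse
      = mfderiv (𝓡 d) 𝓘(ℝ, Eu d) (idChart d G) ((idChart d G).symm x) :=
    ContinuousLinearMap.inverse_eq
      (mfderivWithin_extChartAt_symm_comp_mfderiv_extChartAt hx)
      (mfderiv_extChartAt_comp_mfderivWithin_extChartAt_symm hx)
  rw [hinv]
  have hφ : MDifferentiableAt (𝓡 d) 𝓘(ℝ, Eu d) (idChart d G) ((idChart d G).symm x) :=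
    mdifferentiableAt_extChartAt (by simpa using hxs)
  have hψ := hasMFDerivAt_idChart_symm d G
  have hm : HasMFDerivAt (𝓡 d) (𝓡 d) (fun h : G => (idChart d G).symm x * h) 1
      (mfderiv (𝓡 d) (𝓡 d) (fun h : G => (idChart d G).symm x * h) 1) :=
    (contMDiff_mul_left (I := 𝓡 d) (n := ∞)).contMDiffAt.mdifferentiableAt (by simp)
      |>.hasMFDerivAt
  have h1 := (hasMFDerivAt_of_eq (idChart_symm_idPt d G).symm hm).comp (idPt d G) hψ
  have h2 := (hasMFDerivAt_of_eq (x' := (idChart d G).symm x * (idChart d G).symm (idPt d G))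
    (by rw [idChart_symm_idPt, mul_one]) hφ.hasMFDerivAt).comp (idPt d G) h1
  have h3 := h2.hasFDerivAt
  have hj : HasFDerivAt (fun y : Eu d => (x, y)) (ContinuousLinearMap.inr ℝ (Eu d) (Eu d)) (idPt d G) :=
    (hasFDerivAt_const x (idPt d G)).prodMk (hasFDerivAt_id (idPt d G))
  have h4 := hdx.hasFDerivAt.comp (f := fun y : Eu d => (x, y)) (idPt d G) hj
  exact (hasFDerivAt_unique_apply h3 h4 z).trans (by simp [rightDeriv])

theorem lieBracket_eq_rightDeriv (y z : Eu d) :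
    lieBracket G y z = fderiv ℝ (rightDeriv (locMul d G) (idPt d G) z) (idPt d G) y
      - fderiv ℝ (rightDeriv (locMul d G) (idPt d G) y) (idPt d G) z := by
  have hp : ∀ w : Eu d, rightDeriv (locMul d G) (idPt d G) w (idPt d G) = w := fun w => by
    have hj : HasFDerivAt (fun y : Eu d => (idPt d G, y)) (ContinuousLinearMap.inr ℝ (Eu d) (Eu d))
        (idPt d G) := (hasFDerivAt_const _ (idPt d G)).prodMk (hasFDerivAt_id (idPt d G))
    have := ((contDiffAt_locMul d G).differentiableAt (by simp)).hasFDerivAt.comp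
      (f := fun y : Eu d => (idPt d G, y)) (idPt d G) hj
    have := (((hasFDerivAt_id (idPt d G)).congr_of_eventuallyEq (locMul_right d G))).unique this
    simpa [rightDeriv] using (congrArg (fun L : Eu d →L[ℝ] Eu d => L w) this).symm
  have hinv : ∀ (L : Eu d →L[ℝ] Eu d) (v : Eu d), L = ContinuousLinearMap.id ℝ (Eu d) →
      L.inverse v = v := fun L v h => by
    rw [h, ContinuousLinearMap.inverse_id]
    rfl
  have gen : ∀ (P Q P' Q' : Eu d → Eu d) (S : Set (Eu d)) (p : Eu d), S = Set.univ →
      P =ᶠ[nhds p] P' → Q =ᶠ[nhds p] Q' → VectorField.lieBracketWithin ℝ P Q S p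
        = fderiv ℝ Q' p (P' p) - fderiv ℝ P' p (Q' p) := by
    intro P Q P' Q' S p hS hP hQ
    rw [hS, VectorField.lieBracketWithin_univ, hP.lieBracket_vectorField_eq hQ]
    rfl
  have hs : (idChart d G).symm ⁻¹' Set.univ ∩ Set.range (𝓡 d) = Set.univ := by simp
  exact (hinv _ _ mfderiv_extChartAt_self).trans ((gen _ _ _ _ _ _ hs
    (mpullback_mulInvariantVectorField_idChart d G y)
    (mpullback_mulInvariantVectorField_idChart d G z)).trans (by rw [hp, hp]))

end Chart
section Trace

theorem trace_sq_of_skew {L : Type*} [AddCommGroup L] [Module ℝ L] [FiniteDimensional ℝ L]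
    (b : L →ₗ[ℝ] L →ₗ[ℝ] ℝ) (hsymm : ∀ x y, b x y = b y x) (hpos : ∀ x, x ≠ 0 → 0 < b x x)
    (S : L →ₗ[ℝ] L) (hS : ∀ x y, b (S x) y = - b x (S y)) (hS0 : S ≠ 0) :
    LinearMap.trace ℝ L (S ∘ₗ S) < 0 := by
  have hnn : ∀ x, 0 ≤ b x x := fun x => by
    rcases eq_or_ne x 0 with rfl | h
    · simp
    · exact (hpos x h).le
  let core : InnerProductSpace.Core ℝ L :=
    { inner := fun x y => b x y
      conj_inner_symm := fun x y => by simp [hsymm]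
      re_inner_nonneg := fun x => by simpa using hnn x
      add_left := fun x y z => by simp
      smul_left := fun x y r => by simp
      definite := fun x h => by
        by_contra hx
        exact (hpos x hx).ne' h }
  let _ : NormedAddCommGroup L := core.toNormedAddCommGroup
  let _ : InnerProductSpace ℝ L := InnerProductSpace.ofCore core.toCore
  have hin : ∀ x y : L, inner ℝ x y = b x y := fun _ _ => rfl
  let e := stdOrthonormalBasis ℝ L
  rw [LinearMap.trace_eq_sum_inner _ e]
  have hterm : ∀ i, inner ℝ (e i) ((S ∘ₗ S) (e i)) = - b (S (e i)) (S (e i)) := fun i => by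
    rw [hin, LinearMap.comp_apply, hsymm, hS]
  simp only [hterm, Finset.sum_neg_distrib]
  rw [neg_lt_zero]
  refine lt_of_le_of_ne (Finset.sum_nonneg fun i _ => hnn _) fun h => hS0 ?_
  have h0 := (Finset.sum_eq_zero_iff_of_nonneg (fun i _ => hnn (S (e i)))).1 h.symm
  refine e.toBasis.ext fun i => ?_
  by_contra hne
  exact (hpos _ hne).ne' (by simpa using h0 i (Finset.mem_univ _))

end Trace

section Adjoint

variable (d : ℕ) (G : Type*) [Group G] [TopologicalSpace G] [ChartedSpace (Eu d) G]

/-- The adjoint representation. -/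
def Ad (g : G) : Eu d →L[ℝ] Eu d := mfderiv (𝓡 d) (𝓡 d) (fun h : G => g * h * g⁻¹) 1

variable [LieGroup (𝓡 d) ∞ G]

theorem contMDiff_conj (g : G) : ContMDiff (𝓡 d) (𝓡 d) ∞ (fun h : G => g * h * g⁻¹) :=
  (contMDiff_mul_right (I := 𝓡 d) (n := ∞) (a := g⁻¹)).comp
    (contMDiff_mul_left (I := 𝓡 d) (n := ∞) (a := g))

theorem hasMFDerivAt_conj (g : G) :
    HasMFDerivAt (𝓡 d) (𝓡 d) (fun h : G => g * h * g⁻¹) 1 (Ad d G g) :=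
  ((contMDiff_conj d G g).contMDiffAt.mdifferentiableAt (by simp)).hasMFDerivAt

theorem Ad_mul (g h : G) : Ad d G (g * h) = (Ad d G g).comp (Ad d G h) := by
  have h1 := (hasMFDerivAt_of_eq (x' := h * 1 * h⁻¹) (by simp) (hasMFDerivAt_conj d G g)).comp 1
    (hasMFDerivAt_conj d G h)
  have h2 : (fun h : G => g * h * g⁻¹) ∘ (fun k : G => h * k * h⁻¹)
      = fun k : G => (g * h) * k * (g * h)⁻¹ := by
    funext k; simp [mul_assoc]
  rw [h2] at h1
  exact hasMFDerivAt_unique (hasMFDerivAt_conj d G (g * h)) h1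

theorem Ad_one : Ad d G 1 = ContinuousLinearMap.id ℝ (Eu d) := by
  have h2 : (fun h : G => (1 : G) * h * 1⁻¹) = id := by funext k; simp
  have := hasMFDerivAt_conj d G 1
  rw [h2] at this
  exact hasMFDerivAt_unique this (hasMFDerivAt_id 1)

theorem Ad_eq_rightDeriv (z : Eu d) : ∀ᶠ x in nhds (idPt d G),
    Ad d G ((idChart d G).symm x) z = rightDeriv (locConj d G) (idPt d G) z x := by
  have hi : Continuous (fun x : Eu d => (x, idPt d G)) := by fun_prop
  have hd : ∀ᶠ q in nhds ((idPt d G, idPt d G) : Eu d × Eu d),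
      DifferentiableAt ℝ (locConj d G) q :=
    (((contDiffAt_locConj d G).of_le (m := 1) (by exact_mod_cast le_top)).eventually
      (by norm_num)).mono fun q hq => hq.differentiableAt (by norm_num)
  filter_upwards [hi.continuousAt.eventually hd] with x hdx
  have hφ : HasMFDerivAt (𝓡 d) 𝓘(ℝ, Eu d) (idChart d G) 1 (ContinuousLinearMap.id ℝ (Eu d)) := by
    have h : (mfderiv (𝓡 d) 𝓘(ℝ, Eu d) (idChart d G) 1 : Eu d →L[ℝ] Eu d)
      = ContinuousLinearMap.id ℝ (Eu d) := mfderiv_extChartAt_self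
    rw [← h]
    exact (mdifferentiableAt_extChartAt (mem_chart_source _ _)).hasMFDerivAt
  have h1 := (hasMFDerivAt_of_eq (idChart_symm_idPt d G).symm
    (hasMFDerivAt_conj d G ((idChart d G).symm x))).comp (idPt d G) (hasMFDerivAt_idChart_symm d G)
  have h2 := (hasMFDerivAt_of_eq (x' := (idChart d G).symm x * (idChart d G).symm (idPt d G) *
    ((idChart d G).symm x)⁻¹) (by rw [idChart_symm_idPt]; simp) hφ).comp (idPt d G) h1
  have h3 := h2.hasFDerivAt
  have hj : HasFDerivAt (fun y : Eu d => (x, y)) (ContinuousLinearMap.inr ℝ (Eu d) (Eu d))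
      (idPt d G) := (hasFDerivAt_const x (idPt d G)).prodMk (hasFDerivAt_id (idPt d G))
  have h4 := hdx.hasFDerivAt.comp (f := fun y : Eu d => (x, y)) (idPt d G) hj
  exact (hasFDerivAt_unique_apply h3 h4 z).trans (by simp [rightDeriv])

theorem hasFDerivAt_Ad (z : Eu d) : ∃ D : Eu d →L[ℝ] Eu d,
    HasFDerivAt (fun x => Ad d G ((idChart d G).symm x) z) D (idPt d G)
      ∧ ∀ y, D y = lieBracket G y z := by
  have hC := (contDiffAt_locConj d G).of_le (m := 2) ENat.LEInfty.out
  have hC' : DifferentiableAt ℝ (fderiv ℝ (locConj d G)) (idPt d G, idPt d G) :=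
    (hC.fderiv_right (m := 1) (by norm_num)).differentiableAt (by norm_num)
  have hi : HasFDerivAt (fun x : Eu d => (x, idPt d G)) (ContinuousLinearMap.inl ℝ (Eu d) (Eu d))
      (idPt d G) := (hasFDerivAt_id _).prodMk (hasFDerivAt_const _ _)
  have dC : DifferentiableAt ℝ (rightDeriv (locConj d G) (idPt d G) z) (idPt d G) :=
    ((ContinuousLinearMap.apply ℝ (Eu d) ((0 : Eu d), z)).hasFDerivAt.comp _
      (hC'.hasFDerivAt.comp (f := fun x : Eu d => (x, idPt d G)) _ hi)).differentiableAt
  refine ⟨_, dC.hasFDerivAt.congr_of_eventuallyEq (Ad_eq_rightDeriv d G z), fun y => ?_⟩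
  rw [lieBracket_eq_rightDeriv, fderiv_mixed_of_conj
    ((contDiffAt_locMul d G).of_le (m := 2) ENat.LEInfty.out) hC (locMul_locConj d G)
    (Filter.Eventually.of_forall (locConj_left d G)) (locConj_right d G) (locMul_left d G)]

theorem continuous_Ad (z : Eu d) : Continuous fun g : G => Ad d G g z := by
  have : IsTopologicalGroup G := topologicalGroup_of_lieGroup (𝓡 d) ∞
  have h1 : ContinuousAt (fun g : G => Ad d G g z) 1 := by
    obtain ⟨D, hD, -⟩ := hasFDerivAt_Ad d G z
    have hc : ContinuousAt (fun g : G => Ad d G ((idChart d G).symm (idChart d G g)) z) 1 :=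
      ContinuousAt.comp (f := fun g : G => idChart d G g) hD.continuousAt
        (continuousAt_extChartAt (I := 𝓡 d) (1 : G))
    refine hc.congr ?_
    filter_upwards [extChartAt_source_mem_nhds (I := 𝓡 d) (1 : G)] with g hg
    rw [(idChart d G).left_inv hg]
  refine continuous_iff_continuousAt.2 fun g₀ => ?_
  have h2 : (fun g : G => Ad d G g z) = fun g => Ad d G g₀ (Ad d G (g₀⁻¹ * g) z) := by
    funext g
    rw [← ContinuousLinearMap.comp_apply, ← Ad_mul, mul_inv_cancel_left]
  rw [h2]
  refine (Ad d G g₀).continuous.continuousAt.comp ?_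
  refine ContinuousAt.comp_of_eq (g := fun g : G => Ad d G g z) h1
    (continuous_const.mul continuous_id).continuousAt (by simp)

open MeasureTheory in
theorem exists_invariant_inner [CompactSpace G] :
    ∃ b : Eu d →ₗ[ℝ] Eu d →ₗ[ℝ] ℝ, (∀ x y, b x y = b y x) ∧ (∀ x, x ≠ 0 → 0 < b x x) ∧
      ∀ g x y, b (Ad d G g x) (Ad d G g y) = b x y := by
  have : IsTopologicalGroup G := topologicalGroup_of_lieGroup (𝓡 d) ∞
  let _ : MeasurableSpace G := borel G
  have : BorelSpace G := ⟨rfl⟩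
  let μ : Measure G := Measure.haar
  have hcont : ∀ x y : Eu d, Continuous fun g : G => inner ℝ (Ad d G g⁻¹ x) (Ad d G g⁻¹ y) :=
    fun x y => ((continuous_Ad d G x).comp continuous_inv).inner
      ((continuous_Ad d G y).comp continuous_inv)
  have hcs : ∀ f : G → ℝ, HasCompactSupport f := fun f => HasCompactSupport.of_compactSpace f
  have hint : ∀ x y : Eu d, Integrable (fun g : G => inner ℝ (Ad d G g⁻¹ x) (Ad d G g⁻¹ y)) μ :=
    fun x y => (hcont x y).integrable_of_hasCompactSupport (hcs _)
  refine ⟨LinearMap.mk₂ ℝ (fun x y => ∫ g : G, inner ℝ (Ad d G g⁻¹ x) (Ad d G g⁻¹ y) ∂μ)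
    ?_ ?_ ?_ ?_, ?_, ?_, ?_⟩
  · intro x x' y
    simp only [map_add, inner_add_left]
    exact integral_add (hint x y) (hint x' y)
  · intro c x y
    simp only [map_smul, inner_smul_left]
    exact integral_const_mul _ _
  · intro x y y'
    simp only [map_add, inner_add_right]
    exact integral_add (hint x y) (hint x y')
  · intro c x y
    simp only [map_smul, inner_smul_right]
    exact integral_const_mul _ _
  · intro x y
    simp only [LinearMap.mk₂_apply]
    exact integral_congr_ae (Filter.Eventually.of_forall fun g => real_inner_comm _ _)
  · intro x hx
    simp only [LinearMap.mk₂_apply]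
    refine (hcont x x).integral_pos_of_hasCompactSupport_nonneg_nonzero (x := 1) (hcs _)
      (fun g => real_inner_self_nonneg) ?_
    simp [Ad_one, hx]
  · intro h x y
    simp only [LinearMap.mk₂_apply]
    rw [← integral_mul_left_eq_self (μ := μ)
      (fun g => inner ℝ (Ad d G g⁻¹ x) (Ad d G g⁻¹ y)) h⁻¹]
    simp only [mul_inv_rev, inv_inv, Ad_mul, ContinuousLinearMap.comp_apply]

theorem exists_ad_skew_inner [CompactSpace G] :
    ∃ b : Eu d →ₗ[ℝ] Eu d →ₗ[ℝ] ℝ, (∀ x y, b x y = b y x) ∧ (∀ x, x ≠ 0 → 0 < b x x) ∧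
      ∀ w x y, b (lieBracket G w x) y = - b x (lieBracket G w y) := by
  obtain ⟨b, hsymm, hpos, hinv⟩ := exists_invariant_inner d G
  refine ⟨b, hsymm, hpos, fun w x y => ?_⟩
  let B : Eu d →L[ℝ] Eu d →L[ℝ] ℝ :=
    LinearMap.toContinuousLinearMap (LinearMap.toContinuousLinearMap.toLinearMap ∘ₗ b)
  obtain ⟨D, hD, hD'⟩ := hasFDerivAt_Ad d G x
  obtain ⟨D₂, hD₂, hD₂'⟩ := hasFDerivAt_Ad d G y
  have h1 := (B.hasFDerivAt.comp _ hD).clm_apply hD₂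
  have h2 : HasFDerivAt (fun x' => B (Ad d G ((idChart d G).symm x') x)
      (Ad d G ((idChart d G).symm x') y)) (0 : Eu d →L[ℝ] ℝ) (idPt d G) := by
    have : (fun x' => B (Ad d G ((idChart d G).symm x') x) (Ad d G ((idChart d G).symm x') y))
      = fun _ => b x y := funext fun x' => hinv _ x y
    rw [this]
    exact hasFDerivAt_const _ _
  have h3 := hasFDerivAt_unique_apply h1 h2 w
  simp only [_root_.add_apply, ContinuousLinearMap.comp_apply,
    ContinuousLinearMap.flip_apply, hD', hD₂', idChart_symm_idPt, Ad_one,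
    _root_.zero_apply, ContinuousLinearMap.id_apply, Function.comp_apply] at h3
  have h4 : b x (lieBracket G w y) + b (lieBracket G w x) y = 0 := h3
  linarith

end Adjoint

section Killing

variable {d : ℕ} (G : Type*) [Group G] [TopologicalSpace G] [ChartedSpace (Eu d) G]
  [LieGroup (𝓡 d) ∞ G]

theorem gInner_pos [CompactSpace G] [LieAlgebra.IsSemisimple ℝ (GroupLieAlgebra (𝓡 d) G)]
    (x : Eu d) (hx : x ≠ 0) : 0 < gInner G x x := by
  obtain ⟨b, hsymm, hpos, hskew⟩ := exists_ad_skew_inner d G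
  rw [gInner, killingForm_apply_apply, neg_pos]
  refine trace_sq_of_skew (L := Eu d) b hsymm hpos
    (show Eu d →ₗ[ℝ] Eu d from LieAlgebra.ad ℝ (GroupLieAlgebra (𝓡 d) G) (toLie G x))
    (fun y z => hskew x y z) fun h0 => hx ?_
  have hc : toLie G x ∈ LieAlgebra.center ℝ (GroupLieAlgebra (𝓡 d) G) := by
    refine (LieModule.mem_maxTrivSubmodule _ _ _ _).2 fun y => ?_
    rw [← lie_skew, neg_eq_zero]
    exact congrArg (fun L : Eu d →ₗ[ℝ] Eu d => L y) h0
  rw [LieAlgebra.center_eq_bot] at hc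
  exact hc

theorem gInner_comm (x y : Eu d) : gInner G x y = gInner G y x := by
  rw [gInner, gInner, killingForm, LieModule.traceForm_comm]

theorem gInner_lie (x y z : Eu d) :
    gInner G (lieBracket G x y) z = - gInner G y (lieBracket G x z) := by
  have h : killingForm ℝ (GroupLieAlgebra (𝓡 d) G) ⁅toLie G x, toLie G y⁆ (toLie G z)
      = - killingForm ℝ (GroupLieAlgebra (𝓡 d) G) (toLie G y) ⁅toLie G x, toLie G z⁆ := by
    rw [← lie_skew, map_neg, LinearMap.neg_apply, killingForm, LieModule.traceForm_apply_lie_apply]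
  rw [gInner, gInner, neg_inj]
  exact h

/-- The negative Killing form as a continuous bilinear form. -/
def gForm : Eu d →L[ℝ] Eu d →L[ℝ] ℝ :=
  LinearMap.toContinuousLinearMap (LinearMap.toContinuousLinearMap.toLinearMap ∘ₗ
    (show Eu d →ₗ[ℝ] Eu d →ₗ[ℝ] ℝ from -killingForm ℝ (GroupLieAlgebra (𝓡 d) G)))

theorem gForm_apply (x y : Eu d) : gForm G x y = gInner G x y := rfl

/-- The Lie bracket as a continuous bilinear map. -/
def lieForm : Eu d →L[ℝ] Eu d →L[ℝ] Eu d :=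
  LinearMap.toContinuousLinearMap (LinearMap.toContinuousLinearMap.toLinearMap ∘ₗ
    (show Eu d →ₗ[ℝ] Eu d →ₗ[ℝ] Eu d from LinearMap.mk₂ ℝ (lieBracket G)
      (fun x y z => add_lie (toLie G x) (toLie G y) (toLie G z))
      (fun c x y => smul_lie c (toLie G x) (toLie G y))
      (fun x y z => lie_add (toLie G x) (toLie G y) (toLie G z))
      (fun c x y => lie_smul c (toLie G x) (toLie G y))))

theorem lieBracket_skew (x y : Eu d) : lieBracket G x y = - lieBracket G y x :=
  (lie_skew (toLie G x) (toLie G y)).symm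

theorem lieBracket_jacobi (x y z : Eu d) : lieBracket G x (lieBracket G y z)
    = lieBracket G (lieBracket G x y) z + lieBracket G y (lieBracket G x z) :=
  leibniz_lie (toLie G x) (toLie G y) (toLie G z)

variable {G}
variable {V : Type*} [NormedAddCommGroup V] [InnerProductSpace ℝ V]

theorem hasFDerivAt_rep {ρ : G →* (V →L[ℝ] V)}
    (hρ : ContMDiff (𝓡 d) 𝓘(ℝ, V →L[ℝ] V) ∞ ρ) :
    ContDiffAt ℝ ∞ (fun x => ρ ((idChart d G).symm x)) (idPt d G) ∧
    ∀ y, fderiv ℝ (fun x => ρ ((idChart d G).symm x)) (idPt d G) y = dRep ρ (toLie G y) := by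
  constructor
  · rw [← contMDiffAt_iff_contDiffAt]
    exact (hρ.contMDiffAt).comp (idPt d G) (contMDiffAt_idChart_symm d G)
  · intro y
    have h1 : HasMFDerivAt (𝓡 d) 𝓘(ℝ, V →L[ℝ] V) ρ 1 (dRep ρ) :=
      (hρ.contMDiffAt.mdifferentiableAt (by simp)).hasMFDerivAt
    have h2 := (hasMFDerivAt_of_eq (idChart_symm_idPt d G).symm h1).comp (idPt d G)
      (hasMFDerivAt_idChart_symm d G)
    exact hasFDerivAt_unique_apply (h2.hasFDerivAt.differentiableAt.hasFDerivAt) h2.hasFDerivAt y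

theorem dRep_lie {ρ : G →* (V →L[ℝ] V)} (hρ : ContMDiff (𝓡 d) 𝓘(ℝ, V →L[ℝ] V) ∞ ρ)
    (x y : Eu d) (v : V) :
    act ρ (lieBracket G x y) v = act ρ x (act ρ y v) - act ρ y (act ρ x v) := by
  obtain ⟨h1, h2⟩ := hasFDerivAt_rep hρ
  have h3 := fderiv_lie_of_mul ((contDiffAt_locMul d G).of_le (m := 2) ENat.LEInfty.out)
    (h1.of_le ENat.LEInfty.out) ?_ (locMul_left d G) (locMul_right d G) x y
  · rw [← lieBracket_eq_rightDeriv, h2, h2, h2] at h3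
    exact congrArg (fun L : V →L[ℝ] V => L v) h3
  · filter_upwards [eventually_mul_mem_source d G] with q hq
    rw [locMul, (idChart d G).left_inv hq, map_mul]

theorem act_skew {ρ : G →* (V →L[ℝ] V)} (hρ : ContMDiff (𝓡 d) 𝓘(ℝ, V →L[ℝ] V) ∞ ρ)
    (hinv : ∀ (g : G) (v w : V), inner ℝ (ρ g v) (ρ g w) = inner ℝ v w)
    (x : Eu d) (v w : V) : inner ℝ (act ρ x v) w = - inner ℝ v (act ρ x w) := by
  obtain ⟨h1, h2⟩ := hasFDerivAt_rep hρ
  have hd := (h1.differentiableAt (by simp)).hasFDerivAt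
  have e : ∀ v : V, HasFDerivAt (fun x => ρ ((idChart d G).symm x) v) _ (idPt d G) := fun v =>
    (ContinuousLinearMap.apply ℝ V v).hasFDerivAt.comp (idPt d G) hd
  have h3 := (e v).inner ℝ (e w)
  simp only [hinv] at h3
  have h4 := hasFDerivAt_unique_apply h3 (hasFDerivAt_const _ _) x
  have h5 : inner ℝ (ρ ((idChart d G).symm (idPt d G)) v)
      (fderiv ℝ (fun x => ρ ((idChart d G).symm x)) (idPt d G) x w)
      + inner ℝ (fderiv ℝ (fun x => ρ ((idChart d G).symm x)) (idPt d G) x v)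
        (ρ ((idChart d G).symm (idPt d G)) w) = 0 := h4
  rw [h2, idChart_symm_idPt, map_one] at h5
  have h6 : inner ℝ v (act ρ x w) + inner ℝ (act ρ x v) w = 0 := h5
  linarith

theorem odot_spec [CompactSpace G] [LieAlgebra.IsSemisimple ℝ (GroupLieAlgebra (𝓡 d) G)]
    (ρ : G →* (V →L[ℝ] V)) (v w : V) (y : Eu d) :
    gInner G y (odot ρ v w) = inner ℝ (act ρ y v) w := by
  have h : ∃ Z : Eu d, ∀ Y : Eu d, gInner G Y Z = inner ℝ (act ρ Y v) w := by
    let B : Eu d →ₗ[ℝ] (Eu d →ₗ[ℝ] ℝ) := LinearMap.mk₂ ℝ (fun z y => gForm G y z)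
      (by simp) (by simp) (by simp) (by simp)
    have hB : Function.Injective B := by
      rw [injective_iff_map_eq_zero]
      intro z hz
      by_contra hne
      exact (gInner_pos G z hne).ne' (congrArg (fun L => L z) hz)
    have hB' : Function.Surjective B :=
      (LinearMap.injective_iff_surjective_of_finrank_eq_finrank
        (Subspace.dual_finrank_eq (K := ℝ) (V := Eu d)).symm).1 hB
    let f : Eu d →ₗ[ℝ] ℝ :=
      { toFun := fun y => inner ℝ (act ρ y v) w
        map_add' := fun y y' => by
          simp only [act]
          rw [← inner_add_left, ← _root_.add_apply, ← map_add]; rfl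
        map_smul' := fun c y => by
          simp only [act]
          rw [RingHom.id_apply, smul_eq_mul, ← real_inner_smul_left,
            ← _root_.smul_apply, ← map_smul]; rfl }
    obtain ⟨z, hz⟩ := hB' f
    exact ⟨z, fun y => congrArg (fun L => L y) hz⟩
  rw [odot, dif_pos h]
  exact h.choose_spec y

end Killing

section DirD

variable {E F F₁ F₂ : Type*} [NormedAddCommGroup E] [NormedSpace ℝ E] [NormedAddCommGroup F]
  [NormedSpace ℝ F] [NormedAddCommGroup F₁] [NormedSpace ℝ F₁] [NormedAddCommGroup F₂]
  [NormedSpace ℝ F₂]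

/-- The derivative of `f` in the direction `v`. -/
def dirD (v : E) (f : E → F) (p : E) : F := fderiv ℝ f p v

theorem contDiffAt_dirD {f : E → F} {p : E} (hf : ContDiffAt ℝ ∞ f p) (v : E) :
    ContDiffAt ℝ ∞ (dirD v f) p :=
  (hf.fderiv_right (m := ∞) (by simp)).clm_apply contDiffAt_const

theorem contDiffAt_bilin (B : F →L[ℝ] F₁ →L[ℝ] F₂) {f : E → F} {g : E → F₁} {p : E} {k : ℕ∞ω}
    (hf : ContDiffAt ℝ k f p) (hg : ContDiffAt ℝ k g p) :
    ContDiffAt ℝ k (fun q => B (f q) (g q)) p :=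
  (B.contDiff.contDiffAt.comp p hf).clm_apply hg

theorem dirD_add {f g : E → F} {p : E} (v : E) (hf : DifferentiableAt ℝ f p)
    (hg : DifferentiableAt ℝ g p) :
    dirD v (fun q => f q + g q) p = dirD v f p + dirD v g p := by
  simp only [dirD]
  rw [fderiv_fun_add hf hg]; rfl

theorem dirD_sub {f g : E → F} {p : E} (v : E) (hf : DifferentiableAt ℝ f p)
    (hg : DifferentiableAt ℝ g p) :
    dirD v (fun q => f q - g q) p = dirD v f p - dirD v g p := by
  simp only [dirD]
  rw [fderiv_fun_sub hf hg]; rfl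

theorem dirD_neg {f : E → F} {p : E} (v : E) : dirD v (fun q => - f q) p = - dirD v f p := by
  simp only [dirD]
  rw [fderiv_fun_neg]; rfl

theorem dirD_const_mul {f : E → ℝ} {p : E} (v : E) (c : ℝ) (hf : DifferentiableAt ℝ f p) :
    dirD v (fun q => c * f q) p = c * dirD v f p := by
  simp only [dirD]
  rw [fderiv_const_mul hf]; rfl

theorem dirD_mul {f g : E → ℝ} {p : E} (v : E) (hf : DifferentiableAt ℝ f p)
    (hg : DifferentiableAt ℝ g p) :
    dirD v (fun q => f q * g q) p = dirD v f p * g p + f p * dirD v g p := by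
  simp only [dirD]
  rw [fderiv_fun_mul hf hg]
  simp
  ring

theorem dirD_sum {κ : Type*} (s : Finset κ) {f : κ → E → F} {p : E} (v : E)
    (hf : ∀ i ∈ s, DifferentiableAt ℝ (f i) p) :
    dirD v (fun q => ∑ i ∈ s, f i q) p = ∑ i ∈ s, dirD v (f i) p := by
  simp only [dirD]
  rw [fderiv_fun_sum hf]
  simp

theorem dirD_bilin (B : F →L[ℝ] F₁ →L[ℝ] F₂) {f : E → F} {g : E → F₁} {p : E} (v : E)
    (hf : DifferentiableAt ℝ f p) (hg : DifferentiableAt ℝ g p) :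
    dirD v (fun q => B (f q) (g q)) p = B (dirD v f p) (g p) + B (f p) (dirD v g p) := by
  have h := (B.hasFDerivAt.comp p hf.hasFDerivAt).clm_apply hg.hasFDerivAt
  have h2 := congrArg (fun L => L v) h.fderiv
  refine Eq.trans h2 ?_
  simp [dirD, add_comm]

theorem dirD_comm {f : E → F} {p : E} (hf : ContDiffAt ℝ ∞ f p) (v w : E) :
    dirD v (dirD w f) p = dirD w (dirD v f) p := by
  have hs : IsSymmSndFDerivAt ℝ f p :=
    (hf.of_le (m := 2) ENat.LEInfty.out).isSymmSndFDerivAt (by simp)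
  have hd : DifferentiableAt ℝ (fderiv ℝ f) p :=
    (hf.fderiv_right (m := ∞) (by simp)).differentiableAt (by simp)
  have e : ∀ v w : E, dirD v (dirD w f) p = fderiv ℝ (fderiv ℝ f) p v w := fun v w => by
    have h := hd.hasFDerivAt.clm_apply (hasFDerivAt_const w p)
    refine Eq.trans (congrArg (fun L => L v) h.fderiv) ?_
    simp
  rw [e, e, hs.eq]

end DirD

section Gauge

variable {E L V ι : Type*} [NormedAddCommGroup E] [NormedSpace ℝ E] [NormedAddCommGroup L]
  [NormedSpace ℝ L] [NormedAddCommGroup V] [InnerProductSpace ℝ V]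

/-- The curvature of the connection `A` in the directions `e i` and `e j`. -/
def gaugeCurv (br : L →L[ℝ] L →L[ℝ] L) (e : ι → E) (A : ι → E → L) (i j : ι) (q : E) : L :=
  dirD (e i) (A j) q - dirD (e j) (A i) q + br (A i q) (A j q)

/-- The covariant derivative in the direction `e i`, for the action `ac` of the Lie algebra. -/
def gaugeD (ac : L →L[ℝ] V →L[ℝ] V) (e : ι → E) (A : ι → E → L) (i : ι) (u : E → V) (q : E) : V :=
  dirD (e i) u q + ac (A i q) (u q)

/-- The covariant derivative of a Lie algebra valued function in the direction `e i`. -/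
def gaugeNabla (br : L →L[ℝ] L →L[ℝ] L) (e : ι → E) (A : ι → E → L) (i : ι) (Y : E → L) (q : E) :
    L :=
  dirD (e i) Y q + br (A i q) (Y q)

variable {br : L →L[ℝ] L →L[ℝ] L} {ac : L →L[ℝ] V →L[ℝ] V} {b : L →L[ℝ] L →L[ℝ] ℝ}
  {e : ι → E} {A : ι → E → L} {u : E → V} {p : E}

theorem contDiffAt_gaugeCurv (hA : ∀ i, ContDiffAt ℝ ∞ (A i) p) (i j : ι) :
    ContDiffAt ℝ ∞ (gaugeCurv br e A i j) p :=
  (((contDiffAt_dirD (hA j) _)).sub ((contDiffAt_dirD (hA i) _))).add (contDiffAt_bilin br (hA i) (hA j))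

theorem contDiffAt_gaugeD (hA : ∀ i, ContDiffAt ℝ ∞ (A i) p) (hu : ContDiffAt ℝ ∞ u p) (i : ι) :
    ContDiffAt ℝ ∞ (gaugeD ac e A i u) p :=
  (contDiffAt_dirD hu _).add (contDiffAt_bilin ac (hA i) hu)

theorem gaugeCurv_skew (hbr : ∀ x y, br x y = - br y x) (i j : ι) (q : E) :
    gaugeCurv br e A i j q = - gaugeCurv br e A j i q := by
  rw [gaugeCurv, gaugeCurv, hbr]; abel

theorem gaugeNabla_neg (i : ι) (Y : E → L) (q : E) :
    gaugeNabla br e A i (fun q => - Y q) q = - gaugeNabla br e A i Y q := by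
  rw [gaugeNabla, gaugeNabla, dirD_neg, map_neg]; abel

theorem bianchi (hbr : ∀ x y, br x y = - br y x)
    (hjac : ∀ x y z, br x (br y z) = br (br x y) z + br y (br x z))
    (hA : ∀ i, ContDiffAt ℝ ∞ (A i) p) (i j k : ι) :
    gaugeNabla br e A i (gaugeCurv br e A j k) p + gaugeNabla br e A j (gaugeCurv br e A k i) p
      + gaugeNabla br e A k (gaugeCurv br e A i j) p = 0 := by
  have d : ∀ i, DifferentiableAt ℝ (A i) p := fun i => (hA i).differentiableAt (by simp)
  have dd : ∀ i v, DifferentiableAt ℝ (dirD v (A i)) p :=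
    fun i v => ((contDiffAt_dirD (hA i) v)).differentiableAt (by simp)
  have db : ∀ i j, DifferentiableAt ℝ (fun q => br (A i q) (A j q)) p :=
    fun i j => (contDiffAt_bilin br (hA i) (hA j)).differentiableAt (by simp)
  have key : ∀ i j k, dirD (e i) (gaugeCurv br e A j k) p
      = dirD (e i) (dirD (e j) (A k)) p - dirD (e i) (dirD (e k) (A j)) p
        + (br (dirD (e i) (A j) p) (A k p) + br (A j p) (dirD (e i) (A k) p)) := fun i j k => by
    refine (dirD_add (f := fun q => dirD (e j) (A k) q - dirD (e k) (A j) q) _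
      ((dd _ _).sub (dd _ _)) (db _ _)).trans ?_
    rw [dirD_sub _ (dd _ _) (dd _ _), dirD_bilin br _ (d _) (d _)]
  simp only [gaugeNabla, key]
  simp only [gaugeCurv, map_add, map_sub]
  rw [dirD_comm (hA k) (e i) (e j), dirD_comm (hA j) (e k) (e i), dirD_comm (hA i) (e j) (e k)]
  rw [hbr (dirD (e i) (A j) p), hbr (dirD (e j) (A k) p), hbr (dirD (e k) (A i) p),
    hbr (A j p) (dirD (e i) (A k) p), hbr (A k p) (dirD (e j) (A i) p),
    hbr (A i p) (dirD (e k) (A j) p)]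
  rw [hjac (A i p) (A j p) (A k p), hbr (br (A i p) (A j p)) (A k p),
    hbr (A k p) (A i p), map_neg]
  rw [hbr (dirD (e i) (A k) p), hbr (dirD (e j) (A i) p), hbr (dirD (e k) (A j) p)]
  abel

theorem gaugeD_comm
    (hrep : ∀ x y v, ac (br x y) v = ac x (ac y v) - ac y (ac x v))
    (hA : ∀ i, ContDiffAt ℝ ∞ (A i) p) (hu : ContDiffAt ℝ ∞ u p) (i j : ι) :
    gaugeD ac e A i (gaugeD ac e A j u) p - gaugeD ac e A j (gaugeD ac e A i u) p
      = ac (gaugeCurv br e A i j p) (u p) := by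
  have d : ∀ i, DifferentiableAt ℝ (A i) p := fun i => (hA i).differentiableAt (by simp)
  have du : DifferentiableAt ℝ u p := hu.differentiableAt (by simp)
  have ddu : ∀ v, DifferentiableAt ℝ (dirD v u) p :=
    fun v => (contDiffAt_dirD hu v).differentiableAt (by simp)
  have db : ∀ i, DifferentiableAt ℝ (fun q => ac (A i q) (u q)) p :=
    fun i => (contDiffAt_bilin ac (hA i) hu).differentiableAt (by simp)
  have key : ∀ i j, gaugeD ac e A i (gaugeD ac e A j u) p = dirD (e i) (dirD (e j) u) p
      + (ac (dirD (e i) (A j) p) (u p) + ac (A j p) (dirD (e i) u p))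
      + ac (A i p) (dirD (e j) u p + ac (A j p) (u p)) := fun i j => by
    rw [← dirD_bilin ac _ (d _) du, ← dirD_add _ (ddu _) (db _)]
    rfl
  rw [key, key]
  simp only [gaugeCurv, map_add, map_sub, hrep, _root_.add_apply, _root_.sub_apply]
  rw [dirD_comm hu (e i) (e j)]
  abel

theorem dirD_form (hinv : ∀ x y z, b (br x y) z = - b y (br x z)) {X Y : E → L}
    (hX : DifferentiableAt ℝ X p) (hY : DifferentiableAt ℝ Y p) (i : ι) :
    dirD (e i) (fun q => b (X q) (Y q)) p
      = b (gaugeNabla br e A i X p) (Y p) + b (X p) (gaugeNabla br e A i Y p) := by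
  rw [dirD_bilin b _ hX hY, gaugeNabla, gaugeNabla, map_add, map_add, _root_.add_apply, hinv]
  ring

theorem dirD_inner (hsk : ∀ x v w, inner ℝ (ac x v) w = - inner ℝ v (ac x w)) {v w : E → V}
    (hv : DifferentiableAt ℝ v p) (hw : DifferentiableAt ℝ w p) (i : ι) :
    dirD (e i) (fun q => inner ℝ (v q) (w q)) p
      = inner ℝ (gaugeD ac e A i v p) (w p) + inner ℝ (v p) (gaugeD ac e A i w p) := by
  have h := dirD_bilin (innerSL ℝ) (e i) hv hw
  refine h.trans ?_
  rw [innerSL_apply_apply, innerSL_apply_apply, gaugeD, gaugeD, inner_add_left, inner_add_right, hsk]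
  ring

/-- The algebraic properties of the bracket `br` of the gauge algebra, of its action `ac` and of its
invariant form `b` that enter the Yang-Mills-Higgs equations. -/
structure IsGaugeAlgebra (br : L →L[ℝ] L →L[ℝ] L) (ac : L →L[ℝ] V →L[ℝ] V)
    (b : L →L[ℝ] L →L[ℝ] ℝ) : Prop where
  skew : ∀ x y, br x y = - br y x
  jacobi : ∀ x y z, br x (br y z) = br (br x y) z + br y (br x z)
  rep : ∀ x y v, ac (br x y) v = ac x (ac y v) - ac y (ac x v)
  form_comm : ∀ x y, b x y = b y x
  form_nonneg : ∀ x, 0 ≤ b x x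
  form_inv : ∀ x y z, b (br x y) z = - b y (br x z)
  inner_skew : ∀ x v w, inner ℝ (ac x v) w = - inner ℝ v (ac x w)

end Gauge

section Stress

variable {E L V : Type*} [NormedAddCommGroup E] [NormedSpace ℝ E] [NormedAddCommGroup L]
  [NormedSpace ℝ L] [NormedAddCommGroup V] [InnerProductSpace ℝ V] {n : ℕ}
  (br : L →L[ℝ] L →L[ℝ] L) (ac : L →L[ℝ] V →L[ℝ] V) (b : L →L[ℝ] L →L[ℝ] ℝ)
  (e : Option (Fin n) → E) (A : Option (Fin n) → E → L) (u : E → V) (W : ℝ → ℝ)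

/-- The energy density; the directions `some i` are spatial and `none` is the time direction. -/
def gaugeEnergy (q : E) : ℝ :=
  1 / 4 * (∑ i, ∑ j, b (gaugeCurv br e A (some i) (some j) q) (gaugeCurv br e A (some i) (some j) q))
    + 1 / 2 * (∑ i, inner ℝ (gaugeD ac e A (some i) u q) (gaugeD ac e A (some i) u q))
    + W (inner ℝ (u q) (u q))

/-- The pairing `∑_j ⟨F_vj, F_wj⟩ + ⟨D_v u, D_w u⟩`, whose spatial components make up the
stress tensor. -/
def stress (v w : Option (Fin n)) (q : E) : ℝ :=
  (∑ j, b (gaugeCurv br e A v (some j) q) (gaugeCurv br e A w (some j) q))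
    + inner ℝ (gaugeD ac e A v u q) (gaugeD ac e A w u q)

variable {br ac b e A u W} {p : E}

theorem contDiffAt_stress (hA : ∀ i, ContDiffAt ℝ ∞ (A i) p) (hu : ContDiffAt ℝ ∞ u p)
    (v w : Option (Fin n)) : ContDiffAt ℝ ∞ (stress br ac b e A u v w) p :=
  (ContDiffAt.sum fun _ _ => contDiffAt_bilin b (contDiffAt_gaugeCurv hA _ _)
    (contDiffAt_gaugeCurv hA _ _)).add ((contDiffAt_gaugeD hA hu _).inner ℝ
      (contDiffAt_gaugeD hA hu _))

theorem contDiffAt_gaugeEnergy (hA : ∀ i, ContDiffAt ℝ ∞ (A i) p) (hu : ContDiffAt ℝ ∞ u p)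
    (hW : ContDiff ℝ 1 W) : ContDiffAt ℝ 1 (gaugeEnergy br ac b e A u W) p :=
  (((contDiffAt_const.mul (ContDiffAt.sum fun _ _ => ContDiffAt.sum fun _ _ =>
    contDiffAt_bilin b (contDiffAt_gaugeCurv hA _ _) (contDiffAt_gaugeCurv hA _ _))).add
    (contDiffAt_const.mul (ContDiffAt.sum fun _ _ => (contDiffAt_gaugeD hA hu _).inner ℝ
      (contDiffAt_gaugeD hA hu _)))).of_le ENat.LEInfty.out).add
    (hW.contDiffAt.comp p ((hu.inner ℝ hu).of_le ENat.LEInfty.out))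

theorem stress_comm (h : IsGaugeAlgebra br ac b) (v w : Option (Fin n)) (q : E) :
    stress br ac b e A u v w q = stress br ac b e A u w v q := by
  rw [stress, stress, real_inner_comm]
  simp only [h.form_comm (gaugeCurv br e A v _ q)]

theorem sum_form_curv_nabla (h : IsGaugeAlgebra br ac b)
    (hA : ∀ i, ContDiffAt ℝ ∞ (A i) p) (v : Option (Fin n)) :
    ∑ i, ∑ j, b (gaugeCurv br e A (some i) (some j) p)
        (gaugeNabla br e A (some i) (gaugeCurv br e A v (some j)) p)
      = 1 / 2 * ∑ i, ∑ j, b (gaugeCurv br e A (some i) (some j) p)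
        (gaugeNabla br e A v (gaugeCurv br e A (some i) (some j)) p) := by
  have hB : ∀ i j : Fin n, gaugeNabla br e A v (gaugeCurv br e A (some i) (some j)) p
      = gaugeNabla br e A (some i) (gaugeCurv br e A v (some j)) p
        - gaugeNabla br e A (some j) (gaugeCurv br e A v (some i)) p := fun i j => by
    have h1 := bianchi (e := e) h.skew h.jacobi hA v (some i) (some j)
    have h2 : gaugeCurv br e A (some j) v = fun q => - gaugeCurv br e A v (some j) q :=
      funext fun q => gaugeCurv_skew h.skew _ _ q
    rw [h2, gaugeNabla_neg] at h1
    rw [eq_comm, ← sub_eq_zero, ← neg_eq_zero, ← h1]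
    abel
  have hsw : ∑ i, ∑ j, b (gaugeCurv br e A (some i) (some j) p)
        (gaugeNabla br e A (some j) (gaugeCurv br e A v (some i)) p)
      = - ∑ i, ∑ j, b (gaugeCurv br e A (some i) (some j) p)
        (gaugeNabla br e A (some i) (gaugeCurv br e A v (some j)) p) := by
    rw [Finset.sum_comm, ← Finset.sum_neg_distrib]
    refine Finset.sum_congr rfl fun i _ => ?_
    rw [← Finset.sum_neg_distrib]
    refine Finset.sum_congr rfl fun j _ => ?_
    rw [gaugeCurv_skew h.skew, map_neg, _root_.neg_apply]
  simp only [hB, map_sub, Finset.sum_sub_distrib, hsw]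
  ring

theorem dirD_gaugeEnergy (h : IsGaugeAlgebra br ac b)
    (hA : ∀ i, ContDiffAt ℝ ∞ (A i) p) (hu : ContDiffAt ℝ ∞ u p) (hW : ContDiff ℝ 1 W)
    (v : Option (Fin n)) :
    dirD (e v) (gaugeEnergy br ac b e A u W) p
      = 1 / 2 * (∑ i, ∑ j, b (gaugeCurv br e A (some i) (some j) p)
          (gaugeNabla br e A v (gaugeCurv br e A (some i) (some j)) p))
        + (∑ i, inner ℝ (gaugeD ac e A (some i) u p)
          (gaugeD ac e A v (gaugeD ac e A (some i) u) p))
        + 2 * deriv W (inner ℝ (u p) (u p)) * inner ℝ (u p) (gaugeD ac e A v u p) := by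
  have dF : ∀ i j, DifferentiableAt ℝ (gaugeCurv br e A i j) p :=
    fun i j => (contDiffAt_gaugeCurv hA i j).differentiableAt (by simp)
  have dD : ∀ i, DifferentiableAt ℝ (gaugeD ac e A i u) p :=
    fun i => (contDiffAt_gaugeD hA hu i).differentiableAt (by simp)
  have dFF : ∀ i j : Fin n, DifferentiableAt ℝ (fun q => b (gaugeCurv br e A (some i) (some j) q)
      (gaugeCurv br e A (some i) (some j) q)) p := fun i j =>
    (contDiffAt_bilin b (contDiffAt_gaugeCurv hA _ _)
      (contDiffAt_gaugeCurv hA _ _)).differentiableAt (n := ∞) (by simp)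
  have dDD : ∀ i : Fin n, DifferentiableAt ℝ (fun q => (inner ℝ (gaugeD ac e A (some i) u q)
      (gaugeD ac e A (some i) u q) : ℝ)) p := fun i => (dD _).inner ℝ (dD _)
  have du : DifferentiableAt ℝ u p := hu.differentiableAt (by simp)
  have duu : DifferentiableAt ℝ (fun q => (inner ℝ (u q) (u q) : ℝ)) p := du.inner ℝ du
  have dW : dirD (e v) (fun q => W (inner ℝ (u q) (u q))) p
      = deriv W (inner ℝ (u p) (u p)) * dirD (e v) (fun q => (inner ℝ (u q) (u q) : ℝ)) p := by
    have h1 : HasDerivAt W (deriv W (inner ℝ (u p) (u p))) (inner ℝ (u p) (u p)) :=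
      (hW.differentiable (by norm_num) _).hasDerivAt
    have h2 := h1.comp_hasFDerivAt (f := fun q => (inner ℝ (u q) (u q) : ℝ)) p duu.hasFDerivAt
    refine (congrArg (fun L => L (e v)) h2.fderiv).trans ?_
    simp [dirD]
  have dWd : DifferentiableAt ℝ (fun q => W (inner ℝ (u q) (u q))) p :=
    ((hW.differentiable (by norm_num)) _).comp p duu
  have d1 := DifferentiableAt.fun_sum (u := Finset.univ) fun i _ =>
    DifferentiableAt.fun_sum (u := Finset.univ) fun j _ => dFF i j
  have d2 := DifferentiableAt.fun_sum (u := Finset.univ) fun i _ => dDD i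
  refine (dirD_add (f := fun q => 1 / 4 * (∑ i, ∑ j, b (gaugeCurv br e A (some i) (some j) q)
    (gaugeCurv br e A (some i) (some j) q)) + 1 / 2 * (∑ i, inner ℝ (gaugeD ac e A (some i) u q)
      (gaugeD ac e A (some i) u q))) _ ((d1.const_mul _).add (d2.const_mul _)) dWd).trans ?_
  rw [dirD_add _ (d1.const_mul _) (d2.const_mul _), dirD_const_mul _ _ d1, dirD_const_mul _ _ d2,
    dirD_sum _ _ fun i _ => DifferentiableAt.fun_sum fun j _ => dFF i j, dirD_sum _ _ fun i _ => dDD i,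
    dW, dirD_inner h.inner_skew du du]
  have e1 : ∀ i, dirD (e v) (fun q => ∑ j, b (gaugeCurv br e A (some i) (some j) q)
      (gaugeCurv br e A (some i) (some j) q)) p
      = 2 * ∑ j, b (gaugeCurv br e A (some i) (some j) p)
          (gaugeNabla br e A v (gaugeCurv br e A (some i) (some j)) p) := fun i => by
    rw [dirD_sum _ _ fun j _ => dFF i j, Finset.mul_sum]
    refine Finset.sum_congr rfl fun j _ => ?_
    rw [dirD_form h.form_inv (dF _ _) (dF _ _), h.form_comm (gaugeNabla br e A v _ p)]
    ring
  have e2 : ∀ i : Fin n, dirD (e v) (fun q => (inner ℝ (gaugeD ac e A (some i) u q)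
      (gaugeD ac e A (some i) u q) : ℝ)) p = 2 * inner ℝ (gaugeD ac e A (some i) u p)
          (gaugeD ac e A v (gaugeD ac e A (some i) u) p) := fun i => by
    rw [dirD_inner h.inner_skew (dD _) (dD _), real_inner_comm]
    ring
  simp only [e1, e2, ← Finset.mul_sum]
  rw [real_inner_comm (u p) (gaugeD ac e A v u p)]
  ring

/-- The divergence of the stress tensor of a solution of the Yang-Mills-Higgs flow. -/
theorem sum_dirD_stress (h : IsGaugeAlgebra br ac b)
    (hA : ∀ i, ContDiffAt ℝ ∞ (A i) p) (hu : ContDiffAt ℝ ∞ u p) (hW : ContDiff ℝ 1 W)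
    (Z : Fin n → L)
    (hZ : ∀ j y, b y (Z j) = inner ℝ (ac y (u p)) (gaugeD ac e A (some j) u p))
    (hflowA : ∀ j, gaugeCurv br e A none (some j) p
      = ∑ i, gaugeNabla br e A (some i) (gaugeCurv br e A (some i) (some j)) p - Z j)
    (hflowu : gaugeD ac e A none u p = ∑ i : Fin n, gaugeD ac e A (some i) (gaugeD ac e A (some i) u) p
      - (2 * deriv W (inner ℝ (u p) (u p))) • u p)
    (v : Option (Fin n)) :
    ∑ i, dirD (e (some i)) (stress br ac b e A u (some i) v) p
      = dirD (e v) (gaugeEnergy br ac b e A u W) p + stress br ac b e A u none v p := by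
  have dF : ∀ i j, DifferentiableAt ℝ (gaugeCurv br e A i j) p :=
    fun i j => (contDiffAt_gaugeCurv hA i j).differentiableAt (by simp)
  have dD : ∀ i, DifferentiableAt ℝ (gaugeD ac e A i u) p :=
    fun i => (contDiffAt_gaugeD hA hu i).differentiableAt (by simp)
  have dFF : ∀ i j : Fin n, DifferentiableAt ℝ (fun q => b (gaugeCurv br e A (some i) (some j) q)
      (gaugeCurv br e A v (some j) q)) p := fun i j =>
    (contDiffAt_bilin b (contDiffAt_gaugeCurv hA _ _)
      (contDiffAt_gaugeCurv hA _ _)).differentiableAt (n := ∞) (by simp)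
  have key : ∀ i : Fin n, dirD (e (some i)) (stress br ac b e A u (some i) v) p
      = ∑ j, (b (gaugeNabla br e A (some i) (gaugeCurv br e A (some i) (some j)) p)
            (gaugeCurv br e A v (some j) p)
          + b (gaugeCurv br e A (some i) (some j) p)
            (gaugeNabla br e A (some i) (gaugeCurv br e A v (some j)) p))
        + (inner ℝ (gaugeD ac e A (some i) (gaugeD ac e A (some i) u) p) (gaugeD ac e A v u p)
          + inner ℝ (gaugeD ac e A (some i) u p)
            (gaugeD ac e A (some i) (gaugeD ac e A v u) p)) := fun i => by
    refine (dirD_add (f := fun q => ∑ j, b (gaugeCurv br e A (some i) (some j) q)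
      (gaugeCurv br e A v (some j) q)) _ (DifferentiableAt.fun_sum fun j _ => dFF i j)
      ((dD _).inner ℝ (dD _))).trans ?_
    rw [dirD_sum _ _ fun j _ => dFF i j, dirD_inner h.inner_skew (dD _) (dD _)]
    exact congrArg (· + _) (Finset.sum_congr rfl fun j _ =>
      dirD_form h.form_inv (dF _ _) (dF _ _) _)
  have hterm1 : ∑ i, ∑ j, b (gaugeNabla br e A (some i) (gaugeCurv br e A (some i) (some j)) p)
        (gaugeCurv br e A v (some j) p)
      = ∑ j, b (gaugeCurv br e A none (some j) p) (gaugeCurv br e A v (some j) p)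
        + ∑ j, inner ℝ (ac (gaugeCurv br e A v (some j) p) (u p))
            (gaugeD ac e A (some j) u p) := by
    rw [Finset.sum_comm, ← Finset.sum_add_distrib]
    refine Finset.sum_congr rfl fun j _ => ?_
    rw [← hZ, hflowA j, h.form_comm _ (Z j), ← _root_.add_apply, ← map_add, sub_add_cancel,
      map_sum, _root_.sum_apply]
  have hterm3 : ∑ i : Fin n, inner ℝ (gaugeD ac e A (some i) (gaugeD ac e A (some i) u) p)
        (gaugeD ac e A v u p)
      = inner ℝ (gaugeD ac e A none u p) (gaugeD ac e A v u p)
        + 2 * deriv W (inner ℝ (u p) (u p)) * inner ℝ (u p) (gaugeD ac e A v u p) := by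
    rw [hflowu, inner_sub_left, real_inner_smul_left, sum_inner]
    ring
  have hterm4 : ∀ i : Fin n, inner ℝ (gaugeD ac e A (some i) u p)
        (gaugeD ac e A (some i) (gaugeD ac e A v u) p)
      = inner ℝ (gaugeD ac e A (some i) u p) (gaugeD ac e A v (gaugeD ac e A (some i) u) p)
        - inner ℝ (ac (gaugeCurv br e A v (some i) p) (u p)) (gaugeD ac e A (some i) u p) :=
    fun i => by
    have h1 := congrArg (fun z => (inner ℝ (gaugeD ac e A (some i) u p) z : ℝ))
      (gaugeD_comm (e := e) h.rep hA hu v (some i))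
    simp only [inner_sub_right] at h1
    rw [real_inner_comm _ (ac _ _)]
    linarith
  simp only [key, Finset.sum_add_distrib, hterm1, hterm3, hterm4, Finset.sum_sub_distrib,
    sum_form_curv_nabla h hA v]
  rw [dirD_gaugeEnergy h hA hu hW v, stress]
  ring

end Stress

section Quadratic

variable {n : ℕ}

/-- The quadratic form with matrix `M` on space-time. -/
def spaceTimeQuad (M : Option (Fin n) → Option (Fin n) → ℝ) (c : Option (Fin n) → ℝ) : ℝ :=
  ∑ v, ∑ w, c v * c w * M v w

theorem spaceTimeQuad_spatial_le {M : Option (Fin n) → Option (Fin n) → ℝ}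
    (hpos : ∀ c, 0 ≤ spaceTimeQuad M c) (hsymm : ∀ v w, M v w = M w v) (g : Fin n → ℝ) :
    ∑ i, ∑ k, g i * g k * M (some i) (some k) ≤ (∑ i, g i ^ 2) * ∑ i, M (some i) (some i) := by
  classical
  have h1 : ∀ i k : Fin n, 0 ≤ g i ^ 2 * M (some k) (some k) + g k ^ 2 * M (some i) (some i)
      - 2 * (g i * g k * M (some i) (some k)) := fun i k => by
    have := hpos (g i • Pi.single (some k) 1 - g k • Pi.single (some i) 1)
    simp [spaceTimeQuad, Pi.single_apply, sub_mul, mul_sub,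
      Finset.sum_sub_distrib] at this
    rw [hsymm (some k) (some i)] at this
    linarith
  have h2 : 0 ≤ ∑ i, ∑ k, (g i ^ 2 * M (some k) (some k) + g k ^ 2 * M (some i) (some i)
      - 2 * (g i * g k * M (some i) (some k))) :=
    Finset.sum_nonneg fun i _ => Finset.sum_nonneg fun k _ => h1 i k
  simp only [Finset.sum_sub_distrib, Finset.sum_add_distrib, ← Finset.mul_sum,
    ← Finset.sum_mul] at h2
  linarith

theorem spaceTimeQuad_cross_le {M : Option (Fin n) → Option (Fin n) → ℝ}
    (hpos : ∀ c, 0 ≤ spaceTimeQuad M c) (hsymm : ∀ v w, M v w = M w v) (s g : Fin n → ℝ) (z : ℝ) :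
    -(∑ i, 2 * z * g i * (M (some i) none + ∑ k, s k * M (some i) (some k)))
      ≤ 1 / 2 * (z ^ 2 * spaceTimeQuad M (fun v => v.elim 1 s))
        + 2 * ((∑ i, g i ^ 2) * ∑ i, M (some i) (some i)) := by
  have h1 := hpos (fun v => v.elim z (fun i => z * s i + 2 * g i))
  have h2 := spaceTimeQuad_spatial_le hpos hsymm g
  have h3 : spaceTimeQuad M (fun v => v.elim z (fun i => z * s i + 2 * g i))
      = z ^ 2 * spaceTimeQuad M (fun v => v.elim 1 s)
        + 4 * z * (∑ i, g i * (M (some i) none + ∑ k, s k * M (some i) (some k)))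
        + 4 * ∑ i, ∑ k, g i * g k * M (some i) (some k) := by
    have hsw : ∑ i, ∑ k, s i * g k * M (some i) (some k)
        = ∑ i, ∑ k, g i * s k * M (some i) (some k) := by
      rw [Finset.sum_comm]
      refine Finset.sum_congr rfl fun i _ => Finset.sum_congr rfl fun k _ => ?_
      rw [hsymm]; ring
    have e1 : spaceTimeQuad M (fun v => v.elim z (fun i => z * s i + 2 * g i))
        = z ^ 2 * M none none + 2 * (∑ i, z * (z * s i + 2 * g i) * M (some i) none)
          + ∑ i, ∑ k, (z * s i + 2 * g i) * (z * s k + 2 * g k) * M (some i) (some k) := by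
      simp only [spaceTimeQuad, Fintype.sum_option, Option.elim, Finset.sum_add_distrib]
      simp only [hsymm none]
      rw [Finset.sum_congr rfl fun i _ => by rw [mul_comm (z * s i + 2 * g i) z]]
      ring
    have e2 : spaceTimeQuad M (fun v => v.elim 1 s)
        = M none none + 2 * (∑ i, s i * M (some i) none)
          + ∑ i, ∑ k, s i * s k * M (some i) (some k) := by
      simp only [spaceTimeQuad, Fintype.sum_option, Option.elim, Finset.sum_add_distrib]
      simp only [hsymm none, one_mul, mul_one]
      ring
    have e3 : ∑ i, ∑ k, (z * s i + 2 * g i) * (z * s k + 2 * g k) * M (some i) (some k)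
        = z ^ 2 * (∑ i, ∑ k, s i * s k * M (some i) (some k))
          + 2 * z * (∑ i, ∑ k, s i * g k * M (some i) (some k))
          + 2 * z * (∑ i, ∑ k, g i * s k * M (some i) (some k))
          + 4 * ∑ i, ∑ k, g i * g k * M (some i) (some k) := by
      simp only [Finset.mul_sum, ← Finset.sum_add_distrib]
      refine Finset.sum_congr rfl fun i _ => Finset.sum_congr rfl fun k _ => ?_
      ring
    have e4 : ∑ i, z * (z * s i + 2 * g i) * M (some i) none
        = z ^ 2 * (∑ i, s i * M (some i) none) + 2 * z * ∑ i, g i * M (some i) none := by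
      simp only [Finset.mul_sum, ← Finset.sum_add_distrib]
      refine Finset.sum_congr rfl fun i _ => ?_
      ring
    have e5 : ∑ i, g i * (M (some i) none + ∑ k, s k * M (some i) (some k))
        = ∑ i, g i * M (some i) none + ∑ i, ∑ k, g i * s k * M (some i) (some k) := by
      simp only [mul_add, Finset.mul_sum, Finset.sum_add_distrib, mul_assoc]
    rw [e1, e2, e3, e4, e5, hsw]
    ring
  have h4 : ∑ i, 2 * z * g i * (M (some i) none + ∑ k, s k * M (some i) (some k))
      = 2 * z * ∑ i, g i * (M (some i) none + ∑ k, s k * M (some i) (some k)) := by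
    rw [Finset.mul_sum]
    exact Finset.sum_congr rfl fun i _ => by ring
  rw [h3] at h1
  rw [h4]
  linarith

end Quadratic

section Weighted

variable {E L V : Type*} [NormedAddCommGroup E] [NormedSpace ℝ E] [NormedAddCommGroup L]
  [NormedSpace ℝ L] [NormedAddCommGroup V] [InnerProductSpace ℝ V] {n : ℕ}
  {br : L →L[ℝ] L →L[ℝ] L} {ac : L →L[ℝ] V →L[ℝ] V} {b : L →L[ℝ] L →L[ℝ] ℝ}
  {e : Option (Fin n) → E} {A : Option (Fin n) → E → L} {u : E → V} {W : ℝ → ℝ} {p : E}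

theorem spaceTimeQuad_stress (c : Option (Fin n) → ℝ) (q : E) :
    spaceTimeQuad (fun v w => stress br ac b e A u v w q) c
      = (∑ j, b (∑ v, c v • gaugeCurv br e A v (some j) q) (∑ v, c v • gaugeCurv br e A v (some j) q))
        + ‖∑ v, c v • gaugeD ac e A v u q‖ ^ 2 := by
  have e1 : ∀ j, b (∑ v, c v • gaugeCurv br e A v (some j) q) (∑ v, c v • gaugeCurv br e A v (some j) q)
      = ∑ v, ∑ w, c v * c w * b (gaugeCurv br e A v (some j) q) (gaugeCurv br e A w (some j) q) :=
    fun j => by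
    rw [map_sum b, _root_.sum_apply]
    refine Finset.sum_congr rfl fun v _ => ?_
    rw [map_sum]
    refine Finset.sum_congr rfl fun w _ => ?_
    rw [map_smul, map_smul, _root_.smul_apply, smul_eq_mul, smul_eq_mul]
    ring
  have e2 : ‖∑ v, c v • gaugeD ac e A v u q‖ ^ 2
      = ∑ v, ∑ w, c v * c w * inner ℝ (gaugeD ac e A v u q) (gaugeD ac e A w u q) := by
    rw [← real_inner_self_eq_norm_sq, sum_inner]
    refine Finset.sum_congr rfl fun v _ => ?_
    rw [inner_sum]
    refine Finset.sum_congr rfl fun w _ => ?_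
    rw [real_inner_smul_left, real_inner_smul_right]
    ring
  rw [e2, Finset.sum_congr rfl fun j _ => e1 j, Finset.sum_comm, ← Finset.sum_add_distrib]
  refine Finset.sum_congr rfl fun v _ => ?_
  rw [Finset.sum_comm, ← Finset.sum_add_distrib]
  refine Finset.sum_congr rfl fun w _ => ?_
  simp only [stress, mul_add, Finset.mul_sum]

theorem spaceTimeQuad_stress_nonneg (h : IsGaugeAlgebra br ac b) (c : Option (Fin n) → ℝ) (q : E) :
    0 ≤ spaceTimeQuad (fun v w => stress br ac b e A u v w q) c := by
  rw [spaceTimeQuad_stress]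
  exact add_nonneg (Finset.sum_nonneg fun j _ => h.form_nonneg _) (sq_nonneg _)

theorem sum_stress_le (hW : ∀ s, 0 ≤ W s) (q : E) :
    ∑ i : Fin n, stress br ac b e A u (some i) (some i) q ≤ 4 * gaugeEnergy br ac b e A u W q := by
  have h1 : 0 ≤ ∑ i : Fin n, (inner ℝ (gaugeD ac e A (some i) u q) (gaugeD ac e A (some i) u q) : ℝ) :=
    Finset.sum_nonneg fun i _ => real_inner_self_nonneg
  have h2 := hW (inner ℝ (u q) (u q))
  simp only [stress, Finset.sum_add_distrib, gaugeEnergy]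
  linarith

theorem gaugeEnergy_nonneg (h : IsGaugeAlgebra br ac b) (hW : ∀ s, 0 ≤ W s) (q : E) :
    0 ≤ gaugeEnergy br ac b e A u W q := by
  refine add_nonneg (add_nonneg (mul_nonneg (by norm_num) ?_) (mul_nonneg (by norm_num) ?_)) (hW _)
  · exact Finset.sum_nonneg fun i _ => Finset.sum_nonneg fun j _ => h.form_nonneg _
  · exact Finset.sum_nonneg fun i _ => real_inner_self_nonneg

variable (br ac b e A u W) in
/-- The spatial flux of the weighted energy `φ · e(A, u)`, for the vector field `∂_t + ∑ s_k ∂_k`. -/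
def energyFlux (φ : E → ℝ) (s : Fin n → E → ℝ) (i : Fin n) (q : E) : ℝ :=
  φ q * (stress br ac b e A u (some i) none q
    + ∑ k, s k q * stress br ac b e A u (some i) (some k) q)
    - φ q * s i q * gaugeEnergy br ac b e A u W q

theorem dirD_weighted_energy
    (hA : ∀ i, ContDiffAt ℝ ∞ (A i) p) (hu : ContDiffAt ℝ ∞ u p) (hW : ContDiff ℝ 1 W)
    (hlaw : ∀ v, ∑ i, dirD (e (some i)) (stress br ac b e A u (some i) v) p
      = dirD (e v) (gaugeEnergy br ac b e A u W) p + stress br ac b e A u none v p)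
    {φ : E → ℝ} {s : Fin n → E → ℝ} {g : Fin n → ℝ} {δ : ℝ}
    (hφ : DifferentiableAt ℝ φ p) (hs : ∀ k, DifferentiableAt ℝ (s k) p)
    (hsd : ∀ i k, dirD (e (some i)) (s k) p = if i = k then δ else 0)
    (hφd : ∀ i, dirD (e (some i)) φ p = s i p * φ p + g i)
    (hφt : dirD (e none) φ p = φ p * (-((n : ℝ) - 4) * δ - ∑ i, s i p ^ 2)) :
    dirD (e none) (fun q => φ q * gaugeEnergy br ac b e A u W q) p
      = ∑ i, dirD (e (some i)) (energyFlux br ac b e A u W φ s i) p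
        - φ p * spaceTimeQuad (fun v w => stress br ac b e A u v w p) (fun v => v.elim 1 (s · p))
        - ∑ i, g i * (stress br ac b e A u (some i) none p
            + ∑ k, s k p * stress br ac b e A u (some i) (some k) p)
        + gaugeEnergy br ac b e A u W p * (4 * δ * φ p + ∑ i, g i * s i p)
        - φ p * δ * ∑ i : Fin n, stress br ac b e A u (some i) (some i) p := by
  have dM : ∀ v w, DifferentiableAt ℝ (stress br ac b e A u v w) p :=
    fun v w => (contDiffAt_stress hA hu v w).differentiableAt (by simp)
  have dE : DifferentiableAt ℝ (gaugeEnergy br ac b e A u W) p :=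
    (contDiffAt_gaugeEnergy hA hu hW).differentiableAt (by norm_num)
  have dS : ∀ i, DifferentiableAt ℝ (fun q => ∑ k, s k q * stress br ac b e A u (some i) (some k) q)
      p := fun i => DifferentiableAt.fun_sum fun k _ => (hs k).mul (dM _ _)
  have key : ∀ i, dirD (e (some i)) (energyFlux br ac b e A u W φ s i) p
      = (s i p * φ p + g i) * (stress br ac b e A u (some i) none p
            + ∑ k, s k p * stress br ac b e A u (some i) (some k) p)
        + φ p * (dirD (e (some i)) (stress br ac b e A u (some i) none) p
          + (δ * stress br ac b e A u (some i) (some i) p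
            + ∑ k, s k p * dirD (e (some i)) (stress br ac b e A u (some i) (some k)) p))
        - (((s i p * φ p + g i) * s i p + φ p * δ) * gaugeEnergy br ac b e A u W p
          + φ p * s i p * dirD (e (some i)) (gaugeEnergy br ac b e A u W) p) := fun i => by
    refine (dirD_sub (f := fun q => φ q * (stress br ac b e A u (some i) none q
      + ∑ k, s k q * stress br ac b e A u (some i) (some k) q))
      (g := fun q => φ q * s i q * gaugeEnergy br ac b e A u W q) _
      (hφ.mul ((dM _ _).add (dS i))) ((hφ.mul (hs i)).mul dE)).trans ?_
    have hadd : DifferentiableAt ℝ (fun q => stress br ac b e A u (some i) none q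
      + ∑ k, s k q * stress br ac b e A u (some i) (some k) q) p := (dM _ _).add (dS i)
    have hmul : DifferentiableAt ℝ (fun q => φ q * s i q) p := hφ.mul (hs i)
    have hsm : ∀ k, DifferentiableAt ℝ (fun q => s k q * stress br ac b e A u (some i) (some k) q)
      p := fun k => (hs k).mul (dM _ _)
    rw [dirD_mul _ hφ hadd, dirD_add _ (dM _ _) (dS i),
      dirD_mul _ hmul dE, dirD_mul _ hφ (hs i),
      dirD_sum _ _ fun k _ => hsm k, hφd, hsd, if_pos rfl]
    have : ∀ k, dirD (e (some i)) (fun q => s k q * stress br ac b e A u (some i) (some k) q) p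
        = (if i = k then δ else 0) * stress br ac b e A u (some i) (some k) p
          + s k p * dirD (e (some i)) (stress br ac b e A u (some i) (some k)) p := fun k => by
      rw [dirD_mul _ (hs k) (dM _ _), hsd]
    simp only [this, Finset.sum_add_distrib, ite_mul, zero_mul, Finset.sum_ite_eq,
      Finset.mem_univ, if_true]
  have hl2 : ∑ i, ∑ k, s k p * dirD (e (some i)) (stress br ac b e A u (some i) (some k)) p
      = ∑ k, s k p * (dirD (e (some k)) (gaugeEnergy br ac b e A u W) p
        + stress br ac b e A u none (some k) p) := by
    rw [Finset.sum_comm]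
    refine Finset.sum_congr rfl fun k _ => ?_
    rw [← Finset.mul_sum, hlaw]
  have hq : spaceTimeQuad (fun v w => stress br ac b e A u v w p) (fun v => v.elim 1 (s · p))
      = stress br ac b e A u none none p + ∑ k, s k p * stress br ac b e A u none (some k) p
        + ∑ i, s i p * (stress br ac b e A u (some i) none p
            + ∑ k, s k p * stress br ac b e A u (some i) (some k) p) := by
    simp only [spaceTimeQuad, Fintype.sum_option, Option.elim, one_mul, mul_add,
      Finset.mul_sum, mul_assoc]
  rw [dirD_mul _ hφ dE, hφt, hq]
  simp only [key]
  have r1 : ∑ i, (s i p * φ p + g i) * (stress br ac b e A u (some i) none p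
            + ∑ k, s k p * stress br ac b e A u (some i) (some k) p)
      = φ p * ∑ i, s i p * (stress br ac b e A u (some i) none p
            + ∑ k, s k p * stress br ac b e A u (some i) (some k) p)
        + ∑ i, g i * (stress br ac b e A u (some i) none p
            + ∑ k, s k p * stress br ac b e A u (some i) (some k) p) := by
    rw [Finset.mul_sum, ← Finset.sum_add_distrib]
    exact Finset.sum_congr rfl fun i _ => by ring
  have r2 : ∑ i, (((s i p * φ p + g i) * s i p + φ p * δ) * gaugeEnergy br ac b e A u W p
          + φ p * s i p * dirD (e (some i)) (gaugeEnergy br ac b e A u W) p)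
      = (φ p * ∑ i, s i p ^ 2 + ∑ i, g i * s i p + n * (φ p * δ)) * gaugeEnergy br ac b e A u W p
        + φ p * ∑ i, s i p * dirD (e (some i)) (gaugeEnergy br ac b e A u W) p := by
    have : (n : ℝ) * (φ p * δ) = ∑ _i : Fin n, φ p * δ := by simp
    rw [this, Finset.mul_sum, Finset.mul_sum, ← Finset.sum_add_distrib, ← Finset.sum_add_distrib,
      Finset.sum_mul, ← Finset.sum_add_distrib]
    exact Finset.sum_congr rfl fun i _ => by ring
  rw [Finset.sum_sub_distrib, Finset.sum_add_distrib, r1, r2, ← Finset.mul_sum,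
    Finset.sum_add_distrib, Finset.sum_add_distrib, hlaw none, hl2, ← Finset.mul_sum]
  simp only [mul_add, Finset.sum_add_distrib]
  ring

theorem dirD_weighted_energy_le (h : IsGaugeAlgebra br ac b)
    (hA : ∀ i, ContDiffAt ℝ ∞ (A i) p) (hu : ContDiffAt ℝ ∞ u p) (hW : ContDiff ℝ 1 W)
    (hW0 : ∀ s, 0 ≤ W s)
    (hlaw : ∀ v, ∑ i, dirD (e (some i)) (stress br ac b e A u (some i) v) p
      = dirD (e v) (gaugeEnergy br ac b e A u W) p + stress br ac b e A u none v p)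
    {φ : E → ℝ} {s : Fin n → E → ℝ} {g : Fin n → ℝ} {δ K z : ℝ} (hδ : δ ≤ 0) (hK : 0 ≤ K)
    (hφ : DifferentiableAt ℝ φ p) (hs : ∀ k, DifferentiableAt ℝ (s k) p)
    (hsd : ∀ i k, dirD (e (some i)) (s k) p = if i = k then δ else 0)
    (hφp : φ p = K * z ^ 2)
    (hφd : ∀ i, dirD (e (some i)) φ p = s i p * φ p + K * (2 * z * g i))
    (hφt : dirD (e none) φ p = φ p * (-((n : ℝ) - 4) * δ - ∑ i, s i p ^ 2)) :
    dirD (e none) (fun q => φ q * gaugeEnergy br ac b e A u W q) p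
      + 1 / 2 * (φ p * spaceTimeQuad (fun v w => stress br ac b e A u v w p)
          (fun v => v.elim 1 (s · p)))
      ≤ ∑ i, dirD (e (some i)) (energyFlux br ac b e A u W φ s i) p
        + K * (8 * ∑ i, g i ^ 2 + 2 * z * ∑ i, g i * s i p) * gaugeEnergy br ac b e A u W p := by
  rw [dirD_weighted_energy hA hu hW hlaw hφ hs hsd hφd hφt]
  have h1 := spaceTimeQuad_cross_le (fun c => spaceTimeQuad_stress_nonneg (e := e) (A := A) (u := u)
    h c p) (fun v w => stress_comm h v w p) (s · p) g z
  have h2 := sum_stress_le (br := br) (ac := ac) (b := b) (e := e) (A := A) (u := u) hW0 p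
  have h3 : ∑ i, K * (2 * z * g i) * (stress br ac b e A u (some i) none p
      + ∑ k, s k p * stress br ac b e A u (some i) (some k) p)
      = K * ∑ i, 2 * z * g i * (stress br ac b e A u (some i) none p
      + ∑ k, s k p * stress br ac b e A u (some i) (some k) p) := by
    rw [Finset.mul_sum]
    exact Finset.sum_congr rfl fun i _ => by ring
  have h4 : ∑ i, K * (2 * z * g i) * s i p = K * (2 * z * ∑ i, g i * s i p) := by
    rw [Finset.mul_sum, Finset.mul_sum]
    exact Finset.sum_congr rfl fun i _ => by ring
  have hφ0 : 0 ≤ φ p := hφp ▸ mul_nonneg hK (sq_nonneg z)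
  have h5 := mul_le_mul_of_nonneg_left h1 hK
  have h6 : 0 ≤ φ p * -δ * (4 * gaugeEnergy br ac b e A u W p
      - ∑ i : Fin n, stress br ac b e A u (some i) (some i) p) :=
    mul_nonneg (mul_nonneg hφ0 (neg_nonneg.2 hδ)) (sub_nonneg.2 h2)
  have h7 : 0 ≤ 2 * K * (∑ i, g i ^ 2) * (4 * gaugeEnergy br ac b e A u W p
      - ∑ i : Fin n, stress br ac b e A u (some i) (some i) p) :=
    mul_nonneg (mul_nonneg (by positivity) (Finset.sum_nonneg fun i _ => sq_nonneg _))
      (sub_nonneg.2 h2)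
  rw [h3, h4]
  have h8 : φ p * spaceTimeQuad (fun v w => stress br ac b e A u v w p) (fun v => v.elim 1 (s · p))
      = K * (z ^ 2 * spaceTimeQuad (fun v w => stress br ac b e A u v w p)
        (fun v => v.elim 1 (s · p))) := by rw [hφp]; ring
  linarith

end Weighted
section Integration
open MeasureTheory Set

variable {n : ℕ}

/-- The spatial and (for `none`) temporal unit vectors of space-time. -/
def stDir : Option (Fin n) → Eu n × ℝ
  | none => (0, 1)
  | some i => (EuclideanSpace.single i 1, 0)

variable {a T t₀ t₁ R : ℝ} {X : Eu n}

theorem mem_slab {t : ℝ} (h : t ∈ Icc t₀ t₁) (h0 : a < t₀) (h1 : t₁ < T) : t ∈ Ioo a T :=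
  ⟨h0.trans_le h.1, h.2.trans_lt h1⟩

theorem integrable_slab {f : Eu n × ℝ → ℝ} (hf : ContinuousOn f (univ ×ˢ Ioo a T))
    (h0 : a < t₀) (h1 : t₁ < T) (hK : ∀ p : Eu n × ℝ, p.1 ∉ Metric.closedBall X R → f p = 0) :
    IntegrableOn f (univ ×ˢ Ioc t₀ t₁) := by
  have h2 : IntegrableOn f (Metric.closedBall X R ×ˢ Icc t₀ t₁) := by
    refine ContinuousOn.integrableOn_compact ((isCompact_closedBall X R).prod isCompact_Icc)
      (hf.mono ?_)
    rintro ⟨x, t⟩ ⟨-, ht⟩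
    exact ⟨mem_univ _, mem_slab ht h0 h1⟩
  have h3 : IntegrableOn f (univ ×ˢ Icc t₀ t₁) := by
    refine h2.of_forall_sdiff_eq_zero (MeasurableSet.univ.prod measurableSet_Icc) ?_
    rintro ⟨x, t⟩ ⟨⟨-, ht⟩, hx⟩
    exact hK _ fun hx' => hx ⟨hx', ht⟩
  exact h3.mono_set (prod_mono le_rfl Ioc_subset_Icc_self)

theorem integrable_slice {f : Eu n × ℝ → ℝ} (hf : ContinuousOn f (univ ×ˢ Ioo a T)) {t : ℝ}
    (ht : t ∈ Ioo a T) (hK : ∀ p : Eu n × ℝ, p.1 ∉ Metric.closedBall X R → f p = 0) :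
    Integrable (fun x => f (x, t)) := by
  have hc : Continuous fun x => f (x, t) := by
    rw [← continuousOn_univ]
    exact hf.comp (by fun_prop) fun x _ => ⟨mem_univ _, ht⟩
  refine hc.integrable_of_hasCompactSupport ?_
  exact HasCompactSupport.intro (isCompact_closedBall X R) fun x hx => hK (x, t) hx

theorem continuousOn_dirD {f : Eu n × ℝ → ℝ} (hf : ∀ p ∈ univ ×ˢ Ioo a T, ContDiffAt ℝ 1 f p)
    (v : Eu n × ℝ) : ContinuousOn (dirD v f) (univ ×ˢ Ioo a T) := fun p hp =>
  (((hf p hp).fderiv_right (m := 0) (by norm_num)).continuousAt.clm_apply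
    continuousAt_const).continuousWithinAt

theorem dirD_eq_zero_off {f : Eu n × ℝ → ℝ}
    (hK : ∀ p : Eu n × ℝ, p.1 ∉ Metric.closedBall X R → f p = 0) (v p : Eu n × ℝ)
    (hp : p.1 ∉ Metric.closedBall X R) : dirD v f p = 0 := by
  have h : f =ᶠ[nhds p] fun _ => 0 := by
    have ho : IsOpen {q : Eu n × ℝ | q.1 ∉ Metric.closedBall X R} :=
      (Metric.isClosed_closedBall.preimage continuous_fst).isOpen_compl
    filter_upwards [ho.mem_nhds hp] with q hq using hK q hq
  rw [dirD, h.fderiv_eq]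
  simp

theorem integral_slab_symm {f : Eu n × ℝ → ℝ} (hf : IntegrableOn f (univ ×ˢ Ioc t₀ t₁)) :
    ∫ p in univ ×ˢ Ioc t₀ t₁, f p = ∫ t in Ioc t₀ t₁, ∫ x, f (x, t) := by
  have hμ : (volume : Measure (Eu n × ℝ)).restrict (univ ×ˢ Ioc t₀ t₁)
      = (volume : Measure (Eu n)).prod (volume.restrict (Ioc t₀ t₁)) := by
    rw [Measure.volume_eq_prod, ← Measure.prod_restrict, Measure.restrict_univ]
  rw [IntegrableOn, hμ] at hf
  rw [hμ, integral_prod_symm _ hf]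

theorem integral_slab {f : Eu n × ℝ → ℝ} (hf : IntegrableOn f (univ ×ˢ Ioc t₀ t₁)) :
    ∫ p in univ ×ˢ Ioc t₀ t₁, f p = ∫ x, ∫ t in Ioc t₀ t₁, f (x, t) := by
  have hμ : (volume : Measure (Eu n × ℝ)).restrict (univ ×ˢ Ioc t₀ t₁)
      = (volume : Measure (Eu n)).prod (volume.restrict (Ioc t₀ t₁)) := by
    rw [Measure.volume_eq_prod, ← Measure.prod_restrict, Measure.restrict_univ]
  rw [IntegrableOn, hμ] at hf
  rw [hμ, integral_prod _ hf]

theorem integral_slab_dirD_space {f : Eu n × ℝ → ℝ}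
    (hf : ∀ p ∈ univ ×ˢ Ioo a T, ContDiffAt ℝ 1 f p) (h0 : a < t₀) (h1 : t₁ < T)
    (hK : ∀ p : Eu n × ℝ, p.1 ∉ Metric.closedBall X R → f p = 0) (i : Fin n) :
    ∫ p in univ ×ˢ Ioc t₀ t₁, dirD (stDir (some i)) f p = 0 := by
  have hD := continuousOn_dirD hf (stDir (some i))
  have hD0 := dirD_eq_zero_off hK (stDir (some i))
  have hfc : ContinuousOn f (univ ×ˢ Ioo a T) :=
    fun p hp => (hf p hp).continuousAt.continuousWithinAt
  rw [integral_slab_symm (integrable_slab hD h0 h1 hD0)]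
  refine integral_eq_zero_of_ae ?_
  filter_upwards [ae_restrict_mem measurableSet_Ioc] with t ht
  have ht' : t ∈ Ioo a T := mem_slab (Ioc_subset_Icc_self ht) h0 h1
  have hd : ∀ x, HasFDerivAt (fun x => f (x, t))
      ((fderiv ℝ f (x, t)).comp (ContinuousLinearMap.inl ℝ (Eu n) ℝ)) x := fun x =>
    (((hf (x, t) ⟨mem_univ _, ht'⟩).differentiableAt (by norm_num)).hasFDerivAt).comp
      (f := fun x : Eu n => (x, t)) x ((hasFDerivAt_id x).prodMk (hasFDerivAt_const t x))
  have he : ∀ x, dirD (stDir (some i)) f (x, t)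
      = fderiv ℝ (fun x => f (x, t)) x (EuclideanSpace.single i 1) := fun x => by
    rw [(hd x).fderiv]
    simp [dirD, stDir]
  have hi := integrable_slice hD ht' hD0
  have h := integral_mul_fderiv_eq_neg_fderiv_mul_of_integrable (μ := (volume : Measure (Eu n)))
    (f := fun _ => (1 : ℝ)) (g := fun x => f (x, t)) (v := EuclideanSpace.single i 1)
    (by simp) (by simpa [he] using hi) (by simpa using integrable_slice hfc ht' hK)
    (fun x _ => differentiableAt_const _) (fun x _ => (hd x).differentiableAt)
  simpa [he] using h

theorem integral_slab_dirD_time {f : Eu n × ℝ → ℝ} (h01 : t₀ ≤ t₁)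
    (hf : ∀ p ∈ univ ×ˢ Ioo a T, ContDiffAt ℝ 1 f p) (h0 : a < t₀) (h1 : t₁ < T)
    (hK : ∀ p : Eu n × ℝ, p.1 ∉ Metric.closedBall X R → f p = 0) :
    ∫ p in univ ×ˢ Ioc t₀ t₁, dirD (stDir none) f p
      = (∫ x, f (x, t₁)) - ∫ x, f (x, t₀) := by
  have hD := continuousOn_dirD hf (stDir none)
  have hD0 := dirD_eq_zero_off hK (stDir none)
  have hfc : ContinuousOn f (univ ×ˢ Ioo a T) :=
    fun p hp => (hf p hp).continuousAt.continuousWithinAt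
  rw [integral_slab (integrable_slab hD h0 h1 hD0), ← integral_sub
    (integrable_slice hfc (mem_slab (right_mem_Icc.2 h01) h0 h1) hK)
    (integrable_slice hfc (mem_slab (left_mem_Icc.2 h01) h0 h1) hK)]
  refine integral_congr_ae (Filter.Eventually.of_forall fun x => ?_)
  simp only
  rw [← intervalIntegral.integral_of_le h01]
  have hd : ∀ t ∈ uIcc t₀ t₁, HasDerivAt (fun t => f (x, t)) (dirD (stDir none) f (x, t)) t := by
    intro t ht
    rw [uIcc_of_le h01] at ht
    have h := ((hf (x, t) ⟨mem_univ _, mem_slab ht h0 h1⟩).differentiableAt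
      (by norm_num)).hasFDerivAt.comp_hasDerivAt (f := fun t : ℝ => (x, t)) t
      ((hasDerivAt_const t x).prodMk (hasDerivAt_id t))
    exact h
  refine intervalIntegral.integral_eq_sub_of_hasDerivAt hd ?_
  refine ContinuousOn.intervalIntegrable (hD.comp (by fun_prop) fun t ht => ⟨mem_univ _, ?_⟩)
  rw [uIcc_of_le h01] at ht
  exact mem_slab ht h0 h1

theorem integral_le_of_dirD_le {f S k : Eu n × ℝ → ℝ} {g : Fin n → Eu n × ℝ → ℝ} (h01 : t₀ ≤ t₁)
    (h0 : a < t₀) (h1 : t₁ < T)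
    (hf : ∀ p ∈ univ ×ˢ Ioo a T, ContDiffAt ℝ 1 f p)
    (hg : ∀ i, ∀ p ∈ univ ×ˢ Ioo a T, ContDiffAt ℝ 1 (g i) p)
    (hS : ContinuousOn S (univ ×ˢ Ioo a T)) (hk : ContinuousOn k (univ ×ˢ Ioo a T))
    (hfK : ∀ p : Eu n × ℝ, p.1 ∉ Metric.closedBall X R → f p = 0)
    (hgK : ∀ i, ∀ p : Eu n × ℝ, p.1 ∉ Metric.closedBall X R → g i p = 0)
    (hSK : ∀ p : Eu n × ℝ, p.1 ∉ Metric.closedBall X R → S p = 0)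
    (hkK : ∀ p : Eu n × ℝ, p.1 ∉ Metric.closedBall X R → k p = 0)
    (hle : ∀ p ∈ univ ×ˢ Ioo a T, dirD (stDir none) f p + S p
      ≤ ∑ i, dirD (stDir (some i)) (g i) p + k p) :
    (∫ x, f (x, t₁)) + ∫ p in univ ×ˢ Ioc t₀ t₁, S p
      ≤ (∫ x, f (x, t₀)) + ∫ p in univ ×ˢ Ioc t₀ t₁, k p := by
  have i1 := integrable_slab (continuousOn_dirD hf (stDir none)) h0 h1
    (dirD_eq_zero_off hfK (stDir none))
  have i2 := integrable_slab hS h0 h1 hSK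
  have i3 := integrable_slab hk h0 h1 hkK
  have i4 := fun i => integrable_slab (continuousOn_dirD (hg i) (stDir (some i))) h0 h1
    (dirD_eq_zero_off (hgK i) (stDir (some i)))
  have h := setIntegral_mono_on (i1.add i2) ((integrable_finsetSum Finset.univ fun i _ => i4 i).add i3)
    (MeasurableSet.univ.prod measurableSet_Ioc) fun p hp =>
      hle p ⟨mem_univ _, mem_slab (Ioc_subset_Icc_self hp.2) h0 h1⟩
  simp only [Pi.add_apply] at h
  rw [integral_add i1 i2, integral_add (integrable_finsetSum Finset.univ fun i _ => i4 i) i3,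
    integral_finsetSum _ fun i _ => i4 i, integral_slab_dirD_time h01 hf h0 h1 hfK] at h
  simp only [fun i => integral_slab_dirD_space (hg i) h0 h1 (hgK i) i, Finset.sum_const_zero] at h
  linarith

theorem ofReal_integral_le_lintegral {α : Type*} [MeasurableSpace α] {μ : Measure α} {f : α → ℝ}
    (hf : Integrable f μ) : ENNReal.ofReal (∫ x, f x ∂μ) ≤ ∫⁻ x, ENNReal.ofReal (f x) ∂μ := by
  rw [integral_eq_lintegral_pos_part_sub_lintegral_neg_part hf]
  refine (ENNReal.ofReal_le_ofReal (sub_le_self _ ENNReal.toReal_nonneg)).trans ?_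
  exact ENNReal.ofReal_toReal_le

theorem lintegral_le_of_dirD_le {f S k : Eu n × ℝ → ℝ} {g : Fin n → Eu n × ℝ → ℝ} (h01 : t₀ ≤ t₁)
    (h0 : a < t₀) (h1 : t₁ < T)
    (hf : ∀ p ∈ univ ×ˢ Ioo a T, ContDiffAt ℝ 1 f p)
    (hg : ∀ i, ∀ p ∈ univ ×ˢ Ioo a T, ContDiffAt ℝ 1 (g i) p)
    (hS : ContinuousOn S (univ ×ˢ Ioo a T)) (hk : ContinuousOn k (univ ×ˢ Ioo a T))
    (hf0 : ∀ p ∈ univ ×ˢ Ioo a T, 0 ≤ f p) (hS0 : ∀ p ∈ univ ×ˢ Ioo a T, 0 ≤ S p)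
    (hfK : ∀ p : Eu n × ℝ, p.1 ∉ Metric.closedBall X R → f p = 0)
    (hgK : ∀ i, ∀ p : Eu n × ℝ, p.1 ∉ Metric.closedBall X R → g i p = 0)
    (hSK : ∀ p : Eu n × ℝ, p.1 ∉ Metric.closedBall X R → S p = 0)
    (hkK : ∀ p : Eu n × ℝ, p.1 ∉ Metric.closedBall X R → k p = 0)
    (hle : ∀ p ∈ univ ×ˢ Ioo a T, dirD (stDir none) f p + S p
      ≤ ∑ i, dirD (stDir (some i)) (g i) p + k p) :
    (∫⁻ x, ENNReal.ofReal (f (x, t₁))) + ∫⁻ p in univ ×ˢ Ioc t₀ t₁, ENNReal.ofReal (S p)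
      ≤ (∫⁻ x, ENNReal.ofReal (f (x, t₀)))
        + ∫⁻ p in univ ×ˢ Ioc t₀ t₁, ENNReal.ofReal (k p) := by
  have h := integral_le_of_dirD_le h01 h0 h1 hf hg hS hk hfK hgK hSK hkK hle
  have hfc : ContinuousOn f (univ ×ˢ Ioo a T) :=
    fun p hp => (hf p hp).continuousAt.continuousWithinAt
  have m0 : t₀ ∈ Ioo a T := mem_slab (left_mem_Icc.2 h01) h0 h1
  have m1 : t₁ ∈ Ioo a T := mem_slab (right_mem_Icc.2 h01) h0 h1
  have hmS : 0 ≤ᵐ[volume.restrict (univ ×ˢ Ioc t₀ t₁)] S := by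
    filter_upwards [ae_restrict_mem (MeasurableSet.univ.prod measurableSet_Ioc)] with p hp
    exact hS0 p ⟨mem_univ _, mem_slab (Ioc_subset_Icc_self hp.2) h0 h1⟩
  rw [← ofReal_integral_eq_lintegral_ofReal (integrable_slice hfc m1 hfK)
    (Filter.Eventually.of_forall fun x => hf0 _ ⟨mem_univ _, m1⟩),
    ← ofReal_integral_eq_lintegral_ofReal (integrable_slice hfc m0 hfK)
    (Filter.Eventually.of_forall fun x => hf0 _ ⟨mem_univ _, m0⟩),
    ← ofReal_integral_eq_lintegral_ofReal (integrable_slab hS h0 h1 hSK) hmS,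
    ← ENNReal.ofReal_add (integral_nonneg fun x => hf0 _ ⟨mem_univ _, m1⟩)
      (integral_nonneg_of_ae hmS)]
  refine (ENNReal.ofReal_le_ofReal h).trans (ENNReal.ofReal_add_le.trans ?_)
  gcongr
  exact ofReal_integral_le_lintegral (integrable_slab hk h0 h1 hkK)

end Integration
section Weight

variable {n : ℕ}

theorem dirD_comp {E : Type*} [NormedAddCommGroup E] [NormedSpace ℝ E] {F : ℝ → ℝ} {F' : ℝ}
    {f : E → ℝ} {p : E} (v : E) (hF : HasDerivAt F F' (f p)) (hf : DifferentiableAt ℝ f p) :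
    dirD v (fun q => F (f q)) p = F' * dirD v f p := by
  have h2 := hF.comp_hasFDerivAt p hf.hasFDerivAt
  refine (congrArg (fun L => L v) h2.fderiv).trans ?_
  simp [dirD]

theorem contDiff_normSq (X : Eu n) : ContDiff ℝ ∞ (fun p : Eu n × ℝ => ‖p.1 - X‖ ^ 2) :=
  (contDiff_fst.sub contDiff_const).norm_sq ℝ

theorem dirD_normSq (X : Eu n) (v p : Eu n × ℝ) :
    dirD v (fun p : Eu n × ℝ => ‖p.1 - X‖ ^ 2) p = 2 * inner ℝ (p.1 - X) v.1 := by
  have h : HasFDerivAt (fun p : Eu n × ℝ => p.1 - X) (ContinuousLinearMap.fst ℝ (Eu n) ℝ) p :=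
    hasFDerivAt_fst.sub_const X
  rw [dirD, h.norm_sq.fderiv]
  simp [inner_sub_left]

theorem dirD_snd (v p : Eu n × ℝ) : dirD v (fun p : Eu n × ℝ => p.2) p = v.2 := by
  rw [dirD, (hasFDerivAt_snd (𝕜 := ℝ) (p := p)).fderiv]
  rfl

theorem dirD_coord (k : Fin n) (v p : Eu n × ℝ) :
    dirD v (fun p : Eu n × ℝ => p.1 k) p = v.1 k := by
  have h : HasFDerivAt (fun p : Eu n × ℝ => p.1 k)
      ((EuclideanSpace.proj k).comp (ContinuousLinearMap.fst ℝ (Eu n) ℝ)) p :=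
    (EuclideanSpace.proj (𝕜 := ℝ) k).hasFDerivAt.comp p hasFDerivAt_fst
  rw [dirD, h.fderiv]
  rfl

/-- The coefficient `(x - X)^k / (2 (t - T))` of the self-similar vector field. -/
def selfSimCoeff (X : Eu n) (T : ℝ) (k : Fin n) (p : Eu n × ℝ) : ℝ :=
  (p.1 k - X k) / (2 * (p.2 - T))

theorem contDiffAt_coord (k : Fin n) (p : Eu n × ℝ) :
    ContDiffAt ℝ ∞ (fun p : Eu n × ℝ => p.1 k) p :=
  ((EuclideanSpace.proj (𝕜 := ℝ) k).contDiff.comp contDiff_fst).contDiffAt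

theorem contDiffAt_selfSimCoeff (X : Eu n) {T : ℝ} (k : Fin n) {p : Eu n × ℝ} (hp : p.2 < T) :
    ContDiffAt ℝ ∞ (selfSimCoeff X T k) p :=
  ((contDiffAt_coord k p).sub contDiffAt_const).div
    (contDiffAt_const.mul (contDiffAt_snd.sub contDiffAt_const))
    (mul_ne_zero two_ne_zero (sub_ne_zero.2 hp.ne))

theorem dirD_selfSimCoeff (X : Eu n) {T : ℝ} (i k : Fin n) {p : Eu n × ℝ} (hp : p.2 < T) :
    dirD (stDir (some i)) (selfSimCoeff X T k) p = if i = k then 1 / (2 * (p.2 - T)) else 0 := by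
  have hne : 2 * (p.2 - T) ≠ 0 := mul_ne_zero two_ne_zero (sub_ne_zero.2 hp.ne)
  have d1 : DifferentiableAt ℝ (fun p : Eu n × ℝ => p.1 k - X k) p :=
    ((contDiffAt_coord k p).differentiableAt (by simp)).sub_const _
  have d2 : DifferentiableAt ℝ (fun p : Eu n × ℝ => p.2) p := differentiableAt_snd
  have hF : HasDerivAt (fun t : ℝ => (2 * (t - T))⁻¹) (-(2 * 1) / (2 * (p.2 - T)) ^ 2) p.2 :=
    (((hasDerivAt_id p.2).sub_const T).const_mul 2).inv hne
  have h1 := dirD_comp (f := fun p : Eu n × ℝ => p.2) (stDir (some i)) hF d2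
  have d3 : DifferentiableAt ℝ (fun p : Eu n × ℝ => (2 * (p.2 - T))⁻¹) p :=
    hF.differentiableAt.comp p d2
  have h2 : dirD (stDir (some i)) (fun p : Eu n × ℝ => p.1 k - X k) p = if i = k then 1 else 0 := by
    rw [dirD_sub _ ((contDiffAt_coord k p).differentiableAt (by simp)) (differentiableAt_const _),
      dirD_coord]
    simp [dirD, stDir, eq_comm]
  have h3 : selfSimCoeff X T k = fun p : Eu n × ℝ => (p.1 k - X k) * (2 * (p.2 - T))⁻¹ := by
    funext p; rw [selfSimCoeff, div_eq_mul_inv]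
  rw [h3, dirD_mul _ d1 d3, h1, h2, dirD_snd]
  simp [stDir]

theorem sum_selfSimCoeff_sq (X : Eu n) (T : ℝ) (p : Eu n × ℝ) :
    ∑ k, selfSimCoeff X T k p ^ 2 = ‖p.1 - X‖ ^ 2 / (4 * (p.2 - T) ^ 2) := by
  simp only [selfSimCoeff, div_pow, ← Finset.sum_div]
  rw [EuclideanSpace.real_norm_sq_eq]
  simp only [PiLp.sub_apply]
  ring

theorem contDiffAt_heatKer (X : Eu n) {T : ℝ} {p : Eu n × ℝ} (hp : p.2 < T) :
    ContDiffAt ℝ ∞ (fun p : Eu n × ℝ => heatKer X T p.1 p.2) p := by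
  have hb : (4 * Real.pi * (T - p.2)) ≠ 0 :=
    mul_ne_zero (by positivity) (sub_ne_zero.2 hp.ne')
  have hpos : 0 < 4 * Real.pi * (T - p.2) := mul_pos (by positivity) (sub_pos.2 hp)
  refine ContDiffAt.mul (contDiffAt_const.div ?_ (Real.rpow_pos_of_pos hpos _).ne') ?_
  · exact (contDiffAt_const.mul (contDiffAt_const.sub contDiffAt_snd)).rpow_const_of_ne hb
  · exact Real.contDiff_exp.contDiffAt.comp p ((contDiff_normSq X).contDiffAt.div
      (contDiffAt_const.mul (contDiffAt_snd.sub contDiffAt_const))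
      (mul_ne_zero (by norm_num) (sub_ne_zero.2 hp.ne)))

theorem dirD_heatKer (X : Eu n) {T : ℝ} {p : Eu n × ℝ} (hp : p.2 < T) (v : Eu n × ℝ) :
    dirD v (fun p : Eu n × ℝ => heatKer X T p.1 p.2) p
      = heatKer X T p.1 p.2 * (inner ℝ (p.1 - X) v.1 / (2 * (p.2 - T))
        + v.2 * (-((n : ℝ) - 4) * (1 / (2 * (p.2 - T)))
          - ‖p.1 - X‖ ^ 2 / (4 * (p.2 - T) ^ 2))) := by
  have hpos : 0 < 4 * Real.pi * (T - p.2) := mul_pos (by positivity) (sub_pos.2 hp)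
  have hne : p.2 - T ≠ 0 := sub_ne_zero.2 hp.ne
  have d2 : DifferentiableAt ℝ (fun p : Eu n × ℝ => p.2) p := differentiableAt_snd
  have dN : DifferentiableAt ℝ (fun p : Eu n × ℝ => ‖p.1 - X‖ ^ 2) p :=
    (contDiff_normSq X).contDiffAt.differentiableAt (by simp)
  set m : ℝ := ((n : ℝ) - 4) / 2 with hm
  have hF : HasDerivAt (fun t : ℝ => (4 * Real.pi * (T - t)) ^ (-m))
      ((4 * Real.pi * -1) * (-m) * (4 * Real.pi * (T - p.2)) ^ (-m - 1)) p.2 :=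
    (((hasDerivAt_id p.2).const_sub T).const_mul (4 * Real.pi)).rpow_const (Or.inl hpos.ne')
  have hF2 : HasDerivAt (fun t : ℝ => (4 * (t - T))⁻¹) (-(4 * 1) / (4 * (p.2 - T)) ^ 2) p.2 :=
    (((hasDerivAt_id p.2).sub_const T).const_mul 4).inv (mul_ne_zero (by norm_num) hne)
  have h1 := dirD_comp (f := fun p : Eu n × ℝ => p.2) v hF d2
  have h2 := dirD_comp (f := fun p : Eu n × ℝ => p.2) v hF2 d2
  have e1 : DifferentiableAt ℝ (fun p : Eu n × ℝ => (4 * Real.pi * (T - p.2)) ^ (-m)) p :=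
    hF.differentiableAt.comp p d2
  have e2 : DifferentiableAt ℝ (fun p : Eu n × ℝ => (4 * (p.2 - T))⁻¹) p :=
    hF2.differentiableAt.comp p d2
  have e3 : DifferentiableAt ℝ (fun p : Eu n × ℝ => ‖p.1 - X‖ ^ 2 * (4 * (p.2 - T))⁻¹) p :=
    dN.mul e2
  have h3 := dirD_comp v (Real.hasDerivAt_exp (‖p.1 - X‖ ^ 2 * (4 * (p.2 - T))⁻¹)) e3
  have e4 : DifferentiableAt ℝ
      (fun p : Eu n × ℝ => Real.exp (‖p.1 - X‖ ^ 2 * (4 * (p.2 - T))⁻¹)) p := e3.exp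
  have hev : (fun p : Eu n × ℝ => heatKer X T p.1 p.2) =ᶠ[nhds p]
      fun p => (4 * Real.pi * (T - p.2)) ^ (-m)
        * Real.exp (‖p.1 - X‖ ^ 2 * (4 * (p.2 - T))⁻¹) := by
    have : ∀ᶠ q : Eu n × ℝ in nhds p, q.2 < T := continuous_snd.continuousAt.eventually
      (gt_mem_nhds hp)
    filter_upwards [this] with q hq
    have : 0 ≤ 4 * Real.pi * (T - q.2) := mul_nonneg (by positivity) (sub_nonneg.2 hq.le)
    rw [heatKer, Real.rpow_neg this, one_div, div_eq_mul_inv (‖q.1 - X‖ ^ 2)]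
  have h0 : heatKer X T p.1 p.2 = (4 * Real.pi * (T - p.2)) ^ (-m)
      * Real.exp (‖p.1 - X‖ ^ 2 * (4 * (p.2 - T))⁻¹) := hev.self_of_nhds
  rw [dirD, hev.fderiv_eq, ← dirD, dirD_mul _ e1 e4, h1, h3, dirD_mul _ dN e2, h2, dirD_normSq,
    dirD_snd, h0, Real.rpow_sub_one hpos.ne']
  have hne' : T - p.2 ≠ 0 := sub_ne_zero.2 hp.ne'
  generalize (4 * Real.pi * (T - p.2)) ^ (-m) = c
  generalize Real.exp (‖p.1 - X‖ ^ 2 * (4 * (p.2 - T))⁻¹) = ex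
  have hT : T - p.2 = -(p.2 - T) := by ring
  rw [hT, hm]
  generalize p.2 - T = τ at hne
  have hpi := Real.pi_ne_zero
  field_simp
  ring

/-- The spatial cut-off function: it is `1` on the ball of radius `ρ` about `X` and vanishes off the
ball of radius `2 ρ`. -/
def cutoff (η : ℝ → ℝ) (ρ : ℝ) (X : Eu n) (p : Eu n × ℝ) : ℝ :=
  η ((4 * ρ ^ 2 - ‖p.1 - X‖ ^ 2) * (3 * ρ ^ 2)⁻¹)

/-- The spatial derivatives of the cut-off function. -/
def cutoffGrad (η : ℝ → ℝ) (ρ : ℝ) (X : Eu n) (i : Fin n) (p : Eu n × ℝ) : ℝ :=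
  deriv η ((4 * ρ ^ 2 - ‖p.1 - X‖ ^ 2) * (3 * ρ ^ 2)⁻¹) * (-2 * (p.1 i - X i) * (3 * ρ ^ 2)⁻¹)

variable {η : ℝ → ℝ} {ρ : ℝ} {X : Eu n}

theorem contDiff_cutoff (hη : ContDiff ℝ ∞ η) : ContDiff ℝ ∞ (cutoff η ρ X) :=
  hη.comp ((contDiff_const.sub (contDiff_normSq X)).mul contDiff_const)

theorem dirD_cutoff (hη : ContDiff ℝ ∞ η) (v p : Eu n × ℝ) :
    dirD v (cutoff η ρ X) p = deriv η ((4 * ρ ^ 2 - ‖p.1 - X‖ ^ 2) * (3 * ρ ^ 2)⁻¹)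
      * (-2 * inner ℝ (p.1 - X) v.1 * (3 * ρ ^ 2)⁻¹) := by
  have dN : DifferentiableAt ℝ (fun p : Eu n × ℝ => ‖p.1 - X‖ ^ 2) p :=
    (contDiff_normSq X).contDiffAt.differentiableAt (by simp)
  have d1 : DifferentiableAt ℝ (fun p : Eu n × ℝ => 4 * ρ ^ 2 - ‖p.1 - X‖ ^ 2) p :=
    dN.const_sub _
  have d2 : DifferentiableAt ℝ
      (fun p : Eu n × ℝ => (4 * ρ ^ 2 - ‖p.1 - X‖ ^ 2) * (3 * ρ ^ 2)⁻¹) p := d1.mul_const _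
  have hd := ((hη.differentiable (by simp))
    ((4 * ρ ^ 2 - ‖p.1 - X‖ ^ 2) * (3 * ρ ^ 2)⁻¹)).hasDerivAt
  refine (dirD_comp v hd d2).trans ?_
  rw [dirD_mul _ d1 (differentiableAt_const _), dirD_sub _ (differentiableAt_const _) dN,
    dirD_normSq]
  simp [dirD]

/-- The weight: the backward heat kernel, cut off in space. -/
def weight (η : ℝ → ℝ) (ρ : ℝ) (X : Eu n) (T : ℝ) (p : Eu n × ℝ) : ℝ :=
  heatKer X T p.1 p.2 * cutoff η ρ X p ^ 2

theorem contDiffAt_weight (hη : ContDiff ℝ ∞ η) {T : ℝ} {p : Eu n × ℝ} (hp : p.2 < T) :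
    ContDiffAt ℝ ∞ (weight η ρ X T) p :=
  (contDiffAt_heatKer X hp).mul ((contDiff_cutoff hη).contDiffAt.pow 2)

theorem dirD_weight (hη : ContDiff ℝ ∞ η) {T : ℝ} {p : Eu n × ℝ} (hp : p.2 < T) (v : Eu n × ℝ) :
    dirD v (weight η ρ X T) p = dirD v (fun p : Eu n × ℝ => heatKer X T p.1 p.2) p
        * cutoff η ρ X p ^ 2
      + heatKer X T p.1 p.2 * (2 * cutoff η ρ X p * dirD v (cutoff η ρ X) p) := by
  have d1 := (contDiffAt_heatKer X hp).differentiableAt (n := ∞) (by simp)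
  have d2 : DifferentiableAt ℝ (cutoff η ρ X) p :=
    (contDiff_cutoff hη).contDiffAt.differentiableAt (by simp)
  have d3 : DifferentiableAt ℝ (fun p => cutoff η ρ X p ^ 2) p := d2.pow 2
  refine (dirD_mul v d1 d3).trans ?_
  rw [dirD_comp v (hasDerivAt_pow 2 (cutoff η ρ X p)) d2]
  simp

theorem dirD_weight_space (hη : ContDiff ℝ ∞ η) {T : ℝ} {p : Eu n × ℝ} (hp : p.2 < T)
    (i : Fin n) : dirD (stDir (some i)) (weight η ρ X T) p
      = selfSimCoeff X T i p * weight η ρ X T p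
        + heatKer X T p.1 p.2 * (2 * cutoff η ρ X p * cutoffGrad η ρ X i p) := by
  have hi : inner ℝ (p.1 - X) (stDir (some i)).1 = p.1 i - X i := by
    simp [stDir, EuclideanSpace.inner_single_right]
  rw [dirD_weight hη hp, dirD_heatKer X hp, dirD_cutoff hη, hi, selfSimCoeff, weight, cutoffGrad]
  simp only [stDir]
  ring

theorem dirD_weight_time (hη : ContDiff ℝ ∞ η) {T : ℝ} {p : Eu n × ℝ} (hp : p.2 < T) :
    dirD (stDir none) (weight η ρ X T) p = weight η ρ X T p
      * (-((n : ℝ) - 4) * (1 / (2 * (p.2 - T))) - ∑ i, selfSimCoeff X T i p ^ 2) := by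
  rw [dirD_weight hη hp, dirD_heatKer X hp, dirD_cutoff hη, sum_selfSimCoeff_sq, weight]
  simp only [stDir, inner_zero_right]
  ring

end Weight
section Bounds

open Real

theorem rpow_mul_exp_neg_le {q z : ℝ} (hq : 0 < q) (hz : 0 ≤ z) : z ^ q * exp (-z) ≤ q ^ q := by
  have h1 : z ≤ q * exp (z / q) := by
    have h := add_one_le_exp (z / q)
    calc z = q * (z / q) := by field_simp
      _ ≤ q * exp (z / q) := mul_le_mul_of_nonneg_left (by linarith) hq.le
  have h2 := rpow_le_rpow hz h1 hq.le
  rw [mul_rpow hq.le (exp_pos _).le, ← exp_mul, div_mul_cancel₀ _ hq.ne'] at h2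
  calc z ^ q * exp (-z) ≤ q ^ q * exp z * exp (-z) :=
        mul_le_mul_of_nonneg_right h2 (exp_pos _).le
    _ = q ^ q := by rw [mul_assoc, ← exp_add]; simp

theorem exists_abs_deriv_le {η : ℝ → ℝ} (hη : ContDiff ℝ ∞ η) (hη0 : ∀ s, s < 1 / 2 → η s = 0)
    (hη1 : ∀ s, 1 ≤ s → η s = 1) : ∃ M, ∀ s, |deriv η s| ≤ M := by
  have hc : Continuous (deriv η) := hη.continuous_deriv (by simp)
  obtain ⟨M, hM⟩ := (isCompact_Icc (a := (1 / 2 : ℝ)) (b := 1)).exists_bound_of_continuousOn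
    hc.continuousOn
  have hM0 : 0 ≤ M := (norm_nonneg _).trans (hM 1 (by norm_num))
  refine ⟨M, fun s => ?_⟩
  rcases lt_or_ge s (1 / 2) with h | h
  · have : η =ᶠ[nhds s] fun _ => 0 := by
      filter_upwards [gt_mem_nhds h] with y hy using hη0 y hy
    rw [this.deriv_eq]; simpa
  rcases le_or_gt s 1 with h' | h'
  · exact hM s ⟨h, h'⟩
  · have : η =ᶠ[nhds s] fun _ => 1 := by
      filter_upwards [lt_mem_nhds h'] with y hy using hη1 y hy.le
    rw [this.deriv_eq]; simpa

variable {n : ℕ} {η : ℝ → ℝ} {ρ : ℝ} {X : Eu n}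

theorem cutoff_eq_one (hη1 : ∀ s, 1 ≤ s → η s = 1) (hρ : 0 < ρ) {p : Eu n × ℝ}
    (hp : ‖p.1 - X‖ ≤ ρ) : cutoff η ρ X p = 1 := by
  refine hη1 _ ?_
  rw [← div_eq_mul_inv, le_div_iff₀ (by positivity)]
  nlinarith [norm_nonneg (p.1 - X)]

theorem cutoff_arg_lt (hρ : 0 < ρ) {y : ℝ} (h : 5 / 2 * ρ ^ 2 < y ^ 2) :
    (4 * ρ ^ 2 - y ^ 2) * (3 * ρ ^ 2)⁻¹ < 1 / 2 := by
  rw [← div_eq_mul_inv, div_lt_iff₀ (by positivity)]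
  linarith

theorem cutoff_eq_zero (hη0 : ∀ s, s < 1 / 2 → η s = 0) (hρ : 0 < ρ) {p : Eu n × ℝ}
    (hp : 5 / 2 * ρ ^ 2 < ‖p.1 - X‖ ^ 2) : cutoff η ρ X p = 0 :=
  hη0 _ (cutoff_arg_lt hρ hp)

theorem cutoffGrad_eq_zero (hη0 : ∀ s, s < 1 / 2 → η s = 0) (hρ : 0 < ρ) {p : Eu n × ℝ}
    (hp : 5 / 2 * ρ ^ 2 < ‖p.1 - X‖ ^ 2) (i : Fin n) : cutoffGrad η ρ X i p = 0 := by
  have : η =ᶠ[nhds ((4 * ρ ^ 2 - ‖p.1 - X‖ ^ 2) * (3 * ρ ^ 2)⁻¹)] fun _ => 0 := by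
    filter_upwards [gt_mem_nhds (cutoff_arg_lt hρ hp)] with y hy using hη0 y hy
  rw [cutoffGrad, this.deriv_eq]; simp

theorem cutoffGrad_eq_zero_of_lt (hη1 : ∀ s, 1 ≤ s → η s = 1) (hρ : 0 < ρ) {p : Eu n × ℝ}
    (hp : ‖p.1 - X‖ < ρ) (i : Fin n) : cutoffGrad η ρ X i p = 0 := by
  have h1 : 1 < (4 * ρ ^ 2 - ‖p.1 - X‖ ^ 2) * (3 * ρ ^ 2)⁻¹ := by
    rw [← div_eq_mul_inv, lt_div_iff₀ (by positivity)]
    nlinarith [norm_nonneg (p.1 - X)]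
  have : η =ᶠ[nhds ((4 * ρ ^ 2 - ‖p.1 - X‖ ^ 2) * (3 * ρ ^ 2)⁻¹)] fun _ => 1 := by
    filter_upwards [lt_mem_nhds h1] with y hy using hη1 y hy.le
  rw [cutoffGrad, this.deriv_eq]; simp

theorem five_halves_lt_of_notMem_ball (hρ : 0 < ρ) {x : Eu n} (hx : x ∉ Metric.ball X (2 * ρ)) :
    5 / 2 * ρ ^ 2 < ‖x - X‖ ^ 2 := by
  rw [Metric.mem_ball, dist_eq_norm, not_lt] at hx
  nlinarith

theorem heatKer_nonneg {T : ℝ} {x : Eu n} {t : ℝ} (h : t < T) : 0 ≤ heatKer X T x t := by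
  have : 0 ≤ 4 * π * (T - t) := mul_nonneg (by positivity) (sub_nonneg.2 h.le)
  exact mul_nonneg (one_div_nonneg.2 (rpow_nonneg this _)) (exp_pos _).le

theorem heatKer_le_of_le_norm {T : ℝ} {x : Eu n} {t : ℝ} (hn : 4 < n) (ht : t < T) (hρ : 0 < ρ)
    (hx : ρ ≤ ‖x - X‖) :
    heatKer X T x t ≤ ((n - 4) / 2 : ℝ) ^ ((n - 4) / 2 : ℝ) / (π * ρ ^ 2) ^ ((n - 4) / 2 : ℝ) ∧
    heatKer X T x t / (T - t)
      ≤ 4 / ρ ^ 2 * (((n - 4) / 2 + 1 : ℝ) ^ ((n - 4) / 2 + 1 : ℝ)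
        / (π * ρ ^ 2) ^ ((n - 4) / 2 : ℝ)) := by
  have hn' : (4 : ℝ) < n := by exact_mod_cast hn
  have hσ : 0 < T - t := sub_pos.2 ht
  set m : ℝ := ((n : ℝ) - 4) / 2 with hm
  have hm0 : 0 < m := by rw [hm]; linarith
  set z := ρ ^ 2 / (4 * (T - t)) with hz
  have hz0 : 0 < z := by positivity
  have hP : 0 < (π * ρ ^ 2) ^ m := rpow_pos_of_pos (by positivity) _
  have h1 : heatKer X T x t ≤ z ^ m * exp (-z) / (π * ρ ^ 2) ^ m := by
    have e1 : 4 * π * (T - t) = π * ρ ^ 2 / z := by rw [hz]; field_simp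
    have e2 : ‖x - X‖ ^ 2 / (4 * (t - T)) ≤ -z := by
      rw [hz, ← div_neg, show -(4 * (T - t)) = 4 * (t - T) by ring]
      exact div_le_div_of_nonpos_of_le (by linarith) (pow_le_pow_left₀ hρ.le hx 2)
    rw [heatKer, ← hm, e1, div_rpow (by positivity) hz0.le, one_div_div, div_mul_eq_mul_div]
    gcongr
  constructor
  · refine h1.trans ?_
    gcongr
    exact rpow_mul_exp_neg_le hm0 hz0.le
  · have h2 : 1 / (T - t) = 4 / ρ ^ 2 * z := by rw [hz]; field_simp
    rw [div_eq_mul_one_div, h2]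
    calc heatKer X T x t * (4 / ρ ^ 2 * z)
        ≤ z ^ m * exp (-z) / (π * ρ ^ 2) ^ m * (4 / ρ ^ 2 * z) := by gcongr
      _ = 4 / ρ ^ 2 * (z ^ (m + 1) * exp (-z) / (π * ρ ^ 2) ^ m) := by
        rw [rpow_add_one hz0.ne']; ring
      _ ≤ _ := by
        gcongr
        exact rpow_mul_exp_neg_le (by linarith) hz0.le

theorem sum_coord_sq (x X : Eu n) : ∑ i, (x i - X i) ^ 2 = ‖x - X‖ ^ 2 := by
  rw [EuclideanSpace.real_norm_sq_eq]; rfl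

theorem sum_cutoffGrad_sq_le {M : ℝ} (hM : ∀ s, |deriv η s| ≤ M)
    (hρ : 0 < ρ) {p : Eu n × ℝ} (hp : ‖p.1 - X‖ ^ 2 ≤ 5 / 2 * ρ ^ 2) :
    ∑ i, cutoffGrad η ρ X i p ^ 2 ≤ 2 * M ^ 2 / ρ ^ 2 := by
  have h1 : ∀ i, cutoffGrad η ρ X i p ^ 2
      = deriv η ((4 * ρ ^ 2 - ‖p.1 - X‖ ^ 2) * (3 * ρ ^ 2)⁻¹) ^ 2 * (4 * (3 * ρ ^ 2)⁻¹ ^ 2)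
        * (p.1 i - X i) ^ 2 := fun i => by rw [cutoffGrad]; ring
  rw [Finset.sum_congr rfl fun i _ => h1 i, ← Finset.mul_sum, sum_coord_sq]
  have h2 := sq_le_sq' (neg_le_of_abs_le (hM ((4 * ρ ^ 2 - ‖p.1 - X‖ ^ 2) * (3 * ρ ^ 2)⁻¹)))
    (le_of_abs_le (hM _))
  calc _ ≤ M ^ 2 * (4 * (3 * ρ ^ 2)⁻¹ ^ 2) * (5 / 2 * ρ ^ 2) := by gcongr
    _ = 10 / 9 * (M ^ 2 / ρ ^ 2) := by field_simp; ring
    _ ≤ 2 * (M ^ 2 / ρ ^ 2) := by gcongr; norm_num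
    _ = _ := by ring

theorem sum_cutoffGrad_mul_selfSimCoeff_le {M : ℝ} (hM : ∀ s, |deriv η s| ≤ M)
    (hρ : 0 < ρ) {T : ℝ} {p : Eu n × ℝ} (hp : ‖p.1 - X‖ ^ 2 ≤ 5 / 2 * ρ ^ 2) (hT : p.2 < T) :
    ∑ i, cutoffGrad η ρ X i p * selfSimCoeff X T i p ≤ M / (T - p.2) := by
  have hσ : 0 < T - p.2 := sub_pos.2 hT
  have hM0 : 0 ≤ M := (abs_nonneg _).trans (hM 0)
  have h1 : ∀ i, cutoffGrad η ρ X i p * selfSimCoeff X T i p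
      = deriv η ((4 * ρ ^ 2 - ‖p.1 - X‖ ^ 2) * (3 * ρ ^ 2)⁻¹) * ((3 * ρ ^ 2)⁻¹ / (T - p.2))
        * (p.1 i - X i) ^ 2 := fun i => by
    rw [cutoffGrad, selfSimCoeff, show 2 * (p.2 - T) = -2 * (T - p.2) by ring]
    field_simp
  rw [Finset.sum_congr rfl fun i _ => h1 i, ← Finset.mul_sum, sum_coord_sq]
  have h2 := le_of_abs_le (hM ((4 * ρ ^ 2 - ‖p.1 - X‖ ^ 2) * (3 * ρ ^ 2)⁻¹))
  calc _ ≤ M * ((3 * ρ ^ 2)⁻¹ / (T - p.2)) * ‖p.1 - X‖ ^ 2 := by gcongr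
    _ ≤ M * ((3 * ρ ^ 2)⁻¹ / (T - p.2)) * (5 / 2 * ρ ^ 2) := by gcongr
    _ = 5 / 6 * (M / (T - p.2)) := by field_simp; ring
    _ ≤ _ := by
      have : 0 ≤ M / (T - p.2) := by positivity
      linarith

theorem cBall_sq (hn : 4 < n) : cBall n ^ 2 = ((n : ℝ) - 4) / (2 * π * exp 1) := by
  have hn' : (4 : ℝ) < n := by exact_mod_cast hn
  exact sq_sqrt (div_nonneg (by linarith) (by positivity))

theorem cBall_pos (hn : 4 < n) : 0 < cBall n := by
  have hn' : (4 : ℝ) < n := by exact_mod_cast hn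
  exact sqrt_pos.2 (div_pos (by linarith) (by positivity))

theorem sq_rpow_half (hn : 4 < n) {r : ℝ} (hr : 0 < r) :
    (r ^ 2) ^ (((n : ℝ) - 4) / 2) = r ^ (n - 4) := by
  rw [← rpow_natCast r 2, ← rpow_mul hr.le, ← rpow_natCast r (n - 4), Nat.cast_sub hn.le]
  congr 1
  push_cast
  ring

theorem exists_cutoff_error_le (hn : 4 < n) (hη : ContDiff ℝ ∞ η)
    (hη01 : ∀ s, η s ∈ Set.Icc (0 : ℝ) 1) (hη0 : ∀ s, s < 1 / 2 → η s = 0)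
    (hη1 : ∀ s, 1 ≤ s → η s = 1) :
    ∃ c : ℝ, 0 < c ∧ ∀ (r : ℝ) (X : Eu n) (T : ℝ) (p : Eu n × ℝ), 0 < r → p.2 < T →
      heatKer X T p.1 p.2 * (8 * ∑ i, cutoffGrad η (cBall n * r) X i p ^ 2
        + 2 * cutoff η (cBall n * r) X p
          * ∑ i, cutoffGrad η (cBall n * r) X i p * selfSimCoeff X T i p) ≤ c / r ^ (n - 2) := by
  obtain ⟨M, hM⟩ := exists_abs_deriv_le hη hη0 hη1
  have hM0 : 0 ≤ M := (abs_nonneg _).trans (hM 0)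
  have hn' : (4 : ℝ) < n := by exact_mod_cast hn
  have hc := cBall_pos hn
  set m : ℝ := ((n : ℝ) - 4) / 2 with hm
  have hm0 : 0 < m := by rw [hm]; linarith
  have hP : 0 < (π * cBall n ^ 2) ^ m := rpow_pos_of_pos (by positivity) _
  have hC0 : 0 ≤ (16 * M ^ 2 * m ^ m + 8 * M * (m + 1) ^ (m + 1))
    / (cBall n ^ 2 * (π * cBall n ^ 2) ^ m) := by positivity
  refine ⟨(16 * M ^ 2 * m ^ m + 8 * M * (m + 1) ^ (m + 1))
    / (cBall n ^ 2 * (π * cBall n ^ 2) ^ m) + 1, by positivity, ?_⟩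
  intro r X T p hr hT
  have hρ : 0 < cBall n * r := mul_pos hc hr
  set ρ := cBall n * r with hρdef
  have hσ : 0 < T - p.2 := sub_pos.2 hT
  have hfin : (0 : ℝ) ≤ ((16 * M ^ 2 * m ^ m + 8 * M * (m + 1) ^ (m + 1))
    / (cBall n ^ 2 * (π * cBall n ^ 2) ^ m) + 1) / r ^ (n - 2) := by positivity
  rcases lt_or_ge (5 / 2 * ρ ^ 2) (‖p.1 - X‖ ^ 2) with h | h
  · simpa [cutoffGrad_eq_zero hη0 hρ h] using hfin
  rcases lt_or_ge ‖p.1 - X‖ ρ with h' | h'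
  · simpa [cutoffGrad_eq_zero_of_lt hη1 hρ h'] using hfin
  have hz0 : 0 ≤ cutoff η ρ X p := (hη01 _).1
  have hz1 : cutoff η ρ X p ≤ 1 := (hη01 _).2
  have hK := heatKer_nonneg (X := X) (x := p.1) hT
  have b1 := sum_cutoffGrad_sq_le (X := X) hM hρ h
  have b2 := sum_cutoffGrad_mul_selfSimCoeff_le (X := X) hM hρ h hT
  obtain ⟨k1, k2⟩ := heatKer_le_of_le_norm (X := X) hn hT hρ h'
  have b3 : cutoff η ρ X p * ∑ i, cutoffGrad η ρ X i p * selfSimCoeff X T i p ≤ M / (T - p.2) :=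
    (mul_le_mul_of_nonneg_left b2 hz0).trans (mul_le_of_le_one_left (by positivity) hz1)
  have hr2 : (π * ρ ^ 2) ^ m = (π * cBall n ^ 2) ^ m * r ^ (n - 4) := by
    rw [hρdef, mul_pow, ← mul_assoc, mul_rpow (by positivity) (by positivity), hm,
      sq_rpow_half hn hr]
  have hr3 : r ^ (n - 2) = r ^ (n - 4) * r ^ 2 := by rw [← pow_add]; congr 1; omega
  calc _ ≤ heatKer X T p.1 p.2 * (8 * (2 * M ^ 2 / ρ ^ 2) + 2 * (M / (T - p.2))) := by
        rw [mul_assoc 2]; gcongr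
    _ = 16 * M ^ 2 / ρ ^ 2 * heatKer X T p.1 p.2
        + 2 * M * (heatKer X T p.1 p.2 / (T - p.2)) := by ring
    _ ≤ 16 * M ^ 2 / ρ ^ 2 * (m ^ m / (π * ρ ^ 2) ^ m)
        + 2 * M * (4 / ρ ^ 2 * ((m + 1) ^ (m + 1) / (π * ρ ^ 2) ^ m)) := by gcongr
    _ = (16 * M ^ 2 * m ^ m + 8 * M * (m + 1) ^ (m + 1))
        / (cBall n ^ 2 * (π * cBall n ^ 2) ^ m) / r ^ (n - 2) := by
      rw [hr2, hr3, hρdef]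
      field_simp
      ring
    _ ≤ _ := by gcongr; linarith

end Bounds
section SpaceTime

open Set

variable {n d : ℕ}

theorem pd_eq_dirD {F : Type*} [NormedAddCommGroup F] [NormedSpace ℝ F] {f : Eu n × ℝ → F}
    {p : Eu n × ℝ} (hf : DifferentiableAt ℝ f p) (i : Fin n) :
    pd i (fun x => f (x, p.2)) p.1 = dirD (stDir (some i)) f p := by
  have h : HasFDerivAt (fun x : Eu n => f (x, p.2)) _ p.1 :=
    HasFDerivAt.comp (f := fun x : Eu n => (x, p.2)) p.1 (hf.hasFDerivAt)
      ((hasFDerivAt_id p.1).prodMk (hasFDerivAt_const p.2 p.1))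
  rw [pd, h.fderiv]
  rfl

theorem deriv_eq_dirD {F : Type*} [NormedAddCommGroup F] [NormedSpace ℝ F] {f : Eu n × ℝ → F}
    {p : Eu n × ℝ} (hf : DifferentiableAt ℝ f p) :
    deriv (fun s => f (p.1, s)) p.2 = dirD (stDir none) f p := by
  have h : HasDerivAt (fun s : ℝ => f (p.1, s)) _ p.2 :=
    HasFDerivAt.comp_hasDerivAt (f := fun s : ℝ => (p.1, s)) p.2 (hf.hasFDerivAt)
      ((hasDerivAt_const p.2 p.1).prodMk (hasDerivAt_id p.2))
  rw [h.deriv]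
  rfl

/-- The time-dependent connection `A` as a connection on space-time in temporal gauge. -/
def stConn (A : ℝ → Fin n → Eu n → Eu d) : Option (Fin n) → Eu n × ℝ → Eu d
  | none => fun _ => 0
  | some j => fun p => A p.2 j p.1

variable {G : Type*} [Group G] [TopologicalSpace G] [ChartedSpace (Eu d) G]
  [LieGroup (𝓡 d) ∞ G] {V : Type*} [NormedAddCommGroup V] [InnerProductSpace ℝ V]

/-- The time-dependent scalar field `u` as a scalar field on space-time. -/
def stScalar (u : ℝ → Eu n → V) (p : Eu n × ℝ) : V := u p.2 p.1

/-- The infinitesimal action as a continuous bilinear map. -/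
def actForm (ρ : G →* (V →L[ℝ] V)) : Eu d →L[ℝ] V →L[ℝ] V :=
  show Eu d →L[ℝ] V →L[ℝ] V from dRep ρ

theorem isGaugeAlgebra_lie [CompactSpace G] [LieAlgebra.IsSemisimple ℝ (GroupLieAlgebra (𝓡 d) G)]
    {ρ : G →* (V →L[ℝ] V)} (hρ : ContMDiff (𝓡 d) 𝓘(ℝ, V →L[ℝ] V) ∞ ρ)
    (hinv : ∀ (g : G) (v w : V), inner ℝ (ρ g v) (ρ g w) = inner ℝ v w) :
    IsGaugeAlgebra (lieForm (d := d) G) (actForm ρ) (gForm G) where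
  skew := lieBracket_skew G
  jacobi := lieBracket_jacobi G
  rep := dRep_lie hρ
  form_comm := gInner_comm G
  form_nonneg x := by
    rcases eq_or_ne x 0 with rfl | h
    · simp
    · exact (gInner_pos G x h).le
  form_inv := gInner_lie G
  inner_skew := act_skew hρ hinv

variable {ρ : G →* (V →L[ℝ] V)} {W : ℝ → ℝ} {a T : ℝ} {A : ℝ → Fin n → Eu n → Eu d}
  {u : ℝ → Eu n → V} {p : Eu n × ℝ}

theorem IsFlow.contDiffAt_conn (h : IsFlow ρ W a T A u) (hp : p.2 ∈ Ioo a T)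
    (i : Option (Fin n)) : ContDiffAt ℝ ∞ (stConn A i) p := by
  cases i with
  | none => exact contDiffAt_const
  | some j => exact (h.smooth_A j).contDiffAt (prod_mem_nhds Filter.univ_mem (Ico_mem_nhds hp.1 hp.2))

theorem IsFlow.contDiffAt_scalar (h : IsFlow ρ W a T A u) (hp : p.2 ∈ Ioo a T) :
    ContDiffAt ℝ ∞ (stScalar u) p :=
  h.smooth_u.contDiffAt (prod_mem_nhds Filter.univ_mem (Ico_mem_nhds hp.1 hp.2))

theorem IsFlow.curv_eq (h : IsFlow ρ W a T A u) (hp : p.2 ∈ Ioo a T) (i j : Fin n) :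
    curv G (A p.2) i j p.1 = gaugeCurv (lieForm G) stDir (stConn A) (some i) (some j) p := by
  rw [curv, gaugeCurv, ← pd_eq_dirD ((h.contDiffAt_conn hp _).differentiableAt (by simp)),
    ← pd_eq_dirD ((h.contDiffAt_conn hp _).differentiableAt (by simp))]
  rfl

theorem IsFlow.snabla_eq (h : IsFlow ρ W a T A u) (hp : p.2 ∈ Ioo a T) (i : Fin n) :
    snabla ρ (A p.2) i (u p.2) p.1
      = gaugeD (actForm ρ) stDir (stConn A) (some i) (stScalar u) p := by
  rw [snabla, gaugeD, ← pd_eq_dirD ((h.contDiffAt_scalar hp).differentiableAt (by simp))]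
  rfl

theorem IsFlow.nabla_curv_eq (h : IsFlow ρ W a T A u) (hp : p.2 ∈ Ioo a T) (i j k : Fin n) :
    nabla G (A p.2) i (curv G (A p.2) j k) p.1
      = gaugeNabla (lieForm G) stDir (stConn A) (some i)
        (gaugeCurv (lieForm G) stDir (stConn A) (some j) (some k)) p := by
  have e : curv G (A p.2) j k
      = fun x => gaugeCurv (lieForm G) stDir (stConn A) (some j) (some k) (x, p.2) :=
    funext fun x => h.curv_eq (p := (x, p.2)) hp j k
  rw [nabla, gaugeNabla, e, ← pd_eq_dirD
    ((contDiffAt_gaugeCurv (h.contDiffAt_conn hp) _ _).differentiableAt (by simp))]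
  rfl

theorem IsFlow.snabla_snabla_eq (h : IsFlow ρ W a T A u) (hp : p.2 ∈ Ioo a T) (i j : Fin n) :
    snabla ρ (A p.2) i (snabla ρ (A p.2) j (u p.2)) p.1
      = gaugeD (actForm ρ) stDir (stConn A) (some i)
        (gaugeD (actForm ρ) stDir (stConn A) (some j) (stScalar u)) p := by
  have e : snabla ρ (A p.2) j (u p.2)
      = fun x => gaugeD (actForm ρ) stDir (stConn A) (some j) (stScalar u) (x, p.2) :=
    funext fun x => h.snabla_eq (p := (x, p.2)) hp j
  rw [snabla, gaugeD, e, ← pd_eq_dirD ((contDiffAt_gaugeD (h.contDiffAt_conn hp)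
    (h.contDiffAt_scalar hp) _).differentiableAt (by simp))]
  rfl

theorem IsFlow.deriv_conn_eq (h : IsFlow ρ W a T A u) (hp : p.2 ∈ Ioo a T) (j : Fin n) :
    deriv (fun s => A s j p.1) p.2
      = gaugeCurv (lieForm G) stDir (stConn A) none (some j) p := by
  have e := deriv_eq_dirD ((h.contDiffAt_conn hp (some j)).differentiableAt (by simp))
  have e0 : dirD (stDir (some j)) (stConn A none) p = 0 := by
    simp [dirD, stConn]
  rw [gaugeCurv, ← e, e0]
  simp [stConn]

theorem IsFlow.deriv_scalar_eq (h : IsFlow ρ W a T A u) (hp : p.2 ∈ Ioo a T) :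
    deriv (fun s => u s p.1) p.2
      = gaugeD (actForm ρ) stDir (stConn A) none (stScalar u) p := by
  have e := deriv_eq_dirD ((h.contDiffAt_scalar hp).differentiableAt (by simp))
  rw [gaugeD, ← e]
  simp [stConn, stScalar]

theorem sum_Ioi_of_symm {f : Fin n → Fin n → ℝ} (hs : ∀ i j, f i j = f j i) (h0 : ∀ i, f i i = 0) :
    ∑ i, ∑ j, f i j = 2 * ∑ i, ∑ j ∈ Finset.Ioi i, f i j := by
  have h1 : ∀ i, ∑ j, f i j = (∑ j ∈ Finset.Ioi i, f i j) + ∑ j ∈ Finset.Iio i, f i j := fun i => by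
    rw [← Finset.sum_filter_add_sum_filter_not Finset.univ (fun j => i < j) (f i)]
    congr 1
    · exact Finset.sum_congr (by ext; simp) fun _ _ => rfl
    · have : (Finset.univ.filter fun j => ¬ i < j) = insert i (Finset.Iio i) := by
        ext j; simp [le_iff_eq_or_lt]
      rw [this, Finset.sum_insert (by simp), h0, zero_add]
  have h2 : ∑ i, ∑ j ∈ Finset.Iio i, f i j = ∑ i, ∑ j ∈ Finset.Ioi i, f i j := by
    rw [Finset.sum_comm' (t' := Finset.univ) (s' := fun j => Finset.Ioi j) (by simp)]
    exact Finset.sum_congr rfl fun i _ => Finset.sum_congr rfl fun j _ => hs j i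
  rw [Finset.sum_congr rfl fun i _ => h1 i, Finset.sum_add_distrib, h2]
  ring

theorem IsFlow.energy_eq (h : IsFlow ρ W a T A u) (hp : p.2 ∈ Ioo a T) :
    energy ρ W (A p.2) (u p.2) p.1
      = gaugeEnergy (lieForm G) (actForm ρ) (gForm G) stDir (stConn A) (stScalar u) W p := by
  have hsk := gaugeCurv_skew (br := lieForm G) (e := stDir) (A := stConn A) (lieBracket_skew G)
  have h0 : ∀ i : Option (Fin n), gaugeCurv (lieForm G) stDir (stConn A) i i p = 0 :=
    fun i => by
      have h2 : (2 : ℝ) • gaugeCurv (lieForm G) stDir (stConn A) i i p = 0 := by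
        rw [two_smul]; nth_rw 1 [hsk i i p]; exact neg_add_cancel _
      exact (smul_eq_zero.1 h2).resolve_left two_ne_zero
  rw [energy, gaugeEnergy, sum_Ioi_of_symm (fun i j => by rw [hsk (some i) (some j)]; simp)
    (fun i => by rw [h0]; simp)]
  simp only [h.curv_eq hp, h.snabla_eq hp, ← real_inner_self_eq_norm_sq, gForm_apply, stScalar]
  ring

theorem IsFlow.selfSimSq_eq (h : IsFlow ρ W a T A u) (hp : p.2 ∈ Ioo a T) (X : Eu n) (S : ℝ) :
    selfSimSq ρ X S A u p.1 p.2 = spaceTimeQuad (fun v w => stress (lieForm G) (actForm ρ) (gForm G)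
      stDir (stConn A) (stScalar u) v w p) (fun v => v.elim 1 (selfSimCoeff X S · p)) := by
  rw [spaceTimeQuad_stress, selfSimSq]
  simp only [selfSimA, selfSimU, Fintype.sum_option, h.curv_eq hp, h.snabla_eq hp,
    h.deriv_conn_eq hp, h.deriv_scalar_eq hp, gForm_apply, Option.elim, one_smul, selfSimCoeff]

theorem IsFlow.stress_law [CompactSpace G] [LieAlgebra.IsSemisimple ℝ (GroupLieAlgebra (𝓡 d) G)]
    (h : IsFlow ρ W a T A u) (hρ : ContMDiff (𝓡 d) 𝓘(ℝ, V →L[ℝ] V) ∞ ρ)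
    (hinv : ∀ (g : G) (v w : V), inner ℝ (ρ g v) (ρ g w) = inner ℝ v w)
    (hW : ContDiff ℝ 1 W) (hp : p.2 ∈ Ioo a T) (v : Option (Fin n)) :
    ∑ i, dirD (stDir (some i)) (stress (lieForm G) (actForm ρ) (gForm G)
      stDir (stConn A) (stScalar u) (some i) v) p
      = dirD (stDir v) (gaugeEnergy (lieForm G) (actForm ρ) (gForm G) stDir (stConn A)
        (stScalar u) W) p
        + stress (lieForm G) (actForm ρ) (gForm G) stDir (stConn A) (stScalar u) none v p := by
  refine sum_dirD_stress (isGaugeAlgebra_lie hρ hinv) (h.contDiffAt_conn hp)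
    (h.contDiffAt_scalar hp) hW
    (fun j => odot ρ (u p.2 p.1) (snabla ρ (A p.2) j (u p.2) p.1)) ?_ ?_ ?_ v
  · intro j y
    rw [gForm_apply, odot_spec, h.snabla_eq hp]
    rfl
  · intro j
    rw [← h.deriv_conn_eq hp, h.eq_A p.2 hp]
    simp only [h.nabla_curv_eq hp]
  · rw [← h.deriv_scalar_eq hp, h.eq_u p.2 hp]
    simp only [h.snabla_snabla_eq hp, real_inner_self_eq_norm_sq, stScalar]

end SpaceTime
section Monotonicity

open Set MeasureTheory

variable {n d : ℕ} {G : Type*} [Group G] [TopologicalSpace G] [ChartedSpace (Eu d) G]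
  [LieGroup (𝓡 d) ∞ G] {V : Type*} [NormedAddCommGroup V] [InnerProductSpace ℝ V]
  {ρ : G →* (V →L[ℝ] V)} {W : ℝ → ℝ} {a T : ℝ} {A : ℝ → Fin n → Eu n → Eu d}
  {u : ℝ → Eu n → V}

theorem IsFlow.contDiffAt_energy (h : IsFlow ρ W a T A u) (hW : ContDiff ℝ 1 W) {p : Eu n × ℝ}
    (hp : p.2 ∈ Ioo a T) :
    ContDiffAt ℝ 1 (fun p : Eu n × ℝ => energy ρ W (A p.2) (u p.2) p.1) p := by
  refine (contDiffAt_gaugeEnergy (br := lieForm G) (ac := actForm ρ) (b := gForm G) (e := stDir)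
    (h.contDiffAt_conn hp) (h.contDiffAt_scalar hp) hW).congr_of_eventuallyEq ?_
  filter_upwards [prod_mem_nhds Filter.univ_mem (Ioo_mem_nhds hp.1 hp.2)] with q hq
  exact h.energy_eq hq.2

theorem IsFlow.continuousOn_energy (h : IsFlow ρ W a T A u) (hW : ContDiff ℝ 1 W) :
    ContinuousOn (fun p : Eu n × ℝ => energy ρ W (A p.2) (u p.2) p.1) (univ ×ˢ Ioo a T) :=
  fun _ hp => (h.contDiffAt_energy hW hp.2).continuousAt.continuousWithinAt

theorem IsFlow.lintegral_energy_eq (h : IsFlow ρ W a T A u) (hW : ContDiff ℝ 1 W) (X : Eu n)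
    (R : ℝ) {t₀ : ℝ} (h0 : a < t₀) :
    ∫⁻ p in Metric.ball X R ×ˢ Ioo t₀ T, ENNReal.ofReal (energy ρ W (A p.2) (u p.2) p.1)
      = ∫⁻ t in Ioo t₀ T, ballEnergy ρ W A u X R t := by
  have hm : AEMeasurable (fun p : Eu n × ℝ => ENNReal.ofReal (energy ρ W (A p.2) (u p.2) p.1))
      ((volume.restrict (Metric.ball X R)).prod (volume.restrict (Ioo t₀ T))) := by
    rw [Measure.prod_restrict, ← Measure.volume_eq_prod]
    exact (((h.continuousOn_energy hW).mono (prod_mono (subset_univ _)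
      (Ioo_subset_Ioo_left h0.le))).aemeasurable
        (measurableSet_ball.prod measurableSet_Ioo)).ennreal_ofReal
  rw [Measure.volume_eq_prod, ← Measure.prod_restrict, lintegral_prod_symm _ hm]
  rfl

variable [CompactSpace G] [LieAlgebra.IsSemisimple ℝ (GroupLieAlgebra (𝓡 d) G)]
  {η : ℝ → ℝ} {X : Eu n}

theorem IsFlow.energy_nonneg (h : IsFlow ρ W a T A u)
    (hρ : ContMDiff (𝓡 d) 𝓘(ℝ, V →L[ℝ] V) ∞ ρ)
    (hinv : ∀ (g : G) (v w : V), inner ℝ (ρ g v) (ρ g w) = inner ℝ v w)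
    (hW0 : ∀ s, 0 ≤ W s) {p : Eu n × ℝ} (hp : p.2 ∈ Ioo a T) :
    0 ≤ energy ρ W (A p.2) (u p.2) p.1 := by
  rw [h.energy_eq hp]
  exact gaugeEnergy_nonneg (isGaugeAlgebra_lie hρ hinv) hW0 p

theorem IsFlow.selfSimSq_nonneg (h : IsFlow ρ W a T A u)
    (hρ : ContMDiff (𝓡 d) 𝓘(ℝ, V →L[ℝ] V) ∞ ρ)
    (hinv : ∀ (g : G) (v w : V), inner ℝ (ρ g v) (ρ g w) = inner ℝ v w)
    {p : Eu n × ℝ} (hp : p.2 ∈ Ioo a T) (X : Eu n) (S : ℝ) :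
    0 ≤ selfSimSq ρ X S A u p.1 p.2 := by
  rw [h.selfSimSq_eq hp]
  exact spaceTimeQuad_stress_nonneg (isGaugeAlgebra_lie hρ hinv) _ p

theorem weight_eq_zero {T : ℝ} (hη0 : ∀ s, s < 1 / 2 → η s = 0) {R : ℝ} (hR : 0 < R)
    {p : Eu n × ℝ} (hp : p.1 ∉ Metric.ball X (2 * R)) : weight η R X T p = 0 := by
  rw [weight, cutoff_eq_zero hη0 hR (five_halves_lt_of_notMem_ball hR hp)]
  simp

/-- The localized monotonicity inequality, with the error term coming from the cut-off. -/
theorem IsFlow.weighted_energy_le (h : IsFlow ρ W a T A u)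
    (hρ : ContMDiff (𝓡 d) 𝓘(ℝ, V →L[ℝ] V) ∞ ρ)
    (hinv : ∀ (g : G) (v w : V), inner ℝ (ρ g v) (ρ g w) = inner ℝ v w)
    (hW : ContDiff ℝ 1 W) (hW0 : ∀ s, 0 ≤ W s) (hη : ContDiff ℝ ∞ η)
    (hη0 : ∀ s, s < 1 / 2 → η s = 0) {R S t₀ t₁ : ℝ} (hR : 0 < R) (hS : T ≤ S)
    (h01 : t₀ ≤ t₁) (h0 : a < t₀) (h1 : t₁ < T) :
    (∫⁻ x, ENNReal.ofReal (weight η R X S (x, t₁) * energy ρ W (A t₁) (u t₁) x))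
        + ∫⁻ p in univ ×ˢ Ioc t₀ t₁,
          ENNReal.ofReal (1 / 2 * (weight η R X S p * selfSimSq ρ X S A u p.1 p.2))
      ≤ (∫⁻ x, ENNReal.ofReal (weight η R X S (x, t₀) * energy ρ W (A t₀) (u t₀) x))
        + ∫⁻ p in univ ×ˢ Ioc t₀ t₁, ENNReal.ofReal (heatKer X S p.1 p.2
          * (8 * ∑ i, cutoffGrad η R X i p ^ 2
            + 2 * cutoff η R X p * ∑ i, cutoffGrad η R X i p * selfSimCoeff X S i p)
          * energy ρ W (A p.2) (u p.2) p.1) := by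
  have hg := isGaugeAlgebra_lie (G := G) hρ hinv
  have hlt : ∀ p ∈ (univ ×ˢ Ioo a T : Set (Eu n × ℝ)), p.2 < S := fun p hp => hp.2.2.trans_le hS
  have cw : ∀ p ∈ (univ ×ˢ Ioo a T : Set (Eu n × ℝ)), ContDiffAt ℝ ∞ (weight η R X S) p :=
    fun p hp => contDiffAt_weight hη (hlt p hp)
  have cs : ∀ i, ∀ p ∈ (univ ×ˢ Ioo a T : Set (Eu n × ℝ)), ContDiffAt ℝ ∞ (selfSimCoeff X S i) p :=
    fun i p hp => contDiffAt_selfSimCoeff X i (hlt p hp)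
  have cst : ∀ v w, ∀ p ∈ (univ ×ˢ Ioo a T : Set (Eu n × ℝ)), ContDiffAt ℝ ∞ (stress (lieForm G)
      (actForm ρ) (gForm G) stDir (stConn A) (stScalar u) v w) p :=
    fun v w p hp => contDiffAt_stress (h.contDiffAt_conn hp.2) (h.contDiffAt_scalar hp.2) v w
  have ce : ∀ p ∈ (univ ×ˢ Ioo a T : Set (Eu n × ℝ)), ContDiffAt ℝ 1 (gaugeEnergy (lieForm G)
      (actForm ρ) (gForm G) stDir (stConn A) (stScalar u) W) p :=
    fun p hp => contDiffAt_gaugeEnergy (h.contDiffAt_conn hp.2) (h.contDiffAt_scalar hp.2) hW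
  have hball : ∀ p : Eu n × ℝ, p.1 ∉ Metric.closedBall X (2 * R) → p.1 ∉ Metric.ball X (2 * R) :=
    fun p hp hp' => hp (Metric.ball_subset_closedBall hp')
  have hw0 : ∀ p : Eu n × ℝ, p.1 ∉ Metric.closedBall X (2 * R) → weight η R X S p = 0 :=
    fun p hp => weight_eq_zero hη0 hR (hball p hp)
  have key := lintegral_le_of_dirD_le (X := X) (R := 2 * R)
    (f := fun p => weight η R X S p * gaugeEnergy (lieForm G) (actForm ρ) (gForm G) stDir
      (stConn A) (stScalar u) W p)
    (S := fun p => 1 / 2 * (weight η R X S p * spaceTimeQuad (fun v w => stress (lieForm G)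
      (actForm ρ) (gForm G) stDir (stConn A) (stScalar u) v w p)
        (fun v => v.elim 1 (selfSimCoeff X S · p))))
    (g := energyFlux (lieForm G) (actForm ρ) (gForm G) stDir (stConn A) (stScalar u) W
      (weight η R X S) (selfSimCoeff X S))
    (k := fun p => heatKer X S p.1 p.2 * (8 * ∑ i, cutoffGrad η R X i p ^ 2
            + 2 * cutoff η R X p * ∑ i, cutoffGrad η R X i p * selfSimCoeff X S i p)
          * gaugeEnergy (lieForm G) (actForm ρ) (gForm G) stDir (stConn A) (stScalar u) W p)
    h01 h0 h1
    (fun p hp => ((cw p hp).of_le ENat.LEInfty.out).mul (ce p hp))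
    (fun i p hp => (((cw p hp).mul ((cst _ _ p hp).add (ContDiffAt.sum fun k _ =>
        (cs k p hp).mul (cst _ _ p hp)))).of_le ENat.LEInfty.out).sub
      ((((cw p hp).mul (cs i p hp)).of_le ENat.LEInfty.out).mul (ce p hp)))
    ?_ ?_ ?_ ?_ ?_ ?_ ?_ ?_ ?_
  · have m0 : t₀ ∈ Ioo a T := ⟨h0, h01.trans_lt h1⟩
    have m1 : t₁ ∈ Ioo a T := ⟨h0.trans_le h01, h1⟩
    have mI : ∀ p ∈ (univ ×ˢ Ioc t₀ t₁ : Set (Eu n × ℝ)), p.2 ∈ Ioo a T :=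
      fun p hp => ⟨h0.trans hp.2.1, hp.2.2.trans_lt h1⟩
    have hms : MeasurableSet (univ ×ˢ Ioc t₀ t₁ : Set (Eu n × ℝ)) :=
      MeasurableSet.univ.prod measurableSet_Ioc
    have e1 : ∀ t ∈ Ioo a T, ∀ x, energy ρ W (A t) (u t) x = gaugeEnergy (lieForm G) (actForm ρ)
      (gForm G) stDir (stConn A) (stScalar u) W (x, t) := fun t ht x => h.energy_eq (p := (x, t)) ht
    simp only [e1 t₀ m0, e1 t₁ m1]
    refine (le_of_eq_of_le (congrArg₂ (· + ·) rfl (setLIntegral_congr_fun hms fun p hp => ?_))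
      key).trans_eq (congrArg₂ (· + ·) rfl (setLIntegral_congr_fun hms fun p hp => ?_))
    · simp only [h.selfSimSq_eq (mI p hp)]
    · simp only [h.energy_eq (mI p hp)]
  · intro p hp
    refine ContinuousAt.continuousWithinAt (continuousAt_const.mul ((cw p hp).continuousAt.mul ?_))
    refine tendsto_finsetSum _ fun v _ => tendsto_finsetSum _ fun w _ => ?_
    have hc : ∀ v : Option (Fin n), ContinuousAt (fun p => (v.elim 1 (selfSimCoeff X S · p) : ℝ)) p :=
      fun v => by
        cases v with
        | none => exact continuousAt_const
        | some k => exact (cs k p hp).continuousAt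
    exact ((hc v).mul (hc w)).mul (cst v w p hp).continuousAt
  · intro p hp
    have hcg : ∀ i, ContinuousAt (cutoffGrad η R X i) p := fun i => by
      have c1 : Continuous fun p : Eu n × ℝ => deriv η ((4 * R ^ 2 - ‖p.1 - X‖ ^ 2) * (3 * R ^ 2)⁻¹) :=
        (hη.continuous_deriv (by simp)).comp (by fun_prop)
      exact (c1.mul (by fun_prop)).continuousAt
    refine ContinuousAt.continuousWithinAt (((contDiffAt_heatKer X (hlt p hp)).continuousAt.mul
      ((continuousAt_const.mul (tendsto_finsetSum _ fun i _ => (hcg i).pow 2)).add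
        ((continuousAt_const.mul (contDiff_cutoff hη).continuous.continuousAt).mul
          (tendsto_finsetSum _ fun i _ => (hcg i).mul (cs i p hp).continuousAt)))).mul
      (ce p hp).continuousAt)
  · intro p hp
    exact mul_nonneg (mul_nonneg (heatKer_nonneg (hlt p hp)) (sq_nonneg _))
      (gaugeEnergy_nonneg hg hW0 p)
  · intro p hp
    exact mul_nonneg (by norm_num) (mul_nonneg (mul_nonneg (heatKer_nonneg (hlt p hp)) (sq_nonneg _))
      (spaceTimeQuad_stress_nonneg hg _ p))
  · intro p hp; simp [hw0 p hp]
  · intro i p hp; simp [energyFlux, hw0 p hp]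
  · intro p hp; simp [hw0 p hp]
  · intro p hp
    have := five_halves_lt_of_notMem_ball hR (hball p hp)
    simp [cutoffGrad_eq_zero hη0 hR this]
  · intro p hp
    have hp' := hlt p hp
    exact dirD_weighted_energy_le hg (h.contDiffAt_conn hp.2) (h.contDiffAt_scalar hp.2) hW hW0
      (h.stress_law hρ hinv hW hp.2)
      (div_nonpos_of_nonneg_of_nonpos zero_le_one (by linarith))
      (heatKer_nonneg hp') ((cw p hp).differentiableAt (by simp))
      (fun k => (cs k p hp).differentiableAt (by simp))
      (fun i k => dirD_selfSimCoeff X i k hp') rfl (dirD_weight_space hη hp')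
      (dirD_weight_time hη hp')

end Monotonicity
section HeatBall

open Real

variable {n : ℕ}

theorem neg_mul_log_le {s : ℝ} (hs : 0 < s) : s * -log s ≤ 1 / exp 1 := by
  have h := log_le_sub_one_of_pos (x := 1 / (s * exp 1)) (by positivity)
  rw [log_div one_ne_zero (by positivity), log_one, log_mul hs.ne' (exp_pos _).ne', log_exp] at h
  have h2 : -log s ≤ 1 / (s * exp 1) := by linarith
  calc s * -log s ≤ s * (1 / (s * exp 1)) := mul_le_mul_of_nonneg_left h2 hs.le
    _ = _ := by field_simp

theorem mul_neg_log_le_cBall_sq (hn : 4 < n) {r σ : ℝ} (hr : 0 < r) (hσ : 0 < σ) :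
    2 * ((n : ℝ) - 4) * σ * -log (4 * π * σ / r ^ 2) ≤ (cBall n * r) ^ 2 := by
  have hn' : (4 : ℝ) < n := by exact_mod_cast hn
  have hs : 0 < 4 * π * σ / r ^ 2 := by positivity
  have h := neg_mul_log_le hs
  rw [mul_pow, cBall_sq hn]
  calc 2 * ((n : ℝ) - 4) * σ * -log (4 * π * σ / r ^ 2)
      = ((n : ℝ) - 4) / (2 * π) * r ^ 2 * (4 * π * σ / r ^ 2 * -log (4 * π * σ / r ^ 2)) := by
        field_simp; ring
    _ ≤ ((n : ℝ) - 4) / (2 * π) * r ^ 2 * (1 / exp 1) :=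
        mul_le_mul_of_nonneg_left h
          (mul_nonneg (div_nonneg (by linarith) (by positivity)) (by positivity))
    _ = _ := by field_simp

theorem lt_of_mem_heatBall (hn : 4 < n) {r T : ℝ} (hr : 0 < r) {X : Eu n} {p : Eu n × ℝ}
    (hp : p ∈ heatBall r X T) : T - r ^ 2 / (4 * π) < p.2 ∧ ‖p.1 - X‖ ≤ cBall n * r := by
  have hn' : (4 : ℝ) < n := by exact_mod_cast hn
  obtain ⟨hT, hp⟩ := hp
  have hσ : 0 < T - p.2 := sub_pos.2 hT
  set m : ℝ := ((n : ℝ) - 4) / 2 with hm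
  have hm0 : 0 < m := by rw [hm]; linarith
  set σ := T - p.2 with hσd
  have hs : 0 < 4 * π * σ / r ^ 2 := by positivity
  have e1 : ‖p.1 - X‖ ^ 2 / (4 * (p.2 - T)) = -(‖p.1 - X‖ ^ 2 / (4 * σ)) := by
    rw [hσd, ← div_neg]; congr 1; ring
  have h1 : log (1 / (r ^ 2) ^ m) < log (1 / (4 * π * σ) ^ m * exp (-(‖p.1 - X‖ ^ 2 / (4 * σ)))) := by
    refine log_lt_log (by positivity) ?_
    rw [hm, sq_rpow_half hn hr, ← e1]
    exact hp
  rw [log_mul (by positivity) (exp_pos _).ne', log_exp, one_div, one_div, log_inv, log_inv,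
    log_rpow (by positivity), log_rpow (by positivity)] at h1
  have h2 : ‖p.1 - X‖ ^ 2 / (4 * σ) < m * -log (4 * π * σ / r ^ 2) := by
    rw [log_div (by positivity) (by positivity)]
    linarith
  constructor
  · have h3 : 0 < m * -log (4 * π * σ / r ^ 2) := lt_of_le_of_lt (by positivity) h2
    have h4 : log (4 * π * σ / r ^ 2) < 0 := by
      have := (mul_pos_iff_of_pos_left hm0).1 h3
      linarith
    have h5 := (log_neg_iff hs).1 h4
    rw [div_lt_one (by positivity)] at h5
    have : σ < r ^ 2 / (4 * π) := by rw [lt_div_iff₀ (by positivity)]; linarith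
    linarith
  · have h3 := mul_neg_log_le_cBall_sq hn hr hσ
    rw [div_lt_iff₀ (by positivity)] at h2
    have h4 : m * -log (4 * π * σ / r ^ 2) * (4 * σ)
        = 2 * ((n : ℝ) - 4) * σ * -log (4 * π * σ / r ^ 2) := by rw [hm]; ring
    exact le_of_sq_le_sq (by linarith) (mul_nonneg (cBall_pos hn).le hr.le)

theorem heatRadius_sq (hn : 4 < n) {r σ : ℝ} (hr : 0 < r) (hσ : 0 < σ)
    (h : σ < exp (-(1 / (2 * ((n : ℝ) - 4)))) * (r ^ 2 / (4 * π))) :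
    σ < heatRadius n r (-σ) ^ 2 ∧ heatRadius n r (-σ) ≤ cBall n * r := by
  have hn' : (4 : ℝ) < n := by exact_mod_cast hn
  have hs : 0 < 4 * π * σ / r ^ 2 := by positivity
  have h1 : 4 * π * σ / r ^ 2 < exp (-(1 / (2 * ((n : ℝ) - 4)))) := by
    rw [div_lt_iff₀ (by positivity)]
    calc 4 * π * σ < 4 * π * (exp (-(1 / (2 * ((n : ℝ) - 4)))) * (r ^ 2 / (4 * π))) :=
          mul_lt_mul_of_pos_left h (by positivity)
      _ = _ := by field_simp
  have h2 := (log_lt_iff_lt_exp hs).2 h1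
  have h3 : σ < 2 * ((n : ℝ) - 4) * σ * -log (4 * π * σ / r ^ 2) := by
    have h4 : 1 / (2 * ((n : ℝ) - 4)) < -log (4 * π * σ / r ^ 2) := by linarith
    have h5 : 0 < 2 * ((n : ℝ) - 4) * σ := mul_pos (by linarith) hσ
    calc σ = 2 * ((n : ℝ) - 4) * σ * (1 / (2 * ((n : ℝ) - 4))) := by
          have : (n : ℝ) - 4 ≠ 0 := by linarith
          field_simp
      _ < _ := mul_lt_mul_of_pos_left h4 h5
  have e : heatRadius n r (-σ) = √(2 * ((n : ℝ) - 4) * σ * -log (4 * π * σ / r ^ 2)) := by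
    rw [heatRadius, show -(4 * π * -σ) = 4 * π * σ by ring]
    congr 1
    ring
  rw [e, sq_sqrt (hσ.trans h3).le]
  refine ⟨h3, (sqrt_le_sqrt (mul_neg_log_le_cBall_sq hn hr hσ)).trans_eq ?_⟩
  exact sqrt_sq (mul_nonneg (cBall_pos hn).le hr.le)

theorem heatKer_le_of_le_time (hn : 4 < n) {r S t : ℝ} (hr : 0 < r) (h : r ^ 2 / (4 * π) ≤ S - t)
    (X x : Eu n) : heatKer X S x t ≤ 1 / r ^ (n - 4) := by
  have hn' : (4 : ℝ) < n := by exact_mod_cast hn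
  have h0 : 0 < S - t := lt_of_lt_of_le (by positivity) h
  rw [← sq_rpow_half hn hr, heatKer]
  have h1 : exp (‖x - X‖ ^ 2 / (4 * (t - S))) ≤ 1 := exp_le_one_iff.2
    (div_nonpos_of_nonneg_of_nonpos (sq_nonneg _) (by linarith))
  have h2 : r ^ 2 ≤ 4 * π * (S - t) := by
    rw [div_le_iff₀ (by positivity)] at h; linarith
  have h3 : (r ^ 2) ^ (((n : ℝ) - 4) / 2) ≤ (4 * π * (S - t)) ^ (((n : ℝ) - 4) / 2) :=
    rpow_le_rpow (sq_nonneg _) h2 (by linarith)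
  have h4 : 0 < (r ^ 2) ^ (((n : ℝ) - 4) / 2) := by positivity
  calc _ ≤ 1 / (4 * π * (S - t)) ^ (((n : ℝ) - 4) / 2) :=
        mul_le_of_le_one_right (one_div_nonneg.2 (h4.le.trans h3)) h1
    _ ≤ _ := one_div_le_one_div_of_le h4 h3

theorem le_heatKer_of_norm_le (hn : 4 < n) {R t : ℝ} (hR : 0 < R) {X x : Eu n}
    (hx : ‖x - X‖ ≤ R) :
    1 / R ^ (n - 4) ≤ (4 * π) ^ (((n : ℝ) - 4) / 2) * exp (1 / 4) * heatKer X (t + R ^ 2) x t := by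
  have hP : 0 < (4 * π) ^ (((n : ℝ) - 4) / 2) := rpow_pos_of_pos (by positivity) _
  have h1 : exp (-(1 / 4)) ≤ exp (‖x - X‖ ^ 2 / (4 * (t - (t + R ^ 2)))) := by
    rw [exp_le_exp, show 4 * (t - (t + R ^ 2)) = -(4 * R ^ 2) by ring, div_neg, neg_le_neg_iff,
      div_le_iff₀ (by positivity)]
    have := pow_le_pow_left₀ (norm_nonneg _) hx 2
    linarith
  rw [heatKer, add_sub_cancel_left, mul_rpow (by positivity) (sq_nonneg R), sq_rpow_half hn hR]
  calc 1 / R ^ (n - 4) = (4 * π) ^ (((n : ℝ) - 4) / 2) * exp (1 / 4)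
        * (1 / ((4 * π) ^ (((n : ℝ) - 4) / 2) * R ^ (n - 4)) * exp (-(1 / 4))) := by
        rw [exp_neg]; field_simp
    _ ≤ _ := by gcongr

theorem measurableSet_heatBall (r : ℝ) (X : Eu n) (T : ℝ) : MeasurableSet (heatBall r X T) := by
  have h : Measurable fun p : Eu n × ℝ => heatKer X T p.1 p.2 := by
    unfold heatKer
    fun_prop
  have h1 : MeasurableSet {p : Eu n × ℝ | p.2 < T} := measurableSet_lt measurable_snd measurable_const
  have h2 : MeasurableSet {p : Eu n × ℝ | 1 / r ^ (n - 4) < heatKer X T p.1 p.2} :=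
    measurableSet_lt measurable_const h
  exact h1.inter h2

end HeatBall
section Main

open Set MeasureTheory

variable {n d : ℕ} {G : Type*} [Group G] [TopologicalSpace G] [ChartedSpace (Eu d) G]
  [LieGroup (𝓡 d) ∞ G] [CompactSpace G] [LieAlgebra.IsSemisimple ℝ (GroupLieAlgebra (𝓡 d) G)]
  {V : Type*} [NormedAddCommGroup V] [InnerProductSpace ℝ V]
  {ρ : G →* (V →L[ℝ] V)} {W : ℝ → ℝ} {a T : ℝ} {A : ℝ → Fin n → Eu n → Eu d}
  {u : ℝ → Eu n → V} {η : ℝ → ℝ} {X : Eu n}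

theorem IsFlow.weighted_energy_le_ballEnergy (h : IsFlow ρ W a T A u)
    (hρ : ContMDiff (𝓡 d) 𝓘(ℝ, V →L[ℝ] V) ∞ ρ)
    (hinv : ∀ (g : G) (v w : V), inner ℝ (ρ g v) (ρ g w) = inner ℝ v w)
    (hW : ContDiff ℝ 1 W) (hW0 : ∀ s, 0 ≤ W s) (hn : 4 < n) (hη : ContDiff ℝ ∞ η)
    (hη01 : ∀ s, η s ∈ Icc (0 : ℝ) 1) (hη0 : ∀ s, s < 1 / 2 → η s = 0) {c r : ℝ} (hr : 0 < r)
    (hc : ∀ (S : ℝ) (p : Eu n × ℝ), p.2 < S →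
      heatKer X S p.1 p.2 * (8 * ∑ i, cutoffGrad η (cBall n * r) X i p ^ 2
        + 2 * cutoff η (cBall n * r) X p
          * ∑ i, cutoffGrad η (cBall n * r) X i p * selfSimCoeff X S i p) ≤ c / r ^ (n - 2))
    {S t : ℝ} (hS : T ≤ S) (h0 : a < T - r ^ 2 / (4 * Real.pi))
    (h01 : T - r ^ 2 / (4 * Real.pi) ≤ t) (h1 : t < T) :
    (∫⁻ x, ENNReal.ofReal (weight η (cBall n * r) X S (x, t) * energy ρ W (A t) (u t) x))
        + ∫⁻ p in univ ×ˢ Ioc (T - r ^ 2 / (4 * Real.pi)) t, ENNReal.ofReal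
          (1 / 2 * (weight η (cBall n * r) X S p * selfSimSq ρ X S A u p.1 p.2))
      ≤ ENNReal.ofReal (1 / r ^ (n - 4))
          * ballEnergy ρ W A u X (2 * cBall n * r) (T - r ^ 2 / (4 * Real.pi))
        + ENNReal.ofReal (c / r ^ (n - 2)) * cylEnergy ρ W A u X T r := by
  have hR : 0 < cBall n * r := mul_pos (cBall_pos hn) hr
  refine (h.weighted_energy_le hρ hinv hW hW0 hη hη0 hR hS h01 h0 h1).trans (add_le_add ?_ ?_)
  · set t₀ := T - r ^ 2 / (4 * Real.pi) with ht₀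
    have hm : MeasurableSet (Metric.ball X (2 * cBall n * r)) := measurableSet_ball
    rw [ballEnergy, ← lintegral_const_mul' _ _ ENNReal.ofReal_ne_top, ← lintegral_indicator hm]
    refine lintegral_mono fun x => ?_
    by_cases hx : x ∈ Metric.ball X (2 * cBall n * r)
    · rw [indicator_of_mem hx, ← ENNReal.ofReal_mul (by positivity)]
      refine ENNReal.ofReal_le_ofReal (mul_le_mul_of_nonneg_right ?_
        (h.energy_nonneg hρ hinv hW0 (p := (x, t₀)) ⟨h0, h01.trans_lt h1⟩))
      have hK : 0 ≤ heatKer X S x t₀ := heatKer_nonneg (h01.trans_lt (h1.trans_le hS))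
      have hz : cutoff η (cBall n * r) X (x, t₀) ^ 2 ≤ 1 :=
        pow_le_one₀ (hη01 _).1 (hη01 _).2
      exact (mul_le_of_le_one_right hK hz).trans (heatKer_le_of_le_time hn hr (by linarith) X x)
    · rw [weight_eq_zero hη0 hR (by rwa [← mul_assoc])]
      simp
  · set t₀ := T - r ^ 2 / (4 * Real.pi) with ht₀
    have hB : MeasurableSet (Metric.ball X (2 * cBall n * r) ×ˢ (univ : Set ℝ)) :=
      measurableSet_ball.prod MeasurableSet.univ
    rw [cylEnergy, ← ht₀, ← h.lintegral_energy_eq hW X _ h0,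
      ← lintegral_const_mul' _ _ ENNReal.ofReal_ne_top]
    calc _ ≤ ∫⁻ p in univ ×ˢ Ioc t₀ t, (Metric.ball X (2 * cBall n * r) ×ˢ (univ : Set ℝ)).indicator
          (fun p => ENNReal.ofReal (c / r ^ (n - 2))
            * ENNReal.ofReal (energy ρ W (A p.2) (u p.2) p.1)) p := by
          refine setLIntegral_mono' (MeasurableSet.univ.prod measurableSet_Ioc) fun p hp => ?_
          have hpT : p.2 ∈ Ioo a T := ⟨h0.trans hp.2.1, hp.2.2.trans_lt h1⟩
          have he := h.energy_nonneg hρ hinv hW0 hpT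
          by_cases hx : p.1 ∈ Metric.ball X (2 * cBall n * r)
          · rw [indicator_of_mem (show p ∈ _ ×ˢ _ from ⟨hx, mem_univ _⟩), ← ENNReal.ofReal_mul' he]
            exact ENNReal.ofReal_le_ofReal (mul_le_mul_of_nonneg_right
              (hc S p (hpT.2.trans_le hS)) he)
          · have := five_halves_lt_of_notMem_ball hR (by rwa [← mul_assoc])
            simp [cutoffGrad_eq_zero hη0 hR this]
      _ = ∫⁻ p in (Metric.ball X (2 * cBall n * r) ×ˢ (univ : Set ℝ)) ∩ univ ×ˢ Ioc t₀ t,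
          ENNReal.ofReal (c / r ^ (n - 2)) * ENNReal.ofReal (energy ρ W (A p.2) (u p.2) p.1) :=
          setLIntegral_indicator hB _
      _ ≤ _ := lintegral_mono_set (t := Metric.ball X (2 * cBall n * r) ×ˢ Ioo t₀ T)
          fun p hp => ⟨hp.1.1, hp.2.2.1, hp.2.2.2.trans_lt h1⟩

theorem IsFlow.lintegral_heatBall_le (h : IsFlow ρ W a T A u)
    (hρ : ContMDiff (𝓡 d) 𝓘(ℝ, V →L[ℝ] V) ∞ ρ)
    (hinv : ∀ (g : G) (v w : V), inner ℝ (ρ g v) (ρ g w) = inner ℝ v w)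
    (hn : 4 < n) (hη1 : ∀ s, 1 ≤ s → η s = 1) {r : ℝ} (hr : 0 < r)
    (h0 : a < T - r ^ 2 / (4 * Real.pi)) {C : ENNReal}
    (hC : ∀ t, T - r ^ 2 / (4 * Real.pi) ≤ t → t < T →
      ∫⁻ p in univ ×ˢ Ioc (T - r ^ 2 / (4 * Real.pi)) t, ENNReal.ofReal
          (1 / 2 * (weight η (cBall n * r) X T p * selfSimSq ρ X T A u p.1 p.2)) ≤ C) :
    ∫⁻ p in heatBall r X T, ENNReal.ofReal (selfSimSq ρ X T A u p.1 p.2)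
      ≤ ENNReal.ofReal (2 * r ^ (n - 4)) * C := by
  set t₀ := T - r ^ 2 / (4 * Real.pi) with ht₀
  have h0T : t₀ < T := sub_lt_self _ (by positivity)
  have hR : 0 < cBall n * r := mul_pos (cBall_pos hn) hr
  obtain ⟨s, hsm, hsT, hst⟩ := exists_seq_strictMono_tendsto' h0T
  have hU : heatBall r X T = ⋃ k, heatBall r X T ∩ univ ×ˢ Ioc t₀ (s k) := by
    refine Subset.antisymm (fun p hp => ?_) (iUnion_subset fun k => inter_subset_left)
    obtain ⟨k, hk⟩ := (hst.eventually (lt_mem_nhds hp.1)).exists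
    exact mem_iUnion.2 ⟨k, hp, mem_univ _, (lt_of_mem_heatBall hn hr hp).1, hk.le⟩
  rw [hU, setLIntegral_iUnion_of_directed]
  · refine iSup_le fun k => ?_
    refine le_trans ?_ (mul_le_mul_right (hC (s k) (hsT k).1.le (hsT k).2) _)
    rw [← lintegral_const_mul' _ _ ENNReal.ofReal_ne_top]
    refine le_trans ?_ (lintegral_mono_set (s := heatBall r X T ∩ univ ×ˢ Ioc t₀ (s k))
      inter_subset_right)
    refine setLIntegral_mono' ((measurableSet_heatBall r X T).inter
      (MeasurableSet.univ.prod measurableSet_Ioc)) fun p hp => ?_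
    have hq := h.selfSimSq_nonneg hρ hinv (p := p) ⟨h0.trans hp.2.2.1, hp.1.1⟩ X T
    rw [← ENNReal.ofReal_mul (by positivity)]
    refine ENNReal.ofReal_le_ofReal ?_
    have hw : weight η (cBall n * r) X T p = heatKer X T p.1 p.2 := by
      rw [weight, cutoff_eq_one hη1 hR (lt_of_mem_heatBall hn hr hp.1).2]
      ring
    have hk : 1 ≤ r ^ (n - 4) * heatKer X T p.1 p.2 := by
      have := hp.1.2.le
      rwa [div_le_iff₀' (by positivity)] at this
    rw [hw]
    calc _ ≤ (r ^ (n - 4) * heatKer X T p.1 p.2) * selfSimSq ρ X T A u p.1 p.2 :=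
          le_mul_of_one_le_left hq hk
      _ = _ := by ring
  · exact directed_of_isDirected_le fun i j hij => inter_subset_inter_right _
      (prod_mono_right (Ioc_subset_Ioc_right (hsm.monotone hij)))

theorem IsFlow.ballEnergy_le (h : IsFlow ρ W a T A u)
    (hρ : ContMDiff (𝓡 d) 𝓘(ℝ, V →L[ℝ] V) ∞ ρ)
    (hinv : ∀ (g : G) (v w : V), inner ℝ (ρ g v) (ρ g w) = inner ℝ v w) (hW0 : ∀ s, 0 ≤ W s)
    (hn : 4 < n) (hη1 : ∀ s, 1 ≤ s → η s = 1) {r R t : ℝ} (hr : 0 < r) (hR : 0 < R)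
    (hRr : R ≤ cBall n * r) (ht : t ∈ Ioo a T) :
    ENNReal.ofReal (1 / R ^ (n - 4)) * ballEnergy ρ W A u X R t
      ≤ ENNReal.ofReal ((4 * Real.pi) ^ (((n : ℝ) - 4) / 2) * Real.exp (1 / 4))
        * ∫⁻ x, ENNReal.ofReal (weight η (cBall n * r) X (t + R ^ 2) (x, t)
          * energy ρ W (A t) (u t) x) := by
  have hP : 0 ≤ (4 * Real.pi) ^ (((n : ℝ) - 4) / 2) * Real.exp (1 / 4) := by positivity
  generalize hK : (4 * Real.pi) ^ (((n : ℝ) - 4) / 2) * Real.exp (1 / 4) = K at hP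
  have hle : ∀ x ∈ Metric.ball X R,
      ENNReal.ofReal (1 / R ^ (n - 4)) * ENNReal.ofReal (energy ρ W (A t) (u t) x)
        ≤ ENNReal.ofReal K * ENNReal.ofReal (weight η (cBall n * r) X (t + R ^ 2) (x, t)
          * energy ρ W (A t) (u t) x) := fun x hx => by
    rw [Metric.mem_ball, dist_eq_norm] at hx
    have hw : weight η (cBall n * r) X (t + R ^ 2) (x, t) = heatKer X (t + R ^ 2) x t := by
      rw [weight, cutoff_eq_one (p := (x, t)) hη1 (mul_pos (cBall_pos hn) hr) (hx.le.trans hRr),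
        one_pow, mul_one]
    rw [← ENNReal.ofReal_mul (by positivity), ← ENNReal.ofReal_mul hP, hw, ← mul_assoc, ← hK]
    exact ENNReal.ofReal_le_ofReal (mul_le_mul_of_nonneg_right (le_heatKer_of_norm_le hn hR hx.le)
      (h.energy_nonneg hρ hinv hW0 (p := (x, t)) ht))
  rw [ballEnergy, ← lintegral_const_mul' _ _ ENNReal.ofReal_ne_top,
    ← lintegral_const_mul' _ _ ENNReal.ofReal_ne_top]
  exact (setLIntegral_mono' measurableSet_ball hle).trans (setLIntegral_le_lintegral _ _)

end Main
end
end YMH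

theorem lemma3p1
    (n : ℕ) (hn : 4 < n)
    (η : ℝ → ℝ) (hη : ContDiff ℝ ∞ η) (hη01 : ∀ s, η s ∈ Set.Icc (0 : ℝ) 1)
    (hη0 : ∀ s, s < 1 / 2 → η s = 0) (hη1 : ∀ s, 1 ≤ s → η s = 1) :
    ∃ c : ℝ, 0 < c ∧
      ∀ (d : ℕ) (G : Type*) [Group G] [TopologicalSpace G] [ChartedSpace (YMH.Eu d) G]
        [LieGroup (𝓡 d) ∞ G] [CompactSpace G] [ConnectedSpace G]
        [LieAlgebra.IsSemisimple ℝ (GroupLieAlgebra (𝓡 d) G)]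
        (V : Type*) [NormedAddCommGroup V] [InnerProductSpace ℝ V] [FiniteDimensional ℝ V]
        (ρ : G →* (V →L[ℝ] V))
        (_ : ContMDiff (𝓡 d) (𝓘(ℝ, V →L[ℝ] V)) ∞ ρ)
        (_ : ∀ (g : G) (v w : V), inner ℝ (ρ g v) (ρ g w) = inner ℝ v w)
        (W : ℝ → ℝ) (_ : ContDiff ℝ 1 W) (_ : ∀ s, 0 ≤ W s)
        (a T : ℝ) (X : YMH.Eu n)
        (A : ℝ → Fin n → YMH.Eu n → YMH.Eu d) (u : ℝ → YMH.Eu n → V)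
        (_ : YMH.IsFlow ρ W a T A u)
        (r : ℝ) (_ : 0 < r) (_ : r < Real.sqrt (4 * Real.pi * (T - a))),
        (∫⁻ p in YMH.heatBall r X T, ENNReal.ofReal (YMH.selfSimSq ρ X T A u p.1 p.2)
          ≤ ENNReal.ofReal (2 * c / r ^ 2) * YMH.cylEnergy ρ W A u X T r
            + 2 * YMH.ballEnergy ρ W A u X (2 * YMH.cBall n * r) (T - r ^ 2 / (4 * Real.pi)))
        ∧ ∀ t ∈ Set.Ioo
            (T - Real.exp (-(1 / (2 * ((n : ℝ) - 4)))) * (r ^ 2 / (4 * Real.pi))) T,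
          ENNReal.ofReal (1 / YMH.heatRadius n r (t - T) ^ (n - 4))
              * YMH.ballEnergy ρ W A u X (YMH.heatRadius n r (t - T)) t
            ≤ ENNReal.ofReal ((4 * Real.pi) ^ (((n : ℝ) - 4) / 2) * Real.exp (1 / 4))
              * (ENNReal.ofReal (c / r ^ (n - 2)) * YMH.cylEnergy ρ W A u X T r
                + ENNReal.ofReal (1 / r ^ (n - 4))
                  * YMH.ballEnergy ρ W A u X (2 * YMH.cBall n * r)
                      (T - r ^ 2 / (4 * Real.pi))) := by
  obtain ⟨c, hc0, hc⟩ := YMH.exists_cutoff_error_le hn hη hη01 hη0 hη1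
  refine ⟨c, hc0, ?_⟩
  intro d G _ _ _ _ _ _ _ V _ _ _ ρ hρ hinv W hW hW0 a T X A u h r hr hra
  have h0 : a < T - r ^ 2 / (4 * Real.pi) := by
    rw [Real.lt_sqrt hr.le] at hra
    have : r ^ 2 / (4 * Real.pi) < T - a := by rw [div_lt_iff₀ (by positivity)]; linarith
    linarith
  have key := fun (S t : ℝ) => h.weighted_energy_le_ballEnergy hρ hinv hW hW0 hn hη hη01 hη0 hr
    (fun S p => hc r X S p hr) (S := S) (t := t)
  constructor
  · refine (h.lintegral_heatBall_le hρ hinv hn hη1 hr h0 fun t ht hT =>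
      le_add_self.trans (key T t le_rfl h0 ht hT)).trans_eq ?_
    rw [mul_add, ← mul_assoc, ← mul_assoc, ← ENNReal.ofReal_mul (by positivity),
      ← ENNReal.ofReal_mul (by positivity), add_comm]
    have e1 : 2 * r ^ (n - 4) * (1 / r ^ (n - 4)) = 2 := by field_simp
    have e2 : 2 * r ^ (n - 4) * (c / r ^ (n - 2)) = 2 * c / r ^ 2 := by
      have : r ^ (n - 2) = r ^ (n - 4) * r ^ 2 := by rw [← pow_add]; congr 1; omega
      rw [this]; field_simp
    rw [e1, e2, ENNReal.ofReal_ofNat]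
  · intro t ht
    have hσ : 0 < T - t := sub_pos.2 ht.2
    have hn' : (4 : ℝ) < n := by exact_mod_cast hn
    obtain ⟨hR1, hR2⟩ := YMH.heatRadius_sq hn hr hσ (by linarith [ht.1])
    rw [neg_sub] at hR1 hR2
    have hR0 : 0 < YMH.heatRadius n r (t - T) :=
      lt_of_le_of_ne (Real.sqrt_nonneg _) fun h => by
        rw [← h] at hR1; norm_num at hR1; linarith [ht.2]
    have hexp : Real.exp (-(1 / (2 * ((n : ℝ) - 4)))) ≤ 1 := Real.exp_le_one_iff.2
      (neg_nonpos.2 (one_div_nonneg.2 (by linarith)))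
    have ht0 : T - r ^ 2 / (4 * Real.pi) ≤ t := by
      have := mul_le_of_le_one_left (b := r ^ 2 / (4 * Real.pi)) (by positivity) hexp
      linarith [ht.1]
    refine (h.ballEnergy_le hρ hinv hW0 hn hη1 hr hR0 hR2 ⟨h0.trans_le ht0, ht.2⟩).trans
      (mul_le_mul_right ((le_self_add.trans (key _ t (by linarith) h0 ht0 ht.2)).trans_eq
        (add_comm _ _)) _)
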